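/- **Setting.** In (unweighted) caching with cache size $k$, a configuration is a set of $k$ pages; for configurations $x,y$ let $\mathrm{dist}(x,y)=|y\setminus x|$. An input consists of an initial configuration $x_0$ and requests $r_1,\dots,r_T$. An offline algorithm $\mathrm{Off}$ is a sequence of configurations $o_0=x_0,o_1,\dots,o_T$ with $r_t\in o_t$ for $1\le t\le T$; its cost, also written $\mathrm{Off}$, is $\sum_{t=1}^T\mathrm{dist}(o_{t-1},o_t)$. Together with $r_t$ the online algorithm receives a predicted configuration $P_t$. The predictor is lazy: for some configuration $P_0$ and all $1\le t\le T$, $P_t=P_{t-1}$ if $r_t\in P_{t-1}$, and otherwise $P_t=(P_{t-1}\setminus\{q\})\cup\{r_t\}$ for some $q\in P_{t-1}$. The prediction error with respect to $\mathrm{Off}$ is $\eta=\sum_{t=1}^T \mathrm{dist}(P_t,o_t)$. **The algorithm Trust&Doubt.** It starts with the cache content $x_0$. Each eviction of a page together with the loading of another one costs $1$. The requests are divided into phases; the first begins with the first request, and a new one begins right before a request to a page different from the $k$ distinct pages already requested in the current phase. A page is *marked* if it was requested in the current phase; its first request in the phase is its *arrival*. At the beginning of a phase the set $A$ of *ancient*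 pages consists of the pages in the cache that were not requested in the previous phase (all of $x_0$ in the first phase), and the other pages in the cache are called *stale* throughout the phase. While $A\neq\emptyset$: a requested page of $A$ leaves $A$, and at a page fault an arbitrary page of $A$ is evicted (leaving $A$) and the requested page is loaded. A non-stale page that arrives in the phase after $A$ has become empty is *clean*; $C$ is the set of clean pages that have arrived so far in the phase. For each $q\in C$ the algorithm maintains a page $p_q$, a Boolean $\mathrm{trusted}(q)$ and a threshold $t_q$. Let $\mathcal T=\{p_q: q\in C,\ \mathrm{trusted}(q)\}$, $D=\{p_q: q\in C,\ \neg\,\mathrm{trusted}(q)\}$, let $U$ be the set of unmarked stale pages not in $\mathcal T$, and $M$ the set of marked pages not in $\mathcal T$. When $A$ becomes empty (possibly at the very beginning of the phase), a uniformly random permutation of $U$ is sampled, independently of the past, and the priority of a page of $U$ is its rank. From then on in the phase, a request $r$ with prediction $P$ is marked and handled as follows. 1. If $r$ is not in the cache, evict the page of lowest priority among the pages of $U$ in the cache, and load $r$. 2. If $r$ is clean and this is its arrival, let $p_r$ be an arbitrary page of $((U\cup M)\setminus D)\setminus P$, and set $\mathrm{trusted}(r)=\text{true}$, $t_r=1$;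 the first $r$-interval begins right before this arrival. 3. If $r=p_q$ for some $q\in C$, redefine $p_q$ to be an arbitrary page of $((U\cup M)\setminus D)\setminus P$, and set $\mathrm{trusted}(q)=\text{false}$. 4. For each $q\in C$ (in an arbitrary order) for which a new $q$-interval begins with this request: if $\mathrm{trusted}(q)=\text{false}$, double $t_q$ and set $\mathrm{trusted}(q)=\text{true}$; and if $p_q$ is in the cache, evict it and load the page of highest priority among the pages of $U$ missing from the cache. The new $q$-interval lasts for $t_q$ arrivals (counting the present one), after which the next arrival begins a new one. The arbitrary choices may be any functions of the requests and predictions seen so far; in particular the choices in steps 2–4 do not depend on the random priorities. (The choice of the ancient page to evict may depend on the algorithm's whole current state.) **Theorem.** There is a universal constant $c>0$ such that for every cache size $k\ge 2$ there is a constant $\alpha\ge 0$ such that, for all sets of pages, all ways of making the arbitrary choices, all $x_0$, all request sequences $r_1,\dots,r_T$ and all lazy predictions, the following holds. Trust&Doubt is well defined: with probability one, every page that it has to choose exists, and after every request its cache is a configuration of size $k$ containing the requested page. Moreover, for every offline algorithm $\mathrm{Off}$, with $\eta$ the prediction error with respect to $\mathrm{Off}$, $$\mathbb E[\text{cost of Trust\&Doubt}]\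 \le\ c\cdot\min\Bigl\{1+\log\Bigl(1+\frac{\eta}{\mathrm{Off}}\Bigr),\ \log k\Bigr\}\cdot \mathrm{Off}+\alpha ,$$ where the right-hand side is read as $\alpha$ if $\mathrm{Off}=0$. That is, Trust&Doubt has competitive ratio $O(\min\{1+\log(1+\eta/\mathrm{Off}),\log k\})$ against any offline algorithm. -/

import Mathlib

universe u

namespace Caching

variable {Page : Type u} [DecidableEq Page]

/-- Distance between two cache configurations: the number of pages that have to be exchanged. For
configurations of equal size this is symmetric, and it is the metric of caching as a task system. -/
def configDist (x y : Finset Page) : ℕ := (y \ x).card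

/-- `o 0, o 1, …, o T` is a way of serving the requests `r 1, …, r T` with a cache of size `k`,
starting from the configuration `x₀`: an offline algorithm's solution for this input. -/
structure IsSchedule (k : ℕ) (x₀ : Finset Page) (T : ℕ) (r : ℕ → Page)
    (o : ℕ → Finset Page) : Prop where
  init : o 0 = x₀
  card_eq : ∀ t ≤ T, (o t).card = k
  serves : ∀ t, 1 ≤ t → t ≤ T → r t ∈ o t

/-- The cost of a schedule: the number of pages it loads. -/
def scheduleCost (T : ℕ) (o : ℕ → Finset Page) : ℕ :=
  ∑ t ∈ Finset.Icc 1 T, configDist (o (t - 1)) (o t)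

/-- `P 1, …, P T` are the predicted configurations. The predictor is lazy: it changes its
configuration only when the requested page is missing from it, and then exchanges one page for the
requested one. -/
structure IsLazyPrediction (k : ℕ) (T : ℕ) (r : ℕ → Page) (P : ℕ → Finset Page) : Prop where
  card_init : (P 0).card = k
  stay : ∀ t, 1 ≤ t → t ≤ T → r t ∈ P (t - 1) → P t = P (t - 1)
  swap : ∀ t, 1 ≤ t → t ≤ T → r t ∉ P (t - 1) →
    ∃ q ∈ P (t - 1), P t = insert (r t) ((P (t - 1)).erase q)

/-- The prediction error `η` with respect to the schedule `o`. -/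
def predictionError (T : ℕ) (P o : ℕ → Finset Page) : ℕ :=
  ∑ t ∈ Finset.Icc 1 T, configDist (P t) (o t)

namespace TrustDoubt

/-- The state of the algorithm Trust&Doubt. -/
structure State (Page : Type u) where
  /-- the current cache content -/
  cache : Finset Page
  /-- the ancient pages -/
  A : Finset Page
  /-- the stale pages of the current phase -/
  stale : Finset Page
  /-- the pages requested so far in the current phase -/
  marked : Finset Page
  /-- the clean pages that have arrived so far in the current phase -/
  C : Finset Page
  /-- the page `p q` associated with a clean page `q` -/
  p : Page → Page
  /-- whether the advice to evict `p q` is currently trusted -/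
  trusted : Page → Bool
  /-- the threshold of a clean page -/
  thr : Page → ℕ
  /-- the number of arrivals in the phase at which the next `q`-interval begins -/
  change : Page → ℕ
  /-- the priorities -/
  prio : Page → ℕ
  /-- the number of pages loaded so far, i.e. the cost paid so far -/
  cost : ℕ

namespace State

/-- The trusted predicted evictions. -/
def T (s : State Page) : Finset Page := (s.C.filter fun q => s.trusted q = true).image s.p

/-- The doubted predicted evictions. -/
def D (s : State Page) : Finset Page := (s.C.filter fun q => s.trusted q = false).image s.p

/-- The unmarked stale pages that are not in `T`. -/
def U (s : State Page) : Finset Page := (s.stale \ s.marked) \ s.T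

/-- The marked pages that are not in `T`. -/
def M (s : State Page) : Finset Page := s.marked \ s.T

/-- The pages that may be defined as `p q`, when the predicted configuration is `P`. -/
def candidates (s : State Page) (P : Finset Page) : Finset Page := ((s.U ∪ s.M) \ s.D) \ P

/-- Evict `x` and load `y`, at cost `1`. -/
def swap (s : State Page) (x y : Page) : State Page :=
  { s with cache := insert y (s.cache.erase x), cost := s.cost + 1 }

end State

/-- What is known after some requests: the requests and the predictions up to now. -/
abbrev History (Page : Type u) := List (Page × Finset Page)

/-- The choices that the description of Trust&Doubt leaves open: which ancient page is evicted,
which of the candidates becomes `p q`, and in which order the clean pages are treated in the last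
step. The choice among the candidates may depend on all requests and predictions
seen so far, but not on the random priorities. -/
structure Choices (Page : Type u) where
  ancient : History Page → State Page → Page
  ancient_mem : ∀ h s, s.A.Nonempty → ancient h s ∈ s.A
  candidate : History Page → Finset Page → Page
  candidate_mem : ∀ h S, S.Nonempty → candidate h S ∈ S
  order : History Page → Finset Page → List Page
  order_nodup : ∀ h S, (order h S).Nodup
  mem_order : ∀ h S q, q ∈ order h S ↔ q ∈ S

/-- The page of lowest priority in `S`, if there is one. -/
noncomputable def lowest (prio : Page → ℕ) (S : Finset Page) : Option Page :=
  if h : S.Nonempty then some (S.exists_min_image prio h).choose else none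

/-- The page of highest priority in `S`, if there is one. -/
noncomputable def highest (prio : Page → ℕ) (S : Finset Page) : Option Page :=
  if h : S.Nonempty then some (S.exists_max_image prio h).choose else none

/-- The chosen candidate, if there is one. -/
def pick (ch : Choices Page) (h : History Page) (S : Finset Page) : Option Page :=
  if S.Nonempty then some (ch.candidate h S) else none

/-- At the start everything in the cache is ancient. -/
def init (x₀ : Finset Page) : State Page where
  cache := x₀
  A := x₀
  stale := ∅
  marked := ∅
  C := ∅
  p := id
  trusted := fun _ => false
  thr := fun _ => 0
  change := fun _ => 0
  prio := fun _ => 0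
  cost := 0

/-- Begin a new phase. -/
def newPhase (s : State Page) : State Page :=
  { s with
    A := s.cache \ s.marked
    stale := s.cache ∩ s.marked
    marked := ∅
    C := ∅ }

instance (S : Finset Page) : Nonempty ({x // x ∈ S} ≃ Fin S.card) := ⟨S.equivFin⟩

/-- Sample a uniformly random permutation of the pages in `U`; the priority of a page in `U` is its
rank in this permutation. -/
noncomputable def samplePriorities (s : State Page) : PMF (State Page) :=
  (PMF.uniformOfFintype ({x // x ∈ s.U} ≃ Fin s.U.card)).map fun e =>
    { s with prio := fun x => if hx : x ∈ s.U then (e ⟨x, hx⟩ : ℕ) else 0 }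

/-- Step 1: if the requested page `r` is missing, evict the unmarked page of lowest priority and
load `r`. -/
noncomputable def step1 (r : Page) (s : State Page) : Option (State Page) :=
  if r ∈ s.cache then some s
  else (lowest s.prio (s.U ∩ s.cache)).map fun x => s.swap x r

/-- Step 2: if `r` is a clean page that arrives now, define `p r` and trust it. -/
def step2 (ch : Choices Page) (h : History Page) (r : Page) (P : Finset Page) (isArrival : Bool)
    (s : State Page) : Option (State Page) :=
  if isArrival = true ∧ r ∉ s.stale then
    (pick ch h (s.candidates P)).map fun y =>
      { s with
        C := insert r s.C
        p := Function.update s.p r y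
        trusted := Function.update s.trusted r true
        thr := Function.update s.thr r 1
        change := Function.update s.change r s.marked.card }
  else some s

/-- Step 3: if `r = p q` for some clean page `q`, redefine `p q` and doubt it. -/
noncomputable def step3 (ch : Choices Page) (h : History Page) (r : Page) (P : Finset Page)
    (s : State Page) : Option (State Page) :=
  if hq : ∃ q ∈ s.C, s.p q = r then
    (pick ch h (s.candidates P)).map fun y =>
      { s with
        p := Function.update s.p hq.choose y
        trusted := Function.update s.trusted hq.choose false }
  else some s

/-- Begin a new `q`-interval: if the previous one was doubted, double the threshold and
trust `p q`. -/
def newInterval (q : Page) (s : State Page) : State Page :=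
  let t := if s.trusted q = false then 2 * s.thr q else s.thr q
  { s with
    thr := Function.update s.thr q t
    trusted := Function.update s.trusted q true
    change := Function.update s.change q (s.marked.card + t) }

/-- Step 4 for one clean page `q`: if a new `q`-interval begins with this request, trust `p q`; if
`p q` is in the cache, evict it and load the missing page of `U` of highest priority. -/
noncomputable def step4 (isArrival : Bool) (s : State Page) (q : Page) : Option (State Page) :=
  if isArrival = true ∧ s.change q = s.marked.card then
    let s' := newInterval q s
    if s'.p q ∈ s'.cache then
      (highest s'.prio (s'.U \ s'.cache)).map fun y => s'.swap (s'.p q) y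
    else some s'
  else some s

/-- Steps 1 to 4 in a row; `none` if at some point a page that should be chosen does not exist. -/
noncomputable def steps (ch : Choices Page) (h : History Page) (r : Page) (P : Finset Page)
    (isArrival : Bool) (s : State Page) : Option (State Page) := do
  let s₁ ← step1 r s
  let s₂ ← step2 ch h r P isArrival s₁
  let s₃ ← step3 ch h r P s₂
  (ch.order h s₃.C).foldlM (step4 isArrival) s₃

/-- Serving the request `r` while there are ancient pages. -/
def serveAncient (ch : Choices Page) (h : History Page) (r : Page) (s : State Page) : State Page :=
  if r ∈ s.A then { s with A := s.A.erase r }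
  else if r ∈ s.cache then s
  else { s.swap (ch.ancient h s) r with A := s.A.erase (ch.ancient h s) }

/-- Serving the request `r` within a phase: mark `r`, then treat it according to whether there are
ancient pages. Priorities are sampled once there are no more ancient pages. -/
noncomputable def serveInPhase (ch : Choices Page) (h : History Page) (r : Page) (P : Finset Page)
    (s : State Page) : PMF (Option (State Page)) :=
  let isArrival : Bool := decide (r ∉ s.marked)
  let s₁ : State Page := { s with marked := insert r s.marked }
  if s.A = ∅ then PMF.pure (steps ch h r P isArrival s₁)
  else
    let s₂ := serveAncient ch h r s₁
    if s₂.A = ∅ then (samplePriorities s₂).map some else PMF.pure (some s₂)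

/-- Trust&Doubt's reaction to a request `r` with predicted configuration `P`. A new phase begins
when `k` distinct pages have been requested in the current one and `r` is not one of them. -/
noncomputable def serve (k : ℕ) (ch : Choices Page) (h : History Page) (r : Page)
    (P : Finset Page) (s : State Page) : PMF (Option (State Page)) :=
  if s.marked.card = k ∧ r ∉ s.marked then
    (if (newPhase s).A = ∅ then samplePriorities (newPhase s) else PMF.pure (newPhase s)).bind
      (serveInPhase ch h r P)
  else serveInPhase ch h r P s

/-- The requests and predictions up to time `t`. -/
def history (r : ℕ → Page) (P : ℕ → Finset Page) (t : ℕ) : History Page :=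
  (List.range t).map fun i => (r (i + 1), P (i + 1))

/-- The distribution of the state of Trust&Doubt after the requests `r 1, …, r t` with predictions
`P 1, …, P t`, started from the configuration `x₀`; the outcome `none` means that the algorithm got
stuck because a page that it should choose did not exist. -/
noncomputable def run (k : ℕ) (ch : Choices Page) (x₀ : Finset Page) (r : ℕ → Page)
    (P : ℕ → Finset Page) : ℕ → PMF (Option (State Page))
  | 0 => PMF.pure (some (init x₀))
  | t + 1 => (run k ch x₀ r P t).bind fun o =>
      match o with
      | none => PMF.pure none
      | some s => serve k ch (history r P (t + 1)) (r (t + 1)) (P (t + 1)) s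

/-- The expected cost of Trust&Doubt on the requests `r 1, …, r T`, where getting stuck has
infinite cost. -/
noncomputable def expectedCost (k : ℕ) (ch : Choices Page) (x₀ : Finset Page) (r : ℕ → Page)
    (P : ℕ → Finset Page) (T : ℕ) : ENNReal :=
  ∑' o : Option (State Page), run k ch x₀ r P T o *
    (match o with
      | none => ⊤
      | some s => (s.cost : ENNReal))

end TrustDoubt

end Caching

/-! ### Expectations under probability mass functions, and uniformly random enumerations. -/

namespace Caching

/-! The proof separates what is random from what is not. Let `W` be the union of the stale and the
marked pages. While ancient pages remain, the cache is the disjoint union of `W` and `A`, so `A` is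
empty exactly when `W` has at least k elements; and a new phase makes the pages of `marked \ T`
stale. Hence marks, clean pages, the `p q`, trust flags and thresholds evolve deterministically
(`coreRun`). Only cache, ancient pages, priorities and cost need the full state. Laziness keeps each
`p q` outside the prediction until it is requested, and |C| = |W| - k makes the candidates for `p q`
nonempty by counting, so the algorithm never gets stuck (`exists_reachable_of_mem_support`).

Without ancient pages, the pages of `U` missing from the cache have the lowest priorities in `U`,
and there are as many of them as doubted clean pages (`card_U_sdiff_cache`). Within a phase `U` only
shrinks, so the sampled order stays exchangeable on it (`exchangeable_expectAt`). A given page of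
`U` is therefore missing with probability at most (doubted pages)/|U|, which is at most (doubted
pages)/(k - marked pages). This bounds the expected cost by a sum of deterministic terms `stepCost`
(`expectedCost_le`).

The rest is amortized analysis. The potentials are sums over the clean pages, and
`potential_advance_le` reduces the effect of a request to inequalities for one page. With `costPot`,
all costs are at most k + 5 (clean arrivals + doubts) (`sum_stepCost_add_le`). With `sizePot`, each
clean page is doubted at most 1 + log₂ k times, since its threshold doubles after an interval that
ends doubted (`totalDoubts_le_size`). With `errorPot`, for every L the doubts number at most 2 Off +
η/2^L + (L+2)(clean arrivals): doubts at thresholds below 2^L are paid by the clean page, while at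
larger thresholds a predicted eviction that turns out wrong either was loaded by Off or stayed in
Off's cache while causing prediction error at about 2^L requests (`totalDoubts_le_error`).

Finally, there are at most 2 Off clean arrivals (`totalClean_le`), and taking 2^L about 1 + η/Off
gives the ratio (`five_mul_le`). -/

/-- The expectation of a nonnegative function under a probability mass function. -/
noncomputable def expect {α : Type*} (p : PMF α) (f : α → ENNReal) : ENNReal := ∑' a, p a * f a

theorem expect_pure {α : Type*} (a : α) (f : α → ENNReal) : expect (PMF.pure a) f = f a := by
  unfold expect
  rw [tsum_eq_single a]
  · simp
  · intro b hb
    simp [PMF.pure_apply, hb]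

theorem expect_bind {α β : Type*} (p : PMF α) (g : α → PMF β) (f : β → ENNReal) :
    expect (p.bind g) f = expect p fun a => expect (g a) f := by
  unfold expect
  simp_rw [PMF.bind_apply, ← ENNReal.tsum_mul_right, ← ENNReal.tsum_mul_left]
  rw [ENNReal.tsum_comm]
  simp_rw [mul_assoc]

theorem expect_map {α β : Type*} (p : PMF α) (g : α → β) (f : β → ENNReal) :
    expect (p.map g) f = expect p fun a => f (g a) := by
  rw [← PMF.bind_pure_comp, expect_bind]
  simp [expect_pure]

theorem expect_mono {α : Type*} (p : PMF α) {f g : α → ENNReal}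
    (h : ∀ a ∈ p.support, f a ≤ g a) : expect p f ≤ expect p g := by
  refine ENNReal.tsum_le_tsum fun a => ?_
  by_cases ha : p a = 0
  · simp [ha]
  · exact mul_le_mul_right (h a ((PMF.mem_support_iff p a).2 ha)) _

theorem expect_const {α : Type*} (p : PMF α) (c : ENNReal) : expect p (fun _ => c) = c := by
  unfold expect
  rw [ENNReal.tsum_mul_right, p.tsum_coe, one_mul]

theorem expect_le_const {α : Type*} (p : PMF α) {f : α → ENNReal} {c : ENNReal}
    (h : ∀ a ∈ p.support, f a ≤ c) : expect p f ≤ c :=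
  (expect_mono p h).trans_eq (expect_const p c)

theorem expect_add {α : Type*} (p : PMF α) (f g : α → ENNReal) :
    expect p (fun a => f a + g a) = expect p f + expect p g := by
  unfold expect
  simp_rw [mul_add]
  exact ENNReal.tsum_add

theorem mul_expect {α : Type*} (p : PMF α) (c : ENNReal) (f : α → ENNReal) :
    c * expect p f = expect p fun a => c * f a := by
  unfold expect
  rw [← ENNReal.tsum_mul_left]
  exact tsum_congr fun a => by ring

theorem expect_sum {α ι : Type*} (p : PMF α) (s : Finset ι) (f : ι → α → ENNReal) :
    expect p (fun a => ∑ i ∈ s, f i a) = ∑ i ∈ s, expect p (f i) := by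
  unfold expect
  simp_rw [Finset.mul_sum]
  exact Summable.tsum_finsetSum fun _ _ => ENNReal.summable

theorem expect_uniform_comp_equiv {α : Type*} [Fintype α] [Nonempty α] (σ : α ≃ α)
    (f : α → ENNReal) :
    expect (PMF.uniformOfFintype α) (fun a => f (σ a)) = expect (PMF.uniformOfFintype α) f := by
  unfold expect
  simp only [PMF.uniformOfFintype_apply]
  exact σ.tsum_eq fun a => (Fintype.card α : ENNReal)⁻¹ * f a

/-- The number of elements of `V` that precede `x`. -/
def rankIn {Page : Type*} (V : Finset Page) (prio : Page → ℕ) (x : Page) : ℕ :=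
  (V.filter fun y => prio y < prio x).card

/-- Distinct priorities give distinct ranks within `V`, so `rankIn` injects these elements into {0,
…, d-1}. -/
theorem card_rankIn_lt_le {Page : Type*} (V : Finset Page) (prio : Page → ℕ)
    (hinj : Set.InjOn prio V) (d : ℕ) : (V.filter fun x => rankIn V prio x < d).card ≤ d := by
  conv_rhs => rw [← Finset.card_range d]
  refine Finset.card_le_card_of_injOn (rankIn V prio) ?_ ?_
  · intro x hx
    simpa using (Finset.mem_filter.1 (Finset.mem_coe.1 hx)).2
  · intro x hx y hy hxy
    have hx' := (Finset.mem_filter.1 (Finset.mem_coe.1 hx)).1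
    have hy' := (Finset.mem_filter.1 (Finset.mem_coe.1 hy)).1
    by_contra hne
    have key : ∀ a ∈ V, ∀ b ∈ V, prio a < prio b → rankIn V prio a < rankIn V prio b := by
      intro a ha b hb hab
      refine Finset.card_lt_card ⟨fun z hz => ?_, fun hsub => ?_⟩
      · simp only [Finset.mem_filter] at hz ⊢
        exact ⟨hz.1, hz.2.trans hab⟩
      · have := hsub (Finset.mem_filter.2 ⟨ha, hab⟩)
        simp at this
    rcases lt_trichotomy (prio x) (prio y) with h | h | h
    · exact absurd hxy (key x hx' y hy' h).ne
    · exact hne (hinj hx' hy' h)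
    · exact absurd hxy.symm (key y hy' x hx' h).ne

/-- The rank function of an enumeration of `S`. -/
def enumRank {Page : Type*} [DecidableEq Page] (S : Finset Page) (e : {x // x ∈ S} ≃ Fin S.card)
    (x : Page) : ℕ :=
  if hx : x ∈ S then (e ⟨x, hx⟩ : ℕ) else 0

theorem enumRank_injOn {Page : Type*} [DecidableEq Page] (S : Finset Page)
    (e : {x // x ∈ S} ≃ Fin S.card) : Set.InjOn (enumRank S e) S := by
  intro x hx y hy hxy
  have hx' : x ∈ S := hx
  have hy' : y ∈ S := hy
  simp only [enumRank, hx', hy', dif_pos] at hxy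
  simpa using e.injective (Fin.ext hxy)

theorem enumRank_swap {Page : Type*} [DecidableEq Page] (S : Finset Page)
    (e : {x // x ∈ S} ≃ Fin S.card) {a b : Page} (ha : a ∈ S) (hb : b ∈ S) (x : Page) :
    enumRank S ((Equiv.swap (⟨a, ha⟩ : {x // x ∈ S}) ⟨b, hb⟩).trans e) x =
      enumRank S e (Equiv.swap a b x) := by
  by_cases hxa : x = a
  · subst hxa; simp [enumRank, ha, hb]
  by_cases hxb : x = b
  · subst hxb; simp [enumRank, ha, hb]
  rw [Equiv.swap_apply_of_ne_of_ne hxa hxb]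
  by_cases hx : x ∈ S
  · simp only [enumRank, hx, dif_pos, Equiv.trans_apply]
    rw [Equiv.swap_apply_of_ne_of_ne] <;> simpa using by assumption
  · simp [enumRank, hx]

theorem rankIn_comp_swap {Page : Type*} [DecidableEq Page] {V : Finset Page} (prio : Page → ℕ)
    {a b : Page} (ha : a ∈ V) (hb : b ∈ V) :
    rankIn V (fun x => prio (Equiv.swap a b x)) a = rankIn V prio b := by
  unfold rankIn
  have hV : ∀ x, Equiv.swap a b x ∈ V ↔ x ∈ V := by
    intro x
    by_cases hxa : x = a
    · subst hxa; simp [ha, hb]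
    by_cases hxb : x = b
    · subst hxb; simp [ha, hb]
    rw [Equiv.swap_apply_of_ne_of_ne hxa hxb]
  refine Finset.card_bij (fun x _ => Equiv.swap a b x) ?_ ?_ ?_
  · intro x hx
    simp only [Finset.mem_filter, Equiv.swap_apply_left] at hx ⊢
    exact ⟨(hV x).2 hx.1, hx.2⟩
  · intro x _ y _ h
    exact (Equiv.swap a b).injective h
  · intro y hy
    simp only [Finset.mem_filter] at hy
    refine ⟨Equiv.swap a b y, ?_, Equiv.swap_apply_self a b y⟩
    simp only [Finset.mem_filter, Equiv.swap_apply_left, Equiv.swap_apply_self]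
    exact ⟨(hV y).2 hy.1, hy.2⟩

/-- In a uniformly random enumeration of `S`, a given element of `V ⊆ S` is among the first `d`
elements of `V` with probability at most `d / |V|`. -/
theorem card_mul_expect_rankIn_lt_le {Page : Type*} [DecidableEq Page] {S V : Finset Page}
    (hVS : V ⊆ S) {x : Page} (hx : x ∈ V) (d : ℕ) :
    (V.card : ENNReal) * expect (PMF.uniformOfFintype ({x // x ∈ S} ≃ Fin S.card))
      (fun e => if rankIn V (enumRank S e) x < d then 1 else 0) ≤ d := by
  have hsymm : ∀ y ∈ V, expect (PMF.uniformOfFintype ({x // x ∈ S} ≃ Fin S.card))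
        (fun e => if rankIn V (enumRank S e) y < d then (1 : ENNReal) else 0) =
      expect (PMF.uniformOfFintype ({x // x ∈ S} ≃ Fin S.card))
        (fun e => if rankIn V (enumRank S e) x < d then 1 else 0) := by
    intro y hy
    -- Precomposition with the transposition of `x` and `y` preserves the uniform distribution and
    -- turns the rank of `x` into that of `y`.
    let τ : {x // x ∈ S} ≃ {x // x ∈ S} := Equiv.swap ⟨x, hVS hx⟩ ⟨y, hVS hy⟩
    let σ : ({x // x ∈ S} ≃ Fin S.card) ≃ ({x // x ∈ S} ≃ Fin S.card) :=
      { toFun := fun e => τ.trans e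
        invFun := fun e => τ.symm.trans e
        left_inv := fun e => by ext; simp
        right_inv := fun e => by ext; simp }
    rw [← expect_uniform_comp_equiv σ fun e =>
      if rankIn V (enumRank S e) x < d then (1 : ENNReal) else 0]
    congr 1
    funext e
    have h1 : enumRank S (σ e) = fun z => enumRank S e (Equiv.swap x y z) :=
      funext fun z => enumRank_swap S e (hVS hx) (hVS hy) z
    rw [h1, rankIn_comp_swap _ hx hy]
  -- By symmetry the left side is the expected number of elements of `V` of rank below `d`, which is
  -- at most `d` for every single enumeration.
  calc _ = ∑ y ∈ V, expect (PMF.uniformOfFintype ({x // x ∈ S} ≃ Fin S.card))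
        (fun e => if rankIn V (enumRank S e) y < d then (1 : ENNReal) else 0) := by
        rw [Finset.sum_congr rfl hsymm, Finset.sum_const, nsmul_eq_mul]
    _ = expect (PMF.uniformOfFintype ({x // x ∈ S} ≃ Fin S.card))
        (fun e => ∑ y ∈ V, if rankIn V (enumRank S e) y < d then (1 : ENNReal) else 0) :=
        (expect_sum _ _ _).symm
    _ ≤ d := by
        refine expect_le_const _ fun e _ => ?_
        rw [Finset.sum_boole]
        exact_mod_cast card_rankIn_lt_le V _ ((enumRank_injOn S e).mono hVS) d

end Caching

/-! ### The deterministic part of the execution and its invariants. -/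

namespace Caching.TrustDoubt

variable {Page : Type u} [DecidableEq Page]

namespace State

/-- The pages that are stale or marked. -/
def W (s : State Page) : Finset Page := s.stale ∪ s.marked

/-- The part of the state that does not depend on the random priorities. -/
def core (s : State Page) : State Page :=
  { s with cache := ∅, A := ∅, prio := fun _ => 0, cost := 0 }

/-- Mark a page. -/
def mark (r : Page) (s : State Page) : State Page := { s with marked := insert r s.marked }

/-- The clean pages whose predicted eviction is doubted. -/
def doubted (s : State Page) : Finset Page := s.C.filter fun q => s.trusted q = false

end State

/-- The effect of step 2 on a clean page `r` that arrives. -/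
def arrive (ch : Choices Page) (h : History Page) (r : Page) (P : Finset Page)
    (s : State Page) : State Page :=
  { s with
    C := insert r s.C
    p := Function.update s.p r (ch.candidate h (s.candidates P))
    trusted := Function.update s.trusted r true
    thr := Function.update s.thr r 1
    change := Function.update s.change r s.marked.card }

/-- The effect of step 3. -/
noncomputable def doubt (ch : Choices Page) (h : History Page) (r : Page) (P : Finset Page)
    (s : State Page) : State Page :=
  if hq : ∃ q ∈ s.C, s.p q = r then
    { s with
      p := Function.update s.p hq.choose (ch.candidate h (s.candidates P))
      trusted := Function.update s.trusted hq.choose false }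
  else s

/-- The effect of steps 2 and 3. -/
noncomputable def settle (ch : Choices Page) (h : History Page) (r : Page) (P : Finset Page)
    (b : Bool) (s : State Page) : State Page :=
  doubt ch h r P (if b = true ∧ r ∉ s.stale then arrive ch h r P s else s)

/-- A new `q`-interval begins with the present request. -/
def due (b : Bool) (s : State Page) (q : Page) : Prop := b = true ∧ s.change q = s.marked.card

instance (b : Bool) (s : State Page) (q : Page) : Decidable (due b s q) :=
  inferInstanceAs (Decidable (_ ∧ _))

/-- The threshold of `q` in its next interval. -/
def nextThr (s : State Page) (q : Page) : ℕ := if s.trusted q = false then 2 * s.thr q else s.thr q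

/-- Begin new intervals for the pages of `S` for which they are due, leaving the cache alone. -/
def renew (b : Bool) (S : Finset Page) (s : State Page) : State Page :=
  { s with
    thr := fun q => if q ∈ S ∧ due b s q then nextThr s q else s.thr q
    trusted := fun q => if q ∈ S ∧ due b s q then true else s.trusted q
    change := fun q => if q ∈ S ∧ due b s q then s.marked.card + nextThr s q else s.change q }

/-- The deterministic part of serving a request when there are no ancient pages. -/
noncomputable def advance (ch : Choices Page) (h : History Page) (r : Page) (P : Finset Page)
    (s : State Page) : State Page :=
  let s₃ := settle ch h r P (decide (r ∉ s.marked)) (s.mark r)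
  renew (decide (r ∉ s.marked)) s₃.C s₃

/-- The deterministic part of serving a request within a phase. -/
noncomputable def coreInPhase (k : ℕ) (ch : Choices Page) (h : History Page) (r : Page)
    (P : Finset Page) (x : State Page) : State Page :=
  if x.W.card < k then x.mark r else advance ch h r P x

/-- The deterministic part of beginning a new phase if necessary. -/
def coreBegin (k : ℕ) (r : Page) (x : State Page) : State Page :=
  if x.marked.card = k ∧ r ∉ x.marked then
    { x with stale := x.marked \ x.T, marked := ∅, C := ∅ }
  else x

/-- The deterministic part of the execution of Trust&Doubt. -/
noncomputable def coreRun (k : ℕ) (ch : Choices Page) (r : ℕ → Page) (P : ℕ → Finset Page) :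
    ℕ → State Page
  | 0 => init ∅
  | t + 1 => coreInPhase k ch (history r P (t + 1)) (r (t + 1)) (P (t + 1))
      (coreBegin k (r (t + 1)) (coreRun k ch r P t))

/-- The combinatorial invariants of the deterministic part, without those on thresholds. -/
structure Wf (k : ℕ) (P : Finset Page) (s : State Page) : Prop where
  C_sub : s.C ⊆ s.marked
  marked_le : s.marked.card ≤ k
  card_C : s.C.card = s.W.card - k
  inj : Set.InjOn s.p s.C
  p_mem : ∀ q ∈ s.C, s.p q ∈ s.W
  p_notMem : ∀ q ∈ s.C, s.p q ∉ P

/-- The invariants on thresholds. -/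
structure ThrWf (s : State Page) : Prop where
  pow : ∀ q ∈ s.C, ∃ e : ℕ, s.thr q = 2 ^ e
  two_le : ∀ q ∈ s.C, 2 * s.thr q ≤ s.change q
  lt_change : ∀ q ∈ s.C, s.marked.card < s.change q
  change_le : ∀ q ∈ s.C, s.change q ≤ s.marked.card + s.thr q

theorem Wf.of_core {k : ℕ} {P : Finset Page} {s : State Page} (h : Wf k P s.core) : Wf k P s :=
  ⟨h.1, h.2, h.3, h.4, h.5, h.6⟩

theorem State.T_union_D (s : State Page) : s.T ∪ s.D = s.C.image s.p := by
  unfold State.T State.D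
  rw [← Finset.image_union]
  congr 1
  ext q
  simp only [Finset.mem_union, Finset.mem_filter]
  cases s.trusted q <;> simp

/-- Trusted and doubted predicted evictions are excluded alike, so trust flags do not influence
which candidates exist. -/
theorem State.candidates_eq {s : State Page} (P : Finset Page) :
    s.candidates P = (s.W \ s.C.image s.p) \ P := by
  rw [← s.T_union_D]
  unfold State.candidates State.U State.M State.W
  ext x
  simp only [Finset.mem_sdiff, Finset.mem_union]
  tauto

theorem State.mem_T {s : State Page} {x : Page} :
    x ∈ s.T ↔ ∃ q ∈ s.C, s.trusted q = true ∧ s.p q = x := by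
  simp [State.T, and_assoc]

theorem mem_W_of_mem_C {k : ℕ} {P : Finset Page} {s : State Page} (hw : Wf k P s) {q : Page}
    (hq : q ∈ s.C) : q ∈ s.W := Finset.mem_union_right _ (hw.C_sub hq)

/-- What steps 2 and 3 do to a state `s₁` in which the request `r` has been marked, starting from
`s`: either `r` is clean and arrives, or `r` is a predicted eviction, or nothing happens. -/
inductive Settled (k : ℕ) (r : Page) (P : Finset Page) (s s₁ : State Page) : State Page → Prop
  | clean (y : Page) (hr : r ∉ s.W) (hyW : y ∈ insert r s.W) (hyP : y ∉ P)
      (hyC : y ∉ s.C.image s.p) : Settled k r P s s₁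
        { s₁ with
          C := insert r s.C
          p := Function.update s.p r y
          trusted := Function.update s.trusted r true
          thr := Function.update s.thr r 1
          change := Function.update s.change r s₁.marked.card }
  | doubt (q y : Page) (hr : r ∈ s.W) (hq : q ∈ s.C) (hqr : s.p q = r) (hyW : y ∈ s.W)
      (hyP : y ∉ P) (hyC : y ∉ s.C.image s.p) : Settled k r P s s₁
        { s₁ with
          p := Function.update s.p q y
          trusted := Function.update s.trusted q false }
  | other (hr : r ∈ s.W) (hC : ∀ q ∈ s.C, s.p q ≠ r) : Settled k r P s s₁ s₁

section

variable {k : ℕ} {ch : Choices Page} {h : History Page} {r : Page} {P P' : Finset Page}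
  {s : State Page}

/-- Candidates exist by counting: `p` is injective on `C` and |C| = |W| - k, so `W` contains exactly
k pages that are not some `p q`. A clean arrival adds a further one, which exceeds the k pages of
the prediction. Cache content `c` and cost `n` are arbitrary because they play no role in these
steps. -/
theorem exists_steps_two_three (hw : Wf k P s) (hW : k ≤ s.W.card)
    (hr : r ∈ P') (hP' : P'.card = k) (hsub : P' ⊆ insert r P) (c : Finset Page) (n : ℕ) :
    let b := decide (r ∉ s.marked)
    let s₁ : State Page := { s.mark r with cache := c, cost := n }
    ((step2 ch h r P' b s₁).bind (step3 ch h r P') = some (settle ch h r P' b s₁)) ∧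
      Settled k r P' s s₁ (settle ch h r P' b s₁) := by
  intro b s₁
  have hcard : (s.C.image s.p).card = s.C.card := Finset.card_image_of_injOn hw.inj
  have hCW : s.C.image s.p ⊆ s.W := fun x hx => by
    obtain ⟨q, hq, rfl⟩ := Finset.mem_image.1 hx
    exact hw.p_mem q hq
  have hC := hw.card_C
  have hsd : (s.W \ s.C.image s.p).card = k := by
    rw [Finset.card_sdiff_of_subset hCW]; omega
  by_cases hrW : r ∈ s.W
  · have hno : ¬ (b = true ∧ r ∉ s₁.stale) := by
      rintro ⟨h1, h2⟩
      have h1' : r ∉ s.marked := by simpa [b] using h1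
      exact (Finset.mem_union.1 hrW).elim (fun h => h2 h) h1'
    have hs2 : step2 ch h r P' b s₁ = some s₁ := by simp only [step2, if_neg hno]
    have hset : settle ch h r P' b s₁ = doubt ch h r P' s₁ := by
      simp only [settle, if_neg hno]
    rw [hs2, hset]
    have hW₁ : s₁.W = s.W := by
      change s.stale ∪ insert r s.marked = s.W
      rw [Finset.union_insert, ← State.W, Finset.insert_eq_of_mem hrW]
    by_cases hq : ∃ q ∈ s₁.C, s₁.p q = r
    · have hcand : (s₁.candidates P').Nonempty := by
        rw [State.candidates_eq, hW₁]
        by_contra hemp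
        rw [Finset.not_nonempty_iff_eq_empty, Finset.sdiff_eq_empty_iff_subset] at hemp
        -- Without a candidate, the k pages that are not some `p q` would be exactly the prediction;
        -- but that contains `r`, which is a `p q`.
        have heq := Finset.eq_of_subset_of_card_le hemp (by rw [hP']; exact hsd.ge)
        have : r ∈ s.W \ s.C.image s.p := by
          have hr' := hr
          rw [← heq] at hr'
          exact hr'
        obtain ⟨q, hqC, hqr⟩ := hq
        exact (Finset.mem_sdiff.1 this).2 (Finset.mem_image.2 ⟨q, hqC, hqr⟩)
      have hmem := ch.candidate_mem h _ hcand
      have h3 : step3 ch h r P' s₁ = some (doubt ch h r P' s₁) := by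
        simp only [step3, doubt, dif_pos hq, pick, if_pos hcand, Option.map_some]
      refine ⟨h3, ?_⟩
      have h4 : doubt ch h r P' s₁ = { s₁ with
          p := Function.update s.p hq.choose (ch.candidate h (s₁.candidates P'))
          trusted := Function.update s.trusted hq.choose false } := by
        simp only [doubt, dif_pos hq]; rfl
      rw [h4]
      have hcs : s₁.candidates P' = (s.W \ s.C.image s.p) \ P' := by
        rw [State.candidates_eq, hW₁]; rfl
      have hy := (Finset.ext_iff.1 hcs _).1 hmem
      simp only [Finset.mem_sdiff] at hy
      exact Settled.doubt _ _ hrW hq.choose_spec.1 hq.choose_spec.2 hy.1.1 hy.2 hy.1.2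
    · have h3 : step3 ch h r P' s₁ = some s₁ := by simp only [step3, dif_neg hq]
      have h4 : doubt ch h r P' s₁ = s₁ := by simp only [doubt, dif_neg hq]
      rw [h4]
      exact ⟨h3, Settled.other hrW fun q hqC hqr => hq ⟨q, hqC, hqr⟩⟩
  · have hyes : b = true ∧ r ∉ s₁.stale := by
      refine ⟨?_, fun h => hrW (Finset.mem_union_left _ h)⟩
      simpa [b] using fun h => hrW (Finset.mem_union_right _ h)
    have hW₁ : s₁.W = insert r s.W := by
      change s.stale ∪ insert r s.marked = _
      rw [Finset.union_insert]; rfl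
    have hcand : (s₁.candidates P').Nonempty := by
      rw [State.candidates_eq, hW₁]
      by_contra hemp
      rw [Finset.not_nonempty_iff_eq_empty, Finset.sdiff_eq_empty_iff_subset] at hemp
      have h1 := Finset.card_le_card hemp
      have h2 : (insert r s.W \ s₁.C.image s₁.p).card = k + 1 := by
        have : s₁.C.image s₁.p = s.C.image s.p := rfl
        rw [this, Finset.card_sdiff_of_subset (hCW.trans (Finset.subset_insert _ _)),
          Finset.card_insert_of_notMem hrW]
        omega
      omega
    have hs2 : step2 ch h r P' b s₁ = some (arrive ch h r P' s₁) := by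
      simp only [step2, if_pos hyes, pick, if_pos hcand, Option.map_some, arrive]
    have hy := ch.candidate_mem h _ hcand
    rw [State.candidates_eq, hW₁] at hy
    simp only [Finset.mem_sdiff] at hy
    -- Step 3 is idle after a clean arrival: the new `p r` avoids the prediction, which contains
    -- `r`, and the older `p q` lie in the old `W`, which does not contain `r`.
    have hno : ¬ ∃ q ∈ (arrive ch h r P' s₁).C, (arrive ch h r P' s₁).p q = r := by
      rintro ⟨q, hqC, hqr⟩
      simp only [arrive] at hqC hqr
      by_cases hqr' : q = r
      · subst hqr'
        rw [Function.update_self, State.candidates_eq, hW₁] at hqr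
        rw [hqr] at hy
        exact hy.2 hr
      · rw [Function.update_of_ne hqr'] at hqr
        have hqC' : q ∈ s.C := Finset.mem_of_mem_insert_of_ne hqC hqr'
        exact hrW (hqr ▸ hw.p_mem q hqC')
    have h3 : step3 ch h r P' (arrive ch h r P' s₁) = some (arrive ch h r P' s₁) := by
      simp only [step3, dif_neg hno]
    have hset : settle ch h r P' b s₁ = arrive ch h r P' s₁ := by
      simp only [settle, if_pos hyes, doubt, dif_neg hno]
    rw [hs2, hset]
    refine ⟨h3, ?_⟩
    have := Settled.clean (k := k) (s₁ := s₁) _ hrW hy.1.1 hy.2 hy.1.2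
    simp only [arrive, State.candidates_eq, hW₁]
    exact this

/-- The prediction gains no page other than `r`, so a `p q` can enter it only by being requested,
and then step 3 replaces it. A clean arrival enlarges `C` and `W` by one page each; otherwise both
keep their sizes. -/
theorem Settled.wf (hw : Wf k P s) (hW : k ≤ s.W.card) (hsub : P' ⊆ insert r P)
    (hm : s.marked.card < k ∨ r ∈ s.marked)
    {c : Finset Page} {n : ℕ} {s₃ : State Page}
    (hS : Settled k r P' s { s.mark r with cache := c, cost := n } s₃) : Wf k P' s₃ := by
  have hmk : (insert r s.marked).card ≤ k := by
    rcases hm with hm | hm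
    · exact (Finset.card_insert_le _ _).trans hm
    · rw [Finset.insert_eq_of_mem hm]; exact hw.marked_le
  have hunion : s.stale ∪ insert r s.marked = insert r s.W := by
    rw [Finset.union_insert]; rfl
  have hnot : ∀ q ∈ s.C, s.p q ≠ r → s.p q ∉ P' := fun q hq hne hmem =>
    hw.p_notMem q hq (Finset.mem_of_mem_insert_of_ne (hsub hmem) hne)
  cases hS with
  | clean y hr hyW hyP hyC =>
    have hrC : r ∉ s.C := fun h => hr (mem_W_of_mem_C hw h)
    have hup : ∀ q ∈ s.C, Function.update s.p r y q = s.p q := fun q hq =>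
      Function.update_of_ne (fun h : q = r => hrC (h ▸ hq)) _ _
    refine ⟨Finset.insert_subset_insert _ hw.C_sub, hmk, ?_, ?_, ?_, ?_⟩
    · change (insert r s.C).card = (s.stale ∪ insert r s.marked).card - k
      rw [hunion, Finset.card_insert_of_notMem hr, Finset.card_insert_of_notMem hrC, hw.card_C]
      omega
    · change Set.InjOn (Function.update s.p r y) (insert r s.C : Finset Page)
      rw [Finset.coe_insert, Set.injOn_insert (by simpa using hrC)]
      refine ⟨hw.inj.congr fun q hq => (hup q hq).symm, ?_⟩
      rintro ⟨q, hq, hqy⟩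
      rw [hup q hq, Function.update_self] at hqy
      exact hyC (Finset.mem_image.2 ⟨q, hq, hqy⟩)
    · intro q hq
      change Function.update s.p r y q ∈ s.stale ∪ insert r s.marked
      rw [hunion]
      rcases Finset.mem_insert.1 hq with rfl | hq
      · rwa [Function.update_self]
      · rw [hup q hq]; exact Finset.mem_insert_of_mem (hw.p_mem q hq)
    · intro q hq
      change Function.update s.p r y q ∉ P'
      rcases Finset.mem_insert.1 hq with rfl | hq
      · rwa [Function.update_self]
      · rw [hup q hq]
        exact hnot q hq fun h => hr (h ▸ hw.p_mem q hq)
  | doubt q₀ y hr hq hqr hyW hyP hyC =>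
    refine ⟨hw.C_sub.trans (Finset.subset_insert _ _), hmk, ?_, ?_, ?_, ?_⟩
    · change s.C.card = (s.stale ∪ insert r s.marked).card - k
      rw [hunion, Finset.insert_eq_of_mem hr, hw.card_C]
    · intro a ha b hb hab
      change Function.update s.p q₀ y a = Function.update s.p q₀ y b at hab
      by_cases h1 : a = q₀ <;> by_cases h2 : b = q₀
      · rw [h1, h2]
      · subst h1
        rw [Function.update_self, Function.update_of_ne h2] at hab
        exact absurd (Finset.mem_image.2 ⟨b, hb, hab.symm⟩) hyC
      · subst h2
        rw [Function.update_self, Function.update_of_ne h1] at hab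
        exact absurd (Finset.mem_image.2 ⟨a, ha, hab⟩) hyC
      · rw [Function.update_of_ne h1, Function.update_of_ne h2] at hab
        exact hw.inj ha hb hab
    · intro q hq
      change Function.update s.p q₀ y q ∈ s.stale ∪ insert r s.marked
      rw [hunion, Finset.insert_eq_of_mem hr]
      by_cases h1 : q = q₀
      · subst h1; rwa [Function.update_self]
      · rw [Function.update_of_ne h1]; exact hw.p_mem q hq
    · intro q hq'
      change Function.update s.p q₀ y q ∉ P'
      by_cases h1 : q = q₀
      · subst h1; rwa [Function.update_self]
      · rw [Function.update_of_ne h1]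
        exact hnot q hq' fun h => h1 (hw.inj hq' hq (h.trans hqr.symm))
  | other hr hC =>
    refine ⟨hw.C_sub.trans (Finset.subset_insert _ _), hmk, ?_, hw.inj, ?_, ?_⟩
    · change s.C.card = (s.stale ∪ insert r s.marked).card - k
      rw [hunion, Finset.insert_eq_of_mem hr, hw.card_C]
    · intro q hq
      change s.p q ∈ s.stale ∪ insert r s.marked
      rw [hunion]
      exact Finset.mem_insert_of_mem (hw.p_mem q hq)
    · exact fun q hq => hnot q hq (hC q hq)

theorem Wf.renew (hw : Wf k P s) (b : Bool) (S : Finset Page) : Wf k P (renew b S s) :=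
  ⟨hw.1, hw.2, hw.3, hw.4, hw.5, hw.6⟩

/-- The invariants on thresholds are restored when the new intervals are begun. -/
theorem Settled.thrWf_renew (ht : ThrWf s) {c : Finset Page} {n : ℕ}
    {s₃ : State Page}
    (hS : Settled k r P' s { s.mark r with cache := c, cost := n } s₃) :
    ThrWf (renew (decide (r ∉ s.marked)) s₃.C s₃) := by
  have hmark : s₃.marked = insert r s.marked := by cases hS <;> rfl
  have key : ∀ q ∈ s₃.C, (q ∈ s.C ∧ s₃.thr q = s.thr q ∧ s₃.change q = s.change q) ∨
      (r ∉ s.marked ∧ s₃.thr q = 1 ∧ s₃.change q = s₃.marked.card ∧ s₃.trusted q = true) := by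
    cases hS with
    | clean y hr hyW hyP hyC =>
      intro q hq
      by_cases hqr : q = r
      · subst hqr
        right
        refine ⟨fun h => hr (Finset.mem_union_right _ h), ?_, ?_, ?_⟩ <;> simp [State.mark]
      · left
        refine ⟨Finset.mem_of_mem_insert_of_ne hq hqr, ?_, ?_⟩ <;>
        simp [Function.update_of_ne hqr]
    | doubt q₀ y hr hq hqr hyW hyP hyC => exact fun q hq => Or.inl ⟨hq, rfl, rfl⟩
    | other hr hC => exact fun q hq => Or.inl ⟨hq, rfl, rfl⟩
  have hm1 : 1 ≤ s₃.marked.card := by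
    rw [hmark]; exact Finset.card_pos.2 ⟨r, Finset.mem_insert_self _ _⟩
  have all : ∀ q ∈ s₃.C, (∃ e : ℕ, (renew (decide (r ∉ s.marked)) s₃.C s₃).thr q = 2 ^ e) ∧
      2 * (renew (decide (r ∉ s.marked)) s₃.C s₃).thr q ≤
        (renew (decide (r ∉ s.marked)) s₃.C s₃).change q ∧
      s₃.marked.card < (renew (decide (r ∉ s.marked)) s₃.C s₃).change q ∧
      (renew (decide (r ∉ s.marked)) s₃.C s₃).change q ≤
        s₃.marked.card + (renew (decide (r ∉ s.marked)) s₃.C s₃).thr q := by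
    intro q hq
    simp only [TrustDoubt.renew, hq, true_and, due, decide_eq_true_eq]
    rcases key q hq with ⟨hqC, h1, h2⟩ | ⟨hrm, h1, h2, h3⟩
    · obtain ⟨e, he⟩ := ht.pow q hqC
      have h4 := ht.two_le q hqC
      have h5 := ht.lt_change q hqC
      have h6 := ht.change_le q hqC
      have hpos : 0 < s.thr q := by rw [he]; positivity
      by_cases hd : r ∉ s.marked ∧ s₃.change q = s₃.marked.card
      · simp only [hd, not_false_eq_true, and_self, if_true, nextThr, h1]
        rw [h2] at hd
        cases htq : s₃.trusted q
        · simp only [if_true]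
          refine ⟨⟨e + 1, by rw [he]; ring⟩, by omega, by omega, by omega⟩
        · simp only [Bool.true_eq_false, if_false]
          refine ⟨⟨e, he⟩, by omega, by omega, by omega⟩
      · rw [h2] at hd
        simp only [h2, hd, if_false, h1]
        refine ⟨⟨e, he⟩, h4, ?_, ?_⟩
        · by_cases hrm : r ∈ s.marked
          · rwa [hmark, Finset.insert_eq_of_mem hrm]
          · have : s₃.marked.card = s.marked.card + 1 := by
              rw [hmark, Finset.card_insert_of_notMem hrm]
            have : s.change q ≠ s₃.marked.card := fun h => hd ⟨hrm, h⟩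
            omega
        · have : s.marked.card ≤ s₃.marked.card := by
            rw [hmark]; exact Finset.card_le_card (Finset.subset_insert _ _)
          omega
    -- A page that has just arrived has `change` equal to the present count, so its first interval
    -- begins with this request; being trusted, it keeps threshold 1.
    · simp only [hrm, not_false_eq_true, h2, and_self, if_true, nextThr, h3, h1,
        Bool.true_eq_false, if_false]
      exact ⟨⟨0, rfl⟩, by omega, by omega, le_refl _⟩
  exact ⟨fun q hq => (all q hq).1, fun q hq => (all q hq).2.1, fun q hq => (all q hq).2.2.1,
    fun q hq => (all q hq).2.2.2⟩

theorem Wf.coreBegin (hw : Wf k P s) : Wf k P (coreBegin k r s) := by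
  unfold TrustDoubt.coreBegin
  split_ifs with hc
  · refine ⟨Finset.empty_subset _, by simp, ?_, by simp, by simp, by simp⟩
    have : ((s.marked \ s.T) ∪ ∅).card ≤ k := by
      rw [Finset.union_empty]
      exact (Finset.card_le_card Finset.sdiff_subset).trans hc.1.le
    change (∅ : Finset Page).card = ((s.marked \ s.T) ∪ ∅).card - k
    rw [Finset.card_empty]; omega
  · exact hw

theorem ThrWf.coreBegin (ht : ThrWf s) : ThrWf (coreBegin k r s) := by
  unfold TrustDoubt.coreBegin
  split_ifs with hc
  · exact ⟨by simp, by simp, by simp, by simp⟩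
  · exact ht

theorem coreBegin_marked (hw : Wf k P s) (hk : 2 ≤ k) :
    (coreBegin k r s).marked.card < k ∨ r ∈ (coreBegin k r s).marked := by
  unfold coreBegin
  split_ifs with hc
  · left; simpa using by omega
  · have := hw.marked_le
    by_cases hr : r ∈ s.marked
    · exact Or.inr hr
    · left
      exact lt_of_le_of_ne this fun h => hc ⟨h, hr⟩

theorem Wf.mark (hw : Wf k P s) (hW : s.W.card < k) (hm : s.marked.card < k ∨ r ∈ s.marked) :
    Wf k P' (s.mark r) := by
  have hC : s.C = ∅ := by
    rw [← Finset.card_eq_zero, hw.card_C]; omega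
  have hC' : (s.mark r).C = ∅ := hC
  refine ⟨by simp [hC'], ?_, ?_, by simp [hC'], by simp [hC'], by simp [hC']⟩
  · rcases hm with hm | hm
    · exact (Finset.card_insert_le _ _).trans hm
    · change (insert r s.marked).card ≤ k
      rw [Finset.insert_eq_of_mem hm]; exact hw.marked_le
  · have : (s.mark r).W.card ≤ s.W.card + 1 := by
      change (s.stale ∪ insert r s.marked).card ≤ _
      rw [Finset.union_insert]
      exact Finset.card_insert_le _ _
    rw [hC', Finset.card_empty]; omega

theorem ThrWf.mark (hC : s.C = ∅) : ThrWf (s.mark r) := by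
  have hC' : (s.mark r).C = ∅ := hC
  exact ⟨by simp [hC'], by simp [hC'], by simp [hC'], by simp [hC']⟩

theorem C_eq_empty (hw : Wf k P s) (hW : s.W.card < k) : s.C = ∅ := by
  rw [← Finset.card_eq_zero, hw.card_C]; omega

theorem settled_settle (hw : Wf k P s) (hW : k ≤ s.W.card)
    (hr : r ∈ P') (hP' : P'.card = k) (hsub : P' ⊆ insert r P) :
    Settled k r P' s (s.mark r)
      (settle ch h r P' (decide (r ∉ s.marked)) (s.mark r)) :=
  (exists_steps_two_three (ch := ch) (h := h) hw hW hr hP' hsub s.cache s.cost).2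

theorem coreInPhase_wf (hw : Wf k P s) (ht : ThrWf s)
    (hm : s.marked.card < k ∨ r ∈ s.marked)
    (hr : r ∈ P') (hP' : P'.card = k) (hsub : P' ⊆ insert r P) :
    Wf k P' (coreInPhase k ch h r P' s) ∧ ThrWf (coreInPhase k ch h r P' s) := by
  unfold coreInPhase
  split_ifs with hW
  · exact ⟨hw.mark hW hm, ThrWf.mark (C_eq_empty hw hW)⟩
  · have hS := settled_settle (ch := ch) (h := h) hw (not_lt.1 hW) hr hP' hsub
    exact ⟨(Settled.wf (c := s.cache) (n := s.cost) hw (not_lt.1 hW) hsub hm hS).renew _ _,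
      Settled.thrWf_renew (c := s.cache) (n := s.cost) ht hS⟩

end

theorem IsLazy.card {k T : ℕ} {r : ℕ → Page} {P : ℕ → Finset Page}
    (hP : IsLazyPrediction k T r P) {t : ℕ} (ht : t ≤ T) : (P t).card = k := by
  induction t with
  | zero => exact hP.card_init
  | succ t ih =>
    by_cases hr : r (t + 1) ∈ P t
    · rw [hP.stay (t + 1) (by omega) ht hr]; exact ih (by omega)
    · obtain ⟨q, hq, he⟩ := hP.swap (t + 1) (by omega) ht hr
      simp only [Nat.add_sub_cancel] at hq he
      have h1 : r (t + 1) ∉ (P t).erase q := fun h => hr (Finset.mem_of_mem_erase h)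
      have h2 : 0 < (P t).card := Finset.card_pos.2 ⟨q, hq⟩
      have h3 := ih (by omega)
      rw [he, Finset.card_insert_of_notMem h1, Finset.card_erase_of_mem hq]
      omega

theorem IsLazy.mem {k T : ℕ} {r : ℕ → Page} {P : ℕ → Finset Page}
    (hP : IsLazyPrediction k T r P) {t : ℕ} (ht : t + 1 ≤ T) : r (t + 1) ∈ P (t + 1) := by
  by_cases hr : r (t + 1) ∈ P t
  · rw [hP.stay (t + 1) (by omega) ht hr]; exact hr
  · obtain ⟨q, hq, he⟩ := hP.swap (t + 1) (by omega) ht hr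
    rw [he]; exact Finset.mem_insert_self _ _

theorem IsLazy.subset {k T : ℕ} {r : ℕ → Page} {P : ℕ → Finset Page}
    (hP : IsLazyPrediction k T r P) {t : ℕ} (ht : t + 1 ≤ T) :
    P (t + 1) ⊆ insert (r (t + 1)) (P t) := by
  by_cases hr : r (t + 1) ∈ P t
  · rw [hP.stay (t + 1) (by omega) ht hr]; exact Finset.subset_insert _ _
  · obtain ⟨q, hq, he⟩ := hP.swap (t + 1) (by omega) ht hr
    rw [he]; exact Finset.insert_subset_insert _ (Finset.erase_subset _ _)

theorem coreRun_wf {k T : ℕ} (hk : 2 ≤ k) (ch : Choices Page) {r : ℕ → Page}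
    {P : ℕ → Finset Page} (hP : IsLazyPrediction k T r P) {t : ℕ} (ht : t ≤ T) :
    Wf k (P t) (coreRun k ch r P t) ∧ ThrWf (coreRun k ch r P t) := by
  induction t with
  | zero =>
    refine ⟨⟨?_, ?_, ?_, ?_, ?_, ?_⟩, ⟨?_, ?_, ?_, ?_⟩⟩ <;> simp [coreRun, init, State.W]
  | succ t ih =>
    obtain ⟨hw, hT⟩ := ih (by omega)
    exact coreInPhase_wf hw.coreBegin hT.coreBegin (coreBegin_marked hw hk) (IsLazy.mem hP ht)
      (IsLazy.card hP ht) (IsLazy.subset hP ht)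

end Caching.TrustDoubt

/-! ### The cache and the priorities when there are no ancient pages. -/

namespace Caching.TrustDoubt

variable {Page : Type u}

theorem lowest_eq_some {prio : Page → ℕ} {S : Finset Page} (hS : S.Nonempty) :
    ∃ x ∈ S, lowest prio S = some x ∧ ∀ y ∈ S, prio x ≤ prio y :=
  ⟨_, (S.exists_min_image prio hS).choose_spec.1, by rw [lowest, dif_pos hS],
    (S.exists_min_image prio hS).choose_spec.2⟩

theorem highest_eq_some {prio : Page → ℕ} {S : Finset Page} (hS : S.Nonempty) :
    ∃ x ∈ S, highest prio S = some x ∧ ∀ y ∈ S, prio y ≤ prio x :=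
  ⟨_, (S.exists_max_image prio hS).choose_spec.1, by rw [highest, dif_pos hS],
    (S.exists_max_image prio hS).choose_spec.2⟩

variable [DecidableEq Page]

/-- The invariants on the cache while there are no ancient pages. -/
structure CacheWf (k : ℕ) (s : State Page) : Prop where
  sub : s.cache ⊆ s.W
  card : s.cache.card = k
  M_sub : s.M ⊆ s.cache
  inj : Set.InjOn s.prio s.U
  order : ∀ x ∈ s.U, x ∉ s.cache → ∀ y ∈ s.U, y ∈ s.cache → s.prio x ≤ s.prio y

theorem State.mem_U {s : State Page} {x : Page} :
    x ∈ s.U ↔ x ∈ s.stale ∧ x ∉ s.marked ∧ x ∉ s.T := by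
  simp [State.U, and_assoc]

theorem State.mem_M {s : State Page} {x : Page} : x ∈ s.M ↔ x ∈ s.marked ∧ x ∉ s.T := by
  simp [State.M]

theorem State.mem_W {s : State Page} {x : Page} : x ∈ s.W ↔ x ∈ s.stale ∨ x ∈ s.marked := by
  simp [State.W]

theorem mem_U_or_mem_M_or_mem_T {s : State Page} {x : Page} (hx : x ∈ s.W) :
    x ∈ s.U ∨ x ∈ s.M ∨ x ∈ s.T := by
  rw [State.mem_W] at hx
  rw [State.mem_U, State.mem_M]
  tauto

section

variable {k : ℕ} {ch : Choices Page} {h : History Page} {r : Page} {P P' : Finset Page}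
  {s : State Page}

/-- The cache consists of k pages of `W`, so |W| - k = |C| pages of `W` are missing. None of them is
in `M`, so each is a missing page of `U` or a missing trusted prediction. -/
theorem card_U_sdiff_cache_add (hw : Wf k P s) (hc : CacheWf k s) :
    (s.U \ s.cache).card +
      (s.C.filter fun q => s.trusted q = true ∧ s.p q ∉ s.cache).card = s.C.card := by
  have h1 : (s.W \ s.cache).card = s.C.card := by
    rw [Finset.card_sdiff_of_subset hc.sub, hc.card, hw.card_C]
  have h2 : ((s.C.filter fun q => s.trusted q = true ∧ s.p q ∉ s.cache).image s.p).card =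
      (s.C.filter fun q => s.trusted q = true ∧ s.p q ∉ s.cache).card :=
    Finset.card_image_of_injOn (hw.inj.mono (Finset.coe_subset.2 (Finset.filter_subset _ _)))
  rw [← h2, ← h1, ← Finset.card_union_of_disjoint]
  · congr 1
    ext x
    simp only [Finset.mem_union, Finset.mem_sdiff, Finset.mem_image, Finset.mem_filter]
    constructor
    · rintro (⟨h3, h4⟩ | ⟨q, ⟨h3, h4, h5⟩, rfl⟩)
      · exact ⟨State.mem_W.2 (Or.inl (State.mem_U.1 h3).1), h4⟩
      · exact ⟨hw.p_mem q h3, h5⟩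
    · rintro ⟨h3, h4⟩
      rcases mem_U_or_mem_M_or_mem_T h3 with h5 | h5 | h5
      · exact Or.inl ⟨h5, h4⟩
      · exact absurd (hc.M_sub h5) h4
      · obtain ⟨q, h6, h7, rfl⟩ := State.mem_T.1 h5
        exact Or.inr ⟨q, ⟨h6, h7, h4⟩, rfl⟩
  · rw [Finset.disjoint_left]
    intro x hx hx'
    obtain ⟨q, hq, rfl⟩ := Finset.mem_image.1 hx'
    simp only [Finset.mem_filter] at hq
    exact (State.mem_U.1 (Finset.mem_sdiff.1 hx).1).2.2 (State.mem_T.2 ⟨q, hq.1, hq.2.1, rfl⟩)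

/-- Thus the number of missing pages of `U` is deterministic, although the set of these pages is
random. -/
theorem card_U_sdiff_cache (hw : Wf k P s) (hc : CacheWf k s)
    (hT : Disjoint s.T s.cache) : (s.U \ s.cache).card = s.doubted.card := by
  have h1 := card_U_sdiff_cache_add hw hc
  have h2 : (s.C.filter fun q => s.trusted q = true ∧ s.p q ∉ s.cache) =
      s.C.filter fun q => ¬ s.trusted q = false := by
    refine Finset.filter_congr fun q hq => ?_
    rw [Bool.not_eq_false]
    exact ⟨fun h => h.1, fun h =>
      ⟨h, Finset.disjoint_left.1 hT (State.mem_T.2 ⟨q, hq, h, rfl⟩)⟩⟩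
  have h3 := Finset.card_filter_add_card_filter_not (s := s.C) fun q => s.trusted q = false
  rw [h2] at h1
  unfold State.doubted
  omega

theorem renew_cons_of_not_due {b : Bool} {q : Page} {l : List Page} (hd : ¬ due b s q) :
    renew b (q :: l).toFinset s = renew b l.toFinset s := by
  have : ∀ x, (x ∈ (q :: l).toFinset ∧ due b s x) ↔ (x ∈ l.toFinset ∧ due b s x) := by
    intro x
    simp only [List.toFinset_cons, Finset.mem_insert]
    constructor
    · rintro ⟨rfl | h1, h2⟩
      · exact absurd h2 hd
      · exact ⟨h1, h2⟩
    · exact fun h => ⟨Or.inr h.1, h.2⟩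
  simp only [renew, this]

/-- Different clean pages do not interfere here, so treating them one by one in any order has the
same deterministic effect as treating them at once. -/
theorem renew_newInterval {b : Bool} {q : Page} {l : List Page} (hd : due b s q) (hq : q ∉ l) :
    renew b l.toFinset (newInterval q s) = renew b (q :: l).toFinset s := by
  have hq' : q ∉ l.toFinset := by simpa using hq
  have h1 : ∀ x, x ≠ q → (due b (newInterval q s) x ↔ due b s x) := by
    intro x hx
    simp [due, newInterval, Function.update_of_ne hx]
  simp only [renew, newInterval, State.mk.injEq, true_and, and_true]
  obtain ⟨hd₁, hd₂⟩ := hd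
  refine ⟨?_, ?_, ?_⟩ <;> funext x <;> by_cases hx : x = q
  · subst hx
    simp [hq', hd₁, hd₂, due]
  · have := h1 x hx
    simp only [newInterval] at this
    simp [hx, this]
  · subst hx
    simp [hq', hd₁, hd₂, nextThr, due]
  · have := h1 x hx
    simp only [newInterval] at this
    simp [hx, this, nextThr]
  · subst hx
    simp [hq', hd₁, hd₂, nextThr, due]
  · have := h1 x hx
    simp only [newInterval] at this
    simp [hx, this, nextThr]

theorem mem_T_newInterval {q : Page} (hq : q ∈ s.C) {x : Page} :
    x ∈ (newInterval q s).T ↔ x ∈ s.T ∨ x = s.p q := by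
  rw [State.mem_T, State.mem_T]
  simp only [newInterval]
  constructor
  · rintro ⟨a, h1, h2, rfl⟩
    by_cases ha : a = q
    · exact Or.inr (by rw [ha])
    · rw [Function.update_of_ne ha] at h2
      exact Or.inl ⟨a, h1, h2, rfl⟩
  · rintro (⟨a, h1, h2, rfl⟩ | rfl)
    · by_cases ha : a = q
      · exact ⟨a, h1, by rw [ha, Function.update_self], rfl⟩
      · exact ⟨a, h1, by rwa [Function.update_of_ne ha], rfl⟩
    · exact ⟨q, hq, Function.update_self _ _ _, rfl⟩

theorem Wf.newInterval (hw : Wf k P s) (q : Page) : Wf k P (newInterval q s) :=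
  ⟨hw.1, hw.2, hw.3, hw.4, hw.5, hw.6⟩

theorem CacheWf.newInterval (hc : CacheWf k s) {q : Page} (hq : q ∈ s.C) :
    CacheWf k (newInterval q s) := by
  have hU : ∀ x, x ∈ (TrustDoubt.newInterval q s).U → x ∈ s.U := by
    intro x hx
    rw [State.mem_U, mem_T_newInterval hq] at hx
    rw [State.mem_U]
    exact ⟨hx.1, hx.2.1, fun h => hx.2.2 (Or.inl h)⟩
  refine ⟨hc.sub, hc.card, fun x hx => ?_, hc.inj.mono hU,
    fun x hx hx' y hy hy' => hc.order x (hU x hx) hx' y (hU y hy) hy'⟩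
  rw [State.mem_M, mem_T_newInterval hq] at hx
  exact hc.M_sub (State.mem_M.2 ⟨hx.1, fun h => hx.2 (Or.inl h)⟩)

/-- Loading the highest-priority missing page leaves the missing pages of `U` below the cached ones.
The evicted page is in `T`, so neither `U` nor `M` loses a cached page. -/
theorem CacheWf.swap (hc : CacheWf k s) {x y : Page} (hx : x ∈ s.T) (hxc : x ∈ s.cache)
    (hy : y ∈ s.U \ s.cache) (hmax : ∀ z ∈ s.U \ s.cache, s.prio z ≤ s.prio y) :
    CacheWf k (s.swap x y) := by
  rw [Finset.mem_sdiff] at hy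
  refine ⟨?_, ?_, ?_, hc.inj, ?_⟩
  · intro z hz
    rcases Finset.mem_insert.1 hz with rfl | hz
    · exact State.mem_W.2 (Or.inl (State.mem_U.1 hy.1).1)
    · exact hc.sub (Finset.mem_of_mem_erase hz)
  · change (insert y (s.cache.erase x)).card = k
    rw [Finset.card_insert_of_notMem fun h => hy.2 (Finset.mem_of_mem_erase h),
      Finset.card_erase_of_mem hxc, hc.card]
    have : 0 < s.cache.card := Finset.card_pos.2 ⟨x, hxc⟩
    rw [hc.card] at this
    omega
  · intro z hz
    have hz' : z ∈ s.M := hz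
    refine Finset.mem_insert_of_mem (Finset.mem_erase.2 ⟨?_, hc.M_sub hz'⟩)
    rintro rfl
    exact (State.mem_M.1 hz').2 hx
  · intro z hz hzc w hw hwc
    have hz' : z ∈ s.U := hz
    have hzx : z ≠ x := by rintro rfl; exact (State.mem_U.1 hz').2.2 hx
    have hzc' : z ∉ s.cache := fun h =>
      hzc (Finset.mem_insert_of_mem (Finset.mem_erase.2 ⟨hzx, h⟩))
    rcases Finset.mem_insert.1 hwc with rfl | hwc
    · exact hmax z (Finset.mem_sdiff.2 ⟨hz', hzc'⟩)
    · exact hc.order z hz' hzc' w hw (Finset.mem_of_mem_erase hwc)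

/-- Step 4 succeeds, and it amounts to `renew` on the deterministic part of the state. -/
theorem exists_foldlM_step4 {b : Bool} {Z : Page → Prop} [DecidablePred Z] (hr : r ∈ P)
    (l : List Page) (hl : l.Nodup) :
    ∀ s : State Page, Wf k P s → k ≤ s.W.card → CacheWf k s → r ∈ s.cache →
      (∀ q ∈ l, q ∈ s.C) →
      (∀ q ∈ s.C, s.trusted q = true → s.p q ∈ s.cache → q ∈ l ∧ due b s q ∧ Z q) →
      ∃ s', l.foldlM (step4 b) s = some s' ∧ s'.core = renew b l.toFinset s.core ∧
        CacheWf k s' ∧ Disjoint s'.T s'.cache ∧ r ∈ s'.cache ∧ s'.prio = s.prio ∧ s'.A = s.A ∧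
        s'.cost ≤ s.cost +
          (l.toFinset.filter fun q => due b s q ∧ (s.trusted q = false ∨ Z q)).card := by
  induction l with
  | nil =>
    intro s hw hW hc hrc hlC hpend
    refine ⟨s, rfl, ?_, hc, ?_, hrc, rfl, rfl, by simp⟩
    · simp [renew]
    · rw [Finset.disjoint_left]
      intro x hx hx'
      obtain ⟨q, h1, h2, rfl⟩ := State.mem_T.1 hx
      simpa using (hpend q h1 h2 hx').1
  | cons q l ih =>
    intro s hw hW hc hrc hlC hpend
    obtain ⟨hql, hl⟩ := List.nodup_cons.1 hl
    have hqC := hlC q (by simp)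
    have hlC' : ∀ a ∈ l, a ∈ s.C := fun a ha => hlC a (by simp [ha])
    by_cases hd : due b s q
    · have htr : ∀ a, a ≠ q → (newInterval q s).trusted a = s.trusted a := fun a ha => by
        simp [newInterval, Function.update_of_ne ha]
      have hdue : ∀ a, a ≠ q → (due b (newInterval q s) a ↔ due b s a) := by
        intro a ha
        simp [due, newInterval, Function.update_of_ne ha]
      have hne : ∀ a ∈ l, a ≠ q := fun a ha h => hql (h ▸ ha)
      have hfil : (l.toFinset.filter fun a => due b (newInterval q s) a ∧
            ((newInterval q s).trusted a = false ∨ Z a)) =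
          l.toFinset.filter fun a => due b s a ∧ (s.trusted a = false ∨ Z a) := by
        refine Finset.filter_congr fun a ha => ?_
        have ha' := hne a (by simpa using ha)
        rw [hdue a ha', htr a ha']
      have hd' : b = true ∧ s.change q = s.marked.card := hd
      by_cases hpc : s.p q ∈ s.cache
      · have hw₁ := hw.newInterval q
        have hc₁ := hc.newInterval hqC
        -- Now `q` is trusted but `p q` is cached, so fewer than |C| missing pages are trusted
        -- predictions; by the count above some page of `U` is missing.
        have hUne : ((newInterval q s).U \ (newInterval q s).cache).Nonempty := by
          rw [← Finset.card_pos]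
          have h1 := card_U_sdiff_cache_add hw₁ hc₁
          have h2 : ((newInterval q s).C.filter fun a => (newInterval q s).trusted a = true ∧
              (newInterval q s).p a ∉ (newInterval q s).cache).card <
              (newInterval q s).C.card := by
            refine Finset.card_lt_card (Finset.filter_ssubset.2 ⟨q, hqC, fun h => h.2 hpc⟩)
          omega
        obtain ⟨y, hy, hyeq, hymax⟩ := highest_eq_some (prio := (newInterval q s).prio) hUne
        have hqT : s.p q ∈ (newInterval q s).T := (mem_T_newInterval hqC).2 (Or.inr rfl)
        have hc₂ := hc₁.swap hqT hpc hy hymax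
        have hstep : step4 b s q = some ((newInterval q s).swap (s.p q) y) := by
          unfold step4
          rw [if_pos hd']
          change (if s.p q ∈ s.cache then (highest _ ((newInterval q s).U \
            (newInterval q s).cache)).map _ else _) = _
          rw [if_pos hpc, hyeq]
          rfl
        have hw₂ : Wf k P ((newInterval q s).swap (s.p q) y) :=
          ⟨hw.1, hw.2, hw.3, hw.4, hw.5, hw.6⟩
        -- The requested page survives the eviction because it is predicted, unlike `p q`. The
        -- loaded page is in `U`, hence not in `T`, so no trusted prediction enters the cache.
        obtain ⟨s', h1, h2, h3, h4, h5, h6, h7, h8⟩ := ih hl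
          ((newInterval q s).swap (s.p q) y) hw₂ hW hc₂
          (Finset.mem_insert_of_mem (Finset.mem_erase.2
            ⟨fun h => hw.p_notMem q hqC (h ▸ hr), hrc⟩)) hlC' (by
            intro a ha hta hpa
            by_cases haq : a = q
            · subst haq
              exfalso
              rcases Finset.mem_insert.1 hpa with h | h
              · exact (State.mem_U.1 (Finset.mem_sdiff.1 hy).1).2.2
                  (by rw [← h]; exact hqT)
              · exact (Finset.mem_erase.1 h).1 rfl
            · have hta' : s.trusted a = true := (htr a haq).symm.trans hta
              have hpa' : s.p a ∈ s.cache := by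
                rcases Finset.mem_insert.1 hpa with h | h
                · exfalso
                  refine (State.mem_U.1 (Finset.mem_sdiff.1 hy).1).2.2 ?_
                  rw [← h]
                  exact State.mem_T.2 ⟨a, ha, hta, rfl⟩
                · exact Finset.mem_of_mem_erase h
              obtain ⟨h1, h2, h3⟩ := hpend a ha hta' hpa'
              refine ⟨?_, (hdue a haq).2 h2, h3⟩
              rcases List.mem_cons.1 h1 with h | h
              · exact absurd h haq
              · exact h)
        refine ⟨s', ?_, ?_, h3, h4, h5, h6, h7, ?_⟩
        · rw [List.foldlM_cons, hstep]; exact h1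
        · rw [h2]
          exact congrArg State.core (renew_newInterval hd hql)
        · refine h8.trans ?_
          change s.cost + 1 + (l.toFinset.filter fun a => due b (newInterval q s) a ∧
            ((newInterval q s).trusted a = false ∨ Z a)).card ≤ _
          rw [hfil, List.toFinset_cons, Finset.filter_insert, if_pos, Finset.card_insert_of_notMem]
          · omega
          · simp [hql]
          · refine ⟨hd, ?_⟩
            cases htq : s.trusted q
            · exact Or.inl rfl
            · exact Or.inr (hpend q hqC htq hpc).2.2
      · have hstep : step4 b s q = some (newInterval q s) := by
          unfold step4
          rw [if_pos hd']
          change (if s.p q ∈ s.cache then _ else _) = _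
          rw [if_neg hpc]
        obtain ⟨s', h1, h2, h3, h4, h5, h6, h7, h8⟩ := ih hl (newInterval q s)
          (hw.newInterval q) hW (hc.newInterval hqC) hrc hlC' (by
            intro a ha hta hpa
            by_cases haq : a = q
            · subst haq; exact absurd hpa hpc
            · obtain ⟨h1, h2, h3⟩ := hpend a ha ((htr a haq).symm.trans hta) hpa
              refine ⟨?_, (hdue a haq).2 h2, h3⟩
              rcases List.mem_cons.1 h1 with h | h
              · exact absurd h haq
              · exact h)
        refine ⟨s', ?_, ?_, h3, h4, h5, h6, h7, ?_⟩
        · rw [List.foldlM_cons, hstep]; exact h1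
        · rw [h2]
          exact congrArg State.core (renew_newInterval hd hql)
        · refine h8.trans ?_
          rw [hfil]
          refine Nat.add_le_add_left (Finset.card_le_card ?_) _
          exact Finset.filter_subset_filter _ (by simp)
    · have hd' : ¬ (b = true ∧ s.change q = s.marked.card) := hd
      have hstep : step4 b s q = some s := by
        unfold step4
        rw [if_neg hd']
      obtain ⟨s', h1, h2, h3, h4, h5, h6, h7, h8⟩ := ih hl s hw hW hc hrc hlC' (by
        intro a ha hta hpa
        obtain ⟨h1, h2, h3⟩ := hpend a ha hta hpa
        refine ⟨?_, h2, h3⟩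
        rcases List.mem_cons.1 h1 with h | h
        · exact absurd (h ▸ h2) hd
        · exact h)
      refine ⟨s', ?_, ?_, h3, h4, h5, h6, h7, ?_⟩
      · rw [List.foldlM_cons, hstep]; exact h1
      · rw [h2]
        exact congrArg State.core (renew_cons_of_not_due hd).symm
      · refine h8.trans (Nat.add_le_add_left (Finset.card_le_card ?_) _)
        exact Finset.filter_subset_filter _ (by simp)

/-- Step 1 succeeds. -/
theorem exists_step1 (hk : 2 ≤ k) (hc : CacheWf k s) (hT : Disjoint s.T s.cache)
    (hw : Wf k P s) (hm : s.marked.card < k ∨ r ∈ s.marked) :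
    ∃ c n, step1 r (s.mark r) = some { s.mark r with cache := c, cost := n } ∧ r ∈ c ∧
      c.card = k ∧ c ⊆ insert r s.cache ∧ s.M ⊆ c ∧
      (∀ x ∈ (s.mark r).U, x ∉ c → ∀ y ∈ (s.mark r).U, y ∈ c → s.prio x ≤ s.prio y) ∧
      n ≤ s.cost + if r ∈ s.cache then 0 else 1 := by
  have hU : ∀ x, x ∈ (s.mark r).U → x ∈ s.U ∧ x ≠ r := by
    intro x hx
    rw [State.mem_U] at hx
    have h1 : x ∉ insert r s.marked := hx.2.1
    rw [Finset.mem_insert, not_or] at h1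
    exact ⟨State.mem_U.2 ⟨hx.1, h1.2, hx.2.2⟩, h1.1⟩
  by_cases hr : r ∈ s.cache
  · refine ⟨s.cache, s.cost, ?_, hr, hc.card, Finset.subset_insert _ _, hc.M_sub, ?_, by simp⟩
    · unfold step1
      rw [if_pos (show r ∈ (s.mark r).cache from hr)]
      rfl
    · exact fun x hx hx' y hy hy' => hc.order x (hU x hx).1 hx' y (hU y hy).1 hy'
  -- Otherwise every cached page would be marked and different from `r`, and there are at most k - 1
  -- such pages.
  · have hne : ((s.mark r).U ∩ (s.mark r).cache).Nonempty := by
      by_contra hemp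
      rw [Finset.not_nonempty_iff_eq_empty] at hemp
      have hsub : s.cache ⊆ s.marked.erase r := by
        intro x hx
        have hxr : x ≠ r := fun h => hr (h ▸ hx)
        refine Finset.mem_erase.2 ⟨hxr, ?_⟩
        by_contra hxm
        have hxU : x ∈ (s.mark r).U := by
          refine State.mem_U.2 ⟨?_, ?_, fun h => Finset.disjoint_left.1 hT h hx⟩
          · exact (State.mem_W.1 (hc.sub hx)).resolve_right hxm
          · exact fun h => (Finset.mem_insert.1 h).elim hxr hxm
        have : x ∈ (s.mark r).U ∩ (s.mark r).cache := Finset.mem_inter.2 ⟨hxU, hx⟩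
        rw [hemp] at this
        simp at this
      have h1 := Finset.card_le_card hsub
      rw [hc.card] at h1
      have h2 := hw.marked_le
      rcases hm with hm | hm
      · have := Finset.card_le_card (Finset.erase_subset r s.marked)
        omega
      · rw [Finset.card_erase_of_mem hm] at h1
        omega
    obtain ⟨z, hz, hzeq, hzmin⟩ := lowest_eq_some (prio := (s.mark r).prio) hne
    rw [Finset.mem_inter] at hz
    have hzc : z ∈ s.cache := hz.2
    have hzU := hU z hz.1
    refine ⟨insert r (s.cache.erase z), s.cost + 1, ?_, Finset.mem_insert_self _ _, ?_, ?_, ?_,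
      ?_, by simp [hr]⟩
    · unfold step1
      rw [if_neg (show r ∉ (s.mark r).cache from hr), hzeq]
      rfl
    · rw [Finset.card_insert_of_notMem fun h => hr (Finset.mem_of_mem_erase h),
        Finset.card_erase_of_mem hzc, hc.card]
      have := hc.card; omega
    · exact Finset.insert_subset_insert _ (Finset.erase_subset _ _)
    · intro x hx
      refine Finset.mem_insert_of_mem (Finset.mem_erase.2 ⟨?_, hc.M_sub hx⟩)
      rintro rfl
      exact (State.mem_U.1 hzU.1).2.1 (State.mem_M.1 hx).1
    · intro x hx hxc y hy hyc
      have hyc' : y ∈ s.cache.erase z := Finset.mem_of_mem_insert_of_ne hyc (hU y hy).2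
      have hyc'' := Finset.mem_of_mem_erase hyc'
      by_cases hxz : x = z
      · subst hxz
        exact hzmin y (Finset.mem_inter.2 ⟨hy, hyc''⟩)
      · refine hc.order x (hU x hx).1 (fun h => hxc ?_) y (hU y hy).1 hyc''
        exact Finset.mem_insert_of_mem (Finset.mem_erase.2 ⟨hxz, h⟩)

/-- The deterministic part of the cost of serving `r` when there are no ancient pages. -/
noncomputable def settledCost (ch : Choices Page) (h : History Page) (r : Page)
    (P : Finset Page) (s : State Page) : ℕ :=
  let s₃ := settle ch h r P (decide (r ∉ s.marked)) (s.mark r)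
  (if r ∈ s.W then 0 else 1) + (if r ∈ s.T then 1 else 0) +
    (s₃.C.filter fun q => due (decide (r ∉ s.marked)) s₃ q ∧
      (s₃.trusted q = false ∨ (q = r ∧ r ∉ s.W))).card

/-- Steps 2 and 3 neither depend on the cache, the ancient pages, the priorities and the cost, nor
change them. -/
theorem settle_with (b : Bool) (x : State Page) (c a : Finset Page) (f : Page → ℕ) (n : ℕ) :
    settle ch h r P b { x with cache := c, A := a, prio := f, cost := n } =
      { settle ch h r P b x with cache := c, A := a, prio := f, cost := n } := by
  have key : ∀ x : State Page,
      doubt ch h r P { x with cache := c, A := a, prio := f, cost := n } =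
        { doubt ch h r P x with cache := c, A := a, prio := f, cost := n } := by
    intro x
    unfold doubt
    by_cases hq : ∃ q ∈ x.C, x.p q = r
    · rw [dif_pos hq, dif_pos (show ∃ q ∈ ({ x with cache := c, A := a, prio := f, cost := n } :
        State Page).C, ({ x with cache := c, A := a, prio := f, cost := n } : State Page).p q = r
        from hq)]
      rfl
    · rw [dif_neg hq, dif_neg (show ¬ ∃ q ∈ ({ x with cache := c, A := a, prio := f, cost := n } :
        State Page).C, ({ x with cache := c, A := a, prio := f, cost := n } : State Page).p q = r
        from hq)]
  unfold settle
  have : (if b = true ∧ r ∉ x.stale then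
        arrive ch h r P { x with cache := c, A := a, prio := f, cost := n }
      else { x with cache := c, A := a, prio := f, cost := n }) =
      { (if b = true ∧ r ∉ x.stale then arrive ch h r P x else x) with
        cache := c, A := a, prio := f, cost := n } := by
    split_ifs <;> rfl
  rw [← key, ← this]

theorem Settled.mem_T (hw : Wf k P s) {c : Finset Page} {n : ℕ} {s₃ : State Page}
    (hS : Settled k r P' s { s.mark r with cache := c, cost := n } s₃) {x : Page} (hx : x ∈ s.T)
    (hxr : x ≠ r) : x ∈ s₃.T := by
  obtain ⟨q, hq, htq, rfl⟩ := State.mem_T.1 hx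
  cases hS with
  | clean y hrW hyW hyP hyC =>
    have hqr : q ≠ r := fun h => hrW (h ▸ mem_W_of_mem_C hw hq)
    exact State.mem_T.2 ⟨q, Finset.mem_insert_of_mem hq,
      (Function.update_of_ne hqr _ _).trans htq, Function.update_of_ne hqr _ _⟩
  | doubt q₀ y hrW hq₀ hqr hyW hyP hyC =>
    have hqq : q ≠ q₀ := fun h => hxr (h ▸ hqr)
    exact State.mem_T.2 ⟨q, hq, (Function.update_of_ne hqq _ _).trans htq,
      Function.update_of_ne hqq _ _⟩
  | other hrW hC => exact State.mem_T.2 ⟨q, hq, htq, rfl⟩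

/-- A page leaves `T` only when it is requested, and then it is marked; so no page enters `U`. This
keeps the order sampled once per phase usable. -/
theorem U_advance_subset (hw : Wf k P s) (hW : k ≤ s.W.card)
    (hr : r ∈ P') (hP' : P'.card = k) (hsub : P' ⊆ insert r P) :
    (advance ch h r P' s).U ⊆ s.U := by
  have hS := settled_settle (ch := ch) (h := h) hw hW hr hP' hsub
  unfold advance
  generalize settle ch h r P' (decide (r ∉ s.marked)) (s.mark r) = s₃ at *
  have hfields : s₃.stale = s.stale ∧ s₃.marked = insert r s.marked := by
    cases hS <;> exact ⟨rfl, rfl⟩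
  intro x hx
  have h1 := State.mem_U.1 hx
  have hxm : x ∉ insert r s.marked := by
    rw [← hfields.2]; exact h1.2.1
  rw [Finset.mem_insert, not_or] at hxm
  refine State.mem_U.2 ⟨hfields.1 ▸ h1.1, hxm.2, fun hxT => h1.2.2 ?_⟩
  obtain ⟨q, hq, htq, hqx⟩ :=
    State.mem_T.1 (Settled.mem_T (c := s.cache) (n := s.cost) hw hS hxT hxm.1)
  refine State.mem_T.2 ⟨q, hq, ?_, hqx⟩
  change (if _ then true else s₃.trusted q) = true
  rw [htq]; split_ifs <;> rfl

theorem settle_core (b : Bool) (x : State Page) :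
    (settle ch h r P b (x.mark r)).core = settle ch h r P b (x.core.mark r) :=
  (settle_with b (x.mark r) ∅ ∅ (fun _ => 0) 0).symm

theorem settledCost_core : settledCost ch h r P s.core = settledCost ch h r P s := by
  unfold settledCost
  rw [show decide (r ∉ s.core.marked) = decide (r ∉ s.marked) from rfl, ← settle_core]
  rfl

/-- Every page of `W` is in `U`, marked, or in `T`, and `T` has at most |C| = |W| - k pages. -/
theorem le_card_U_add (hw : Wf k P s) (hW : k ≤ s.W.card) : k ≤ s.U.card + s.marked.card := by
  have h1 : s.W ⊆ s.U ∪ (s.marked ∪ s.T) := fun x hx => by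
    rcases mem_U_or_mem_M_or_mem_T hx with h | h | h
    · exact Finset.mem_union_left _ h
    · exact Finset.mem_union_right _ (Finset.mem_union_left _ (State.mem_M.1 h).1)
    · exact Finset.mem_union_right _ (Finset.mem_union_right _ h)
  have h2 := (Finset.card_le_card h1).trans ((Finset.card_union_le _ _).trans
    (Nat.add_le_add_left (Finset.card_union_le _ _) _))
  have h3 : s.T.card ≤ s.C.card :=
    Finset.card_image_le.trans (Finset.card_le_card (Finset.filter_subset _ _))
  have := hw.card_C
  omega

/-- Marked pages outside `T` are cached, so a fault concerns a page outside `W`, a page of `T`, or a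
missing page of `U`. Only the last kind depends on the priorities; the other charges form
`settledCost`. -/
theorem exists_steps (hk : 2 ≤ k) (hc : CacheWf k s) (hT : Disjoint s.T s.cache)
    (hw : Wf k P s) (hm : s.marked.card < k ∨ r ∈ s.marked) (hW : k ≤ s.W.card)
    (hr : r ∈ P') (hP' : P'.card = k) (hsub : P' ⊆ insert r P) :
    ∃ s', steps ch h r P' (decide (r ∉ s.marked)) (s.mark r) = some s' ∧
      s'.core = advance ch h r P' s.core ∧ CacheWf k s' ∧ Disjoint s'.T s'.cache ∧
      r ∈ s'.cache ∧ s'.prio = s.prio ∧ s'.A = s.A ∧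
      s'.cost ≤ s.cost + settledCost ch h r P' s + if r ∈ s.U \ s.cache then 1 else 0 := by
  obtain ⟨c, n, h1, hrc, hccard, hcsub, hMc, hord, hn⟩ := exists_step1 (r := r) hk hc hT hw hm
  obtain ⟨h23, hS⟩ := exists_steps_two_three (ch := ch) (h := h) hw hW hr hP' hsub c n
  have hw₃ := Settled.wf hw hW hsub hm hS
  have hsettle := settle_with (ch := ch) (h := h) (r := r) (P := P') (decide (r ∉ s.marked))
    (s.mark r) c s.A s.prio n
  have hsettle' := settle_core (ch := ch) (h := h) (r := r) (P := P') (decide (r ∉ s.marked)) s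
  have hsettle : settle ch h r P' (decide (r ∉ s.marked))
      { s.mark r with cache := c, cost := n } =
        { settle ch h r P' (decide (r ∉ s.marked)) (s.mark r) with
          cache := c, A := s.A, prio := s.prio, cost := n } := hsettle
  have hcore : (settle ch h r P' (decide (r ∉ s.marked))
      { s.mark r with cache := c, cost := n }).core =
        settle ch h r P' (decide (r ∉ s.marked)) (s.core.mark r) := by
    rw [hsettle, ← hsettle']; rfl
  have hcost : settledCost ch h r P' s = (if r ∈ s.W then 0 else 1) + (if r ∈ s.T then 1 else 0) +
      ((settle ch h r P' (decide (r ∉ s.marked)) { s.mark r with cache := c, cost := n }).C.filter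
        fun q => due (decide (r ∉ s.marked)) (settle ch h r P' (decide (r ∉ s.marked))
          { s.mark r with cache := c, cost := n }) q ∧
        ((settle ch h r P' (decide (r ∉ s.marked))
          { s.mark r with cache := c, cost := n }).trusted q = false ∨ (q = r ∧ r ∉ s.W))).card := by
    rw [hsettle]; rfl
  have hrfl : (settle ch h r P' (decide (r ∉ s.marked))
        { s.mark r with cache := c, cost := n }).cache = c ∧
      (settle ch h r P' (decide (r ∉ s.marked))
        { s.mark r with cache := c, cost := n }).prio = s.prio ∧
      (settle ch h r P' (decide (r ∉ s.marked))
        { s.mark r with cache := c, cost := n }).A = s.A ∧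
      (settle ch h r P' (decide (r ∉ s.marked))
        { s.mark r with cache := c, cost := n }).cost = n := by
    rw [hsettle]; exact ⟨rfl, rfl, rfl, rfl⟩
  generalize settle ch h r P' (decide (r ∉ s.marked))
    { s.mark r with cache := c, cost := n } = s₃ at *
  obtain ⟨hcache₃, hprio₃, hA₃, hcost₃⟩ := hrfl
  have hfields : s₃.stale = s.stale ∧ s₃.marked = insert r s.marked := by
    cases hS <;> exact ⟨rfl, rfl⟩
  obtain ⟨hstale₃, hmarked₃⟩ := hfields
  have hW₃ : s₃.W = insert r s.W := by
    unfold State.W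
    rw [hstale₃, hmarked₃, Finset.union_insert]
  have hT₃ : ∀ x ∈ s.T, x ≠ r → x ∈ s₃.T := fun x => Settled.mem_T hw hS
  -- Before the request no page of `T` was cached, and step 1 can load only `r`. So after steps 2
  -- and 3 the only possible trusted prediction in the cache is that of a clean page arriving now.
  have hpend : ∀ q ∈ s₃.C, s₃.trusted q = true → s₃.p q ∈ c →
      due (decide (r ∉ s.marked)) s₃ q ∧ (q = r ∧ r ∉ s.W) := by
    have hold : ∀ q ∈ s.C, s.trusted q = true → s.p q ∈ c → s.p q = r := by
      intro q hq htq hqc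
      rcases Finset.mem_insert.1 (hcsub hqc) with h | h
      · exact h
      · exact absurd h (Finset.disjoint_left.1 hT (State.mem_T.2 ⟨q, hq, htq, rfl⟩))
    intro q hq htq hpq
    cases hS with
    | clean y hrW hyW hyP hyC =>
      by_cases hqr : q = r
      · subst hqr
        refine ⟨⟨?_, Function.update_self _ _ _⟩, rfl, hrW⟩
        simpa using fun h => hrW (Finset.mem_union_right _ h)
      · have hqC : q ∈ s.C := Finset.mem_of_mem_insert_of_ne hq hqr
        have h2 := hold q hqC ((Function.update_of_ne hqr _ _).symm.trans htq)
          (by simpa [Function.update_of_ne hqr] using hpq)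
        exact absurd (h2 ▸ hw.p_mem q hqC) hrW
    | doubt q₀ y hrW hq₀ hqr hyW hyP hyC =>
      by_cases hqq : q = q₀
      · subst hqq
        simp at htq
      · have h2 := hold q hq ((Function.update_of_ne hqq _ _).symm.trans htq)
          (by simpa [Function.update_of_ne hqq] using hpq)
        exact absurd (hw.inj hq hq₀ (h2.trans hqr.symm)) hqq
    | other hrW hC => exact absurd (hold q hq htq hpq) (hC q hq)
  have hU₃ : ∀ x ∈ s₃.U, x ∈ (s.mark r).U := by
    intro x hx
    rw [State.mem_U, hstale₃, hmarked₃] at hx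
    refine State.mem_U.2 ⟨hx.1, hx.2.1, fun h => hx.2.2 (hT₃ x h ?_)⟩
    rintro rfl
    exact hx.2.1 (Finset.mem_insert_self _ _)
  have hUU : ∀ x ∈ (s.mark r).U, x ∈ s.U := by
    intro x hx
    rw [State.mem_U] at hx
    exact State.mem_U.2 ⟨hx.1, fun h => hx.2.1 (Finset.mem_insert_of_mem h), hx.2.2⟩
  have hc₃ : CacheWf k s₃ := by
    refine ⟨?_, ?_, ?_, ?_, ?_⟩
    · rw [hcache₃, hW₃]
      exact hcsub.trans (Finset.insert_subset_insert _ hc.sub)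
    · rw [hcache₃, hccard]
    · intro x hx
      rw [hcache₃]
      rw [State.mem_M, hmarked₃] at hx
      by_cases hxr : x = r
      · rwa [hxr]
      · exact hMc (State.mem_M.2 ⟨Finset.mem_of_mem_insert_of_ne hx.1 hxr,
          fun h => hx.2 (hT₃ x h hxr)⟩)
    · rw [hprio₃]
      exact hc.inj.mono fun x hx => hUU x (hU₃ x hx)
    · rw [hcache₃, hprio₃]
      exact fun x hx hx' y hy hy' => hord x (hU₃ x hx) hx' y (hU₃ y hy) hy'
  have hkW₃ : k ≤ s₃.W.card := by
    rw [hW₃]; exact hW.trans (Finset.card_le_card (Finset.subset_insert _ _))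
  obtain ⟨s', g1, g2, g3, g4, g5, g6, g7, g8⟩ :=
    exists_foldlM_step4 (b := decide (r ∉ s.marked)) (Z := fun q => q = r ∧ r ∉ s.W) hr
      (ch.order h s₃.C) (ch.order_nodup _ _) s₃ hw₃ hkW₃ hc₃ (by rwa [hcache₃])
      (fun q hq => (ch.mem_order _ _ _).1 hq) (fun q hq htq hpq =>
        ⟨(ch.mem_order _ _ _).2 hq, hpend q hq htq (by rwa [hcache₃] at hpq)⟩)
  have hlist : (ch.order h s₃.C).toFinset = s₃.C := by
    ext q; rw [List.mem_toFinset, ch.mem_order]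
  rw [hlist] at g2 g8
  refine ⟨s', ?_, ?_, g3, g4, g5, g6.trans hprio₃, g7.trans hA₃, ?_⟩
  · unfold steps
    rw [h1]
    change (step2 ch h r P' _ _).bind (fun s₂ => (step3 ch h r P' s₂).bind fun s₃ =>
      (ch.order h s₃.C).foldlM (step4 _) s₃) = _
    rw [← Option.bind_assoc, h23]
    exact g1
  · rw [g2, hcore]
    have : s₃.C = (settle ch h r P' (decide (r ∉ s.marked)) (s.core.mark r)).C := by
      rw [← hcore]; rfl
    rw [this]
    rfl
  · refine g8.trans ?_
    rw [hcost, hcost₃]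
    have : (if r ∈ s.cache then 0 else 1) ≤ (if r ∈ s.W then 0 else 1) +
        (if r ∈ s.T then 1 else 0) + if r ∈ s.U \ s.cache then 1 else 0 := by
      by_cases h2 : r ∈ s.cache
      · simp [h2]
      · rw [if_neg h2]
        by_cases h3 : r ∈ s.W
        · rcases mem_U_or_mem_M_or_mem_T h3 with h4 | h4 | h4
          · rw [if_pos (Finset.mem_sdiff.2 ⟨h4, h2⟩)]; omega
          · exact absurd (hc.M_sub h4) h2
          · rw [if_pos h4]; omega
        · rw [if_neg h3]; omega
    omega

end

end Caching.TrustDoubt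

/-! ### The random process and its expected cost. -/

namespace Caching.TrustDoubt

variable {Page : Type u} [DecidableEq Page]

/-- The invariant of the states that Trust&Doubt can reach. -/
structure Inv (k : ℕ) (s : State Page) : Prop where
  ancient : s.W.card < k → s.cache = s.W ∪ s.A ∧ Disjoint s.W s.A ∧ s.cache.card = k
  settled : k ≤ s.W.card → s.A = ∅ ∧ CacheWf k s ∧ Disjoint s.T s.cache

/-- The cache before the priorities are sampled. -/
structure Ancient (k : ℕ) (s : State Page) : Prop where
  cache_eq : s.cache = s.W ∪ s.A
  disj : Disjoint s.W s.A
  card : s.cache.card = k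
  C_eq : s.C = ∅

/-- Sample the priorities once there are no ancient pages. -/
noncomputable def start (s : State Page) : PMF (State Page) :=
  if s.A = ∅ then samplePriorities s else PMF.pure s

/-- Begin a new phase if necessary. -/
noncomputable def beginPhase (k : ℕ) (r : Page) (s : State Page) : PMF (State Page) :=
  if s.marked.card = k ∧ r ∉ s.marked then start (newPhase s) else PMF.pure s

section

variable {k : ℕ} {ch : Choices Page} {h : History Page} {r : Page} {P P' : Finset Page}
  {s : State Page}

theorem serve_eq : serve k ch h r P s = (beginPhase k r s).bind (serveInPhase ch h r P) := by
  unfold serve beginPhase start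
  split_ifs <;> simp

theorem samplePriorities_eq : samplePriorities s =
    (PMF.uniformOfFintype ({x // x ∈ s.U} ≃ Fin s.U.card)).map fun e =>
      { s with prio := enumRank s.U e } := rfl

theorem Ancient.card_W (hs : Ancient k s) : s.W.card + s.A.card = k := by
  rw [← Finset.card_union_of_disjoint hs.disj, ← hs.cache_eq, hs.card]

theorem Ancient.of_inv (hw : Wf k P s) (hs : Inv k s) (hW : s.W.card < k) : Ancient k s :=
  ⟨(hs.ancient hW).1, (hs.ancient hW).2.1, (hs.ancient hW).2.2, C_eq_empty hw hW⟩

theorem Inv.card_cache (hs : Inv k s) : s.cache.card = k := by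
  rcases lt_or_ge s.W.card k with h | h
  · exact (hs.ancient h).2.2
  · exact (hs.settled h).2.1.card

/-- While there are ancient pages, `W` and `A` partition a cache of size k. This lets the
deterministic part recognize the end of the ancient pages without knowing them. -/
theorem Inv.A_eq_empty_iff (hw : Wf k P s) (hs : Inv k s) : s.A = ∅ ↔ k ≤ s.W.card := by
  rcases lt_or_ge s.W.card k with h | h
  · have := (Ancient.of_inv hw hs h).card_W
    rw [← Finset.card_eq_zero]
    omega
  · exact ⟨fun _ => h, fun _ => (hs.settled h).1⟩

theorem T_eq_empty (hC : s.C = ∅) : s.T = ∅ := by simp [State.T, hC]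

theorem of_mem_support_start (hs : Ancient k s) {s' : State Page} (hs' : s' ∈ (start s).support) :
    s'.core = s.core ∧ Inv k s' ∧ s'.cache = s.cache ∧ s'.cost = s.cost := by
  have hcard := hs.card_W
  unfold start at hs'
  split_ifs at hs' with hA
  · rw [samplePriorities_eq, PMF.support_map] at hs'
    obtain ⟨e, -, rfl⟩ := hs'
    have hWk : s.W.card = k := by rw [hA] at hcard; simpa using hcard
    have hcache : s.cache = s.W := by rw [hs.cache_eq, hA, Finset.union_empty]
    refine ⟨rfl, ⟨fun h => absurd hWk h.ne, fun _ => ⟨hA, ⟨?_, hs.card, ?_, ?_, ?_⟩, ?_⟩⟩, rfl,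
      rfl⟩
    · exact hcache.le
    · intro x hx
      exact hcache.ge (Finset.mem_union_right _ (State.mem_M.1 hx).1)
    · exact enumRank_injOn s.U e
    · intro x hx hx'
      exact absurd (hcache.ge (Finset.mem_union_left _ (State.mem_U.1 hx).1)) hx'
    · change Disjoint s.T s.cache
      rw [T_eq_empty hs.C_eq]
      exact Finset.disjoint_empty_left _
  · rw [PMF.support_pure, Set.mem_singleton_iff] at hs'
    subst hs'
    have : 0 < s'.A.card := Finset.card_pos.2 (Finset.nonempty_iff_ne_empty.2 hA)
    exact ⟨rfl, ⟨fun _ => ⟨hs.cache_eq, hs.disj, hs.card⟩, fun h => by omega⟩, rfl, rfl⟩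

theorem card_mul_expect_start_le (hA : s.A = ∅) {V : Finset Page} (hV : V ⊆ s.U) {x : Page}
    (hx : x ∈ V) (d : ℕ) :
    (V.card : ENNReal) * expect (start s) (fun s' => if rankIn V s'.prio x < d then 1 else 0) ≤
      d := by
  unfold start
  rw [if_pos hA, samplePriorities_eq, expect_map]
  exact card_mul_expect_rankIn_lt_le hV hx d

theorem cache_inter_marked (hs : CacheWf k s) (hT : Disjoint s.T s.cache) :
    s.cache ∩ s.marked = s.M := by
  ext x
  rw [Finset.mem_inter, State.mem_M]
  constructor
  · rintro ⟨h1, h2⟩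
    exact ⟨h2, fun h => Finset.disjoint_left.1 hT h h1⟩
  · rintro h1
    exact ⟨hs.M_sub (State.mem_M.2 h1), h1.1⟩

theorem le_card_W_of_card_marked (hm : s.marked.card = k) : k ≤ s.W.card := by
  rw [← hm]; exact Finset.card_le_card Finset.subset_union_right

/-- The marked pages in the cache are exactly those outside `T`, so the new stale set does not
depend on the random cache content. -/
theorem newPhase_core (hs : Inv k s) (hm : s.marked.card = k ∧ r ∉ s.marked) :
    (newPhase s).core = coreBegin k r s.core := by
  obtain ⟨-, hc, hT⟩ := hs.settled (le_card_W_of_card_marked hm.1)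
  unfold coreBegin
  rw [if_pos (show s.core.marked.card = k ∧ r ∉ s.core.marked from hm)]
  simp only [newPhase, cache_inter_marked hc hT]
  rfl

theorem newPhase_ancient (hs : Inv k s) (hm : s.marked.card = k) : Ancient k (newPhase s) := by
  obtain ⟨-, hc, hT⟩ := hs.settled (le_card_W_of_card_marked hm)
  have hW : (newPhase s).W = s.cache ∩ s.marked := Finset.union_empty _
  refine ⟨?_, ?_, hc.card, rfl⟩
  · rw [hW]
    change s.cache = s.cache ∩ s.marked ∪ s.cache \ s.marked
    rw [Finset.union_comm, Finset.sdiff_union_inter]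
  · rw [hW]
    exact (Finset.disjoint_sdiff_inter _ _).symm

theorem of_mem_support_beginPhase (hs : Inv k s) {s' : State Page}
    (hs' : s' ∈ (beginPhase k r s).support) :
    s'.core = coreBegin k r s.core ∧ Inv k s' ∧ s'.cost = s.cost := by
  unfold beginPhase at hs'
  split_ifs at hs' with hm
  · obtain ⟨h1, h2, -, h4⟩ := of_mem_support_start (newPhase_ancient hs hm.1) hs'
    exact ⟨h1.trans (newPhase_core hs hm), h2, h4⟩
  · rw [PMF.support_pure, Set.mem_singleton_iff] at hs'
    subst hs'
    unfold coreBegin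
    rw [if_neg (show ¬ (s'.core.marked.card = k ∧ r ∉ s'.core.marked) from hm)]
    exact ⟨rfl, hs, rfl⟩

/-- A request outside `W` makes `W` grow by one page and `A` shrink by one: either `r` itself is
ancient, or an ancient page is exchanged for it. Requests in `W` are hits. -/
theorem serveAncient_spec (hs : Ancient k s) (hA : s.A ≠ ∅) :
    Ancient k (serveAncient ch h r (s.mark r)) ∧
      (serveAncient ch h r (s.mark r)).core = (s.core.mark r) ∧
      r ∈ (serveAncient ch h r (s.mark r)).cache ∧
      (serveAncient ch h r (s.mark r)).cost ≤ s.cost + if r ∈ s.W then 0 else 1 := by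
  have hWm : (s.mark r).W = insert r s.W := Finset.union_insert _ _ _
  unfold serveAncient
  by_cases hrA : r ∈ s.A
  · rw [if_pos (show r ∈ (s.mark r).A from hrA)]
    have hrW : r ∉ s.W := fun h => Finset.disjoint_left.1 hs.disj h hrA
    refine ⟨⟨?_, ?_, hs.card, hs.C_eq⟩, rfl, ?_, ?_⟩
    · change s.cache = (s.mark r).W ∪ s.A.erase r
      rw [hWm, hs.cache_eq, Finset.insert_union, ← Finset.union_insert, Finset.insert_erase hrA]
    · change Disjoint (s.mark r).W (s.A.erase r)
      rw [hWm, Finset.disjoint_insert_left]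
      exact ⟨Finset.notMem_erase _ _, hs.disj.mono_right (Finset.erase_subset _ _)⟩
    · change r ∈ s.cache
      rw [hs.cache_eq]
      exact Finset.mem_union_right _ hrA
    · exact Nat.le_add_right _ _
  · rw [if_neg (show r ∉ (s.mark r).A from hrA)]
    by_cases hrc : r ∈ s.cache
    · rw [if_pos (show r ∈ (s.mark r).cache from hrc)]
      have hrW : r ∈ s.W := by
        rw [hs.cache_eq] at hrc
        exact (Finset.mem_union.1 hrc).resolve_right hrA
      rw [Finset.insert_eq_of_mem hrW] at hWm
      refine ⟨⟨?_, ?_, hs.card, hs.C_eq⟩, rfl, hrc, Nat.le_add_right _ _⟩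
      · rw [hWm]; exact hs.cache_eq
      · rw [hWm]; exact hs.disj
    · rw [if_neg (show r ∉ (s.mark r).cache from hrc)]
      have ha : ch.ancient h (s.mark r) ∈ s.A :=
        ch.ancient_mem h (s.mark r) (Finset.nonempty_iff_ne_empty.2 hA)
      generalize ch.ancient h (s.mark r) = a at ha
      have hac : a ∈ s.cache := by
        rw [hs.cache_eq]; exact Finset.mem_union_right _ ha
      have haW : a ∉ s.W := fun h => Finset.disjoint_left.1 hs.disj h ha
      have hrW : r ∉ s.W := fun h => hrc (by rw [hs.cache_eq]; exact Finset.mem_union_left _ h)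
      refine ⟨⟨?_, ?_, ?_, hs.C_eq⟩, rfl, Finset.mem_insert_self _ _, ?_⟩
      · change insert r (s.cache.erase a) = (s.mark r).W ∪ s.A.erase a
        rw [hWm, Finset.insert_union, hs.cache_eq, Finset.erase_union_distrib,
          Finset.erase_eq_of_notMem haW]
      · change Disjoint (s.mark r).W (s.A.erase a)
        rw [hWm, Finset.disjoint_insert_left]
        exact ⟨fun h => hrA (Finset.mem_of_mem_erase h),
          hs.disj.mono_right (Finset.erase_subset _ _)⟩
      · change (insert r (s.cache.erase a)).card = k
        rw [Finset.card_insert_of_notMem fun h => hrc (Finset.mem_of_mem_erase h),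
          Finset.card_erase_of_mem hac]
        have := Finset.card_pos.2 ⟨a, hac⟩
        have := hs.card
        omega
      · rw [if_neg hrW]; exact le_refl (s.cost + 1)

theorem serveInPhase_of_A_ne (hA : s.A ≠ ∅) : serveInPhase ch h r P s =
    (start (serveAncient ch h r (s.mark r))).map some := by
  unfold serveInPhase start
  rw [if_neg hA]
  by_cases h2 : (serveAncient ch h r (s.mark r)).A = ∅
  · rw [if_pos h2]; exact if_pos h2
  · rw [if_neg h2, PMF.pure_map]; exact if_neg h2

/-- One request within a phase while there are ancient pages. -/
theorem serveInPhase_ancient (hw : Wf k P s) (hs : Inv k s) (hW : s.W.card < k)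
    {o : Option (State Page)} (ho : o ∈ (serveInPhase ch h r P' s).support) :
    ∃ s', o = some s' ∧ s'.core = coreInPhase k ch h r P' s.core ∧ Inv k s' ∧ r ∈ s'.cache ∧
      s'.cost ≤ s.cost + if r ∈ s.W then 0 else 1 := by
  have hanc := Ancient.of_inv hw hs hW
  have hA : s.A ≠ ∅ := fun hA => absurd ((hs.A_eq_empty_iff hw).1 hA) (not_le.2 hW)
  obtain ⟨h1, h2, h3, h4⟩ := serveAncient_spec (ch := ch) (h := h) (r := r) hanc hA
  rw [serveInPhase_of_A_ne hA, PMF.support_map] at ho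
  obtain ⟨s', hs', rfl⟩ := ho
  obtain ⟨g1, g2, g3, g4⟩ := of_mem_support_start h1 hs'
  refine ⟨s', rfl, ?_, g2, by rwa [g3], by rwa [g4]⟩
  rw [g1, h2]
  unfold coreInPhase
  rw [if_pos (show s.core.W.card < k from hW)]

/-- One request within a phase when there are no ancient pages. -/
theorem serveInPhase_settled (hk : 2 ≤ k) (hw : Wf k P s) (hs : Inv k s) (hW : k ≤ s.W.card)
    (hm : s.marked.card < k ∨ r ∈ s.marked)
    (hr : r ∈ P') (hP' : P'.card = k) (hsub : P' ⊆ insert r P) :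
    ∃ s', serveInPhase ch h r P' s = PMF.pure (some s') ∧
      s'.core = coreInPhase k ch h r P' s.core ∧ Inv k s' ∧ r ∈ s'.cache ∧ s'.prio = s.prio ∧
      s'.cost ≤ s.cost + settledCost ch h r P' s + if r ∈ s.U \ s.cache then 1 else 0 := by
  obtain ⟨hA, hc, hT⟩ := hs.settled hW
  obtain ⟨s', h1, h2, h3, h4, h5, h6, h7, h8⟩ :=
    exists_steps (ch := ch) (h := h) hk hc hT hw hm hW hr hP' hsub
  have hcore : s'.core = coreInPhase k ch h r P' s.core := by
    unfold coreInPhase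
    rw [if_neg (show ¬ s.core.W.card < k from not_lt.2 hW), h2]
  have hW' : k ≤ s'.W.card := by
    have := Finset.card_le_card h3.sub
    rwa [h3.card] at this
  refine ⟨s', ?_, hcore, ⟨fun h => absurd hW' (not_le.2 h), fun _ => ⟨h7.trans hA, h3, h4⟩⟩, h5, h6,
    h8⟩
  unfold serveInPhase
  rw [if_pos hA, ← h1]
  rfl

end

section

variable {k T : ℕ} {ch : Choices Page} {x₀ : Finset Page} {r : ℕ → Page} {P : ℕ → Finset Page}

/-- The deterministic part of the state after a new phase has begun if necessary. -/
noncomputable def coreMid (k : ℕ) (ch : Choices Page) (r : ℕ → Page) (P : ℕ → Finset Page)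
    (t : ℕ) : State Page :=
  coreBegin k (r (t + 1)) (coreRun k ch r P t)

theorem coreRun_succ (t : ℕ) : coreRun k ch r P (t + 1) =
    coreInPhase k ch (history r P (t + 1)) (r (t + 1)) (P (t + 1)) (coreMid k ch r P t) := rfl

theorem run_succ (t : ℕ) : run k ch x₀ r P (t + 1) = (run k ch x₀ r P t).bind fun o =>
    o.elim (PMF.pure none) fun s => (beginPhase k (r (t + 1)) s).bind
      (serveInPhase ch (history r P (t + 1)) (r (t + 1)) (P (t + 1))) := by
  simp only [run]
  congr 1
  funext o
  cases o with
  | none => rfl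
  | some s => exact serve_eq

theorem coreMid_wf (hk : 2 ≤ k) (ch : Choices Page) (hP : IsLazyPrediction k T r P) {t : ℕ}
    (ht : t ≤ T) : Wf k (P t) (coreMid k ch r P t) ∧ ThrWf (coreMid k ch r P t) :=
  ⟨(coreRun_wf hk ch hP ht).1.coreBegin, (coreRun_wf hk ch hP ht).2.coreBegin⟩

theorem coreMid_marked (hk : 2 ≤ k) (ch : Choices Page) (hP : IsLazyPrediction k T r P) {t : ℕ}
    (ht : t ≤ T) : (coreMid k ch r P t).marked.card < k ∨ r (t + 1) ∈ (coreMid k ch r P t).marked :=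
  coreBegin_marked (coreRun_wf hk ch hP ht).1 hk

/-- The states that Trust&Doubt can reach at time `t`. -/
structure Reachable (k : ℕ) (ch : Choices Page) (r : ℕ → Page) (P : ℕ → Finset Page) (t : ℕ)
    (s : State Page) : Prop where
  core_eq : s.core = coreRun k ch r P t
  inv : Inv k s
  mem : 1 ≤ t → r t ∈ s.cache

/-- The states that Trust&Doubt can reach after time `t` when it has begun a new phase if
necessary. -/
structure MidReachable (k : ℕ) (ch : Choices Page) (r : ℕ → Page) (P : ℕ → Finset Page) (t : ℕ)
    (s : State Page) : Prop where
  core_eq : s.core = coreMid k ch r P t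
  inv : Inv k s

theorem Reachable.mid {t : ℕ} {s s' : State Page} (hs : Reachable k ch r P t s)
    (hs' : s' ∈ (beginPhase k (r (t + 1)) s).support) : MidReachable k ch r P t s' := by
  obtain ⟨h1, h2, -⟩ := of_mem_support_beginPhase hs.inv hs'
  exact ⟨by rw [h1, hs.core_eq]; rfl, h2⟩

theorem MidReachable.wf (hk : 2 ≤ k) (hP : IsLazyPrediction k T r P) {t : ℕ} (ht : t ≤ T)
    {s : State Page} (hs : MidReachable k ch r P t s) : Wf k (P t) s :=
  Wf.of_core (by rw [hs.core_eq]; exact (coreMid_wf hk ch hP ht).1)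

theorem MidReachable.next (hk : 2 ≤ k) (hP : IsLazyPrediction k T r P) {t : ℕ} (ht : t + 1 ≤ T)
    {s : State Page} (hs : MidReachable k ch r P t s) {o : Option (State Page)}
    (ho : o ∈ (serveInPhase ch (history r P (t + 1)) (r (t + 1)) (P (t + 1)) s).support) :
    ∃ s', o = some s' ∧ Reachable k ch r P (t + 1) s' := by
  have hw := hs.wf hk hP (by omega)
  rcases lt_or_ge s.W.card k with hW | hW
  · obtain ⟨s', h1, h2, h3, h4, -⟩ := serveInPhase_ancient hw hs.inv hW ho
    exact ⟨s', h1, by rw [h2, hs.core_eq, coreRun_succ], h3, fun _ => h4⟩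
  · have hm := coreMid_marked hk ch hP (t := t) (by omega)
    rw [← hs.core_eq] at hm
    obtain ⟨s', h1, h2, h3, h4, -⟩ := serveInPhase_settled (ch := ch) (h := history r P (t + 1))
      hk hw hs.inv hW hm (IsLazy.mem hP ht) (IsLazy.card hP ht) (IsLazy.subset hP ht)
    rw [h1, PMF.support_pure, Set.mem_singleton_iff] at ho
    exact ⟨s', ho, by rw [h2, hs.core_eq, coreRun_succ], h3, fun _ => h4⟩

theorem exists_reachable_of_mem_support (hk : 2 ≤ k) (hx₀ : x₀.card = k)
    (hP : IsLazyPrediction k T r P) {t : ℕ} (ht : t ≤ T) {o : Option (State Page)}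
    (ho : o ∈ (run k ch x₀ r P t).support) : ∃ s, o = some s ∧ Reachable k ch r P t s := by
  induction t generalizing o with
  | zero =>
    simp only [run, PMF.support_pure, Set.mem_singleton_iff] at ho
    refine ⟨_, ho, rfl, ⟨fun _ => ⟨?_, ?_, hx₀⟩, fun h => ?_⟩, fun h => by omega⟩
    · simp [init, State.W]
    · simp [init, State.W]
    · simp [init, State.W] at h; omega
  | succ t ih =>
    rw [run_succ, PMF.mem_support_bind_iff] at ho
    obtain ⟨o', ho', ho⟩ := ho
    obtain ⟨s, rfl, hs⟩ := ih (by omega) ho'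
    rw [Option.elim_some, PMF.mem_support_bind_iff] at ho
    obtain ⟨s', hs', ho⟩ := ho
    exact (hs.mid hs').next hk hP ht ho

/-- The expectation of a function of the state at time `t`. -/
noncomputable def expectAt (k : ℕ) (ch : Choices Page) (x₀ : Finset Page) (r : ℕ → Page)
    (P : ℕ → Finset Page) (t : ℕ) (f : State Page → ENNReal) : ENNReal :=
  expect (run k ch x₀ r P t) fun o => o.elim 0 f

/-- The expectation of a function of the state after time `t`, when a new phase has begun if
necessary. -/
noncomputable def expectMid (k : ℕ) (ch : Choices Page) (x₀ : Finset Page) (r : ℕ → Page)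
    (P : ℕ → Finset Page) (t : ℕ) (f : State Page → ENNReal) : ENNReal :=
  expectAt k ch x₀ r P t fun s => expect (beginPhase k (r (t + 1)) s) f

theorem expectAt_succ (t : ℕ) (f : State Page → ENNReal) :
    expectAt k ch x₀ r P (t + 1) f = expectMid k ch x₀ r P t fun s =>
      expect (serveInPhase ch (history r P (t + 1)) (r (t + 1)) (P (t + 1)) s)
        fun o => o.elim 0 f := by
  unfold expectMid expectAt
  rw [run_succ, expect_bind]
  congr 1
  funext o
  cases o with
  | none => simp [expect_pure]
  | some s => simp [expect_bind]

theorem expectAt_mono (hk : 2 ≤ k) (hx₀ : x₀.card = k) (hP : IsLazyPrediction k T r P) {t : ℕ}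
    (ht : t ≤ T) {f g : State Page → ENNReal} (hfg : ∀ s, Reachable k ch r P t s → f s ≤ g s) :
    expectAt k ch x₀ r P t f ≤ expectAt k ch x₀ r P t g := by
  refine expect_mono _ fun o ho => ?_
  obtain ⟨s, rfl, hs⟩ := exists_reachable_of_mem_support hk hx₀ hP ht ho
  exact hfg s hs

theorem expectMid_mono (hk : 2 ≤ k) (hx₀ : x₀.card = k) (hP : IsLazyPrediction k T r P) {t : ℕ}
    (ht : t ≤ T) {f g : State Page → ENNReal} (hfg : ∀ s, MidReachable k ch r P t s → f s ≤ g s) :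
    expectMid k ch x₀ r P t f ≤ expectMid k ch x₀ r P t g :=
  expectAt_mono hk hx₀ hP ht fun _ hs => expect_mono _ fun _ hs' => hfg _ (hs.mid hs')

theorem expectAt_const_le (t : ℕ) (c : ENNReal) : expectAt k ch x₀ r P t (fun _ => c) ≤ c :=
  expect_le_const _ fun o _ => by cases o <;> simp

theorem expectMid_const_le (t : ℕ) (c : ENNReal) : expectMid k ch x₀ r P t (fun _ => c) ≤ c := by
  unfold expectMid
  simp_rw [expect_const]
  exact expectAt_const_le t c

theorem mul_expectAt (t : ℕ) (c : ENNReal) (f : State Page → ENNReal) :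
    c * expectAt k ch x₀ r P t f = expectAt k ch x₀ r P t fun s => c * f s := by
  unfold expectAt
  rw [mul_expect]
  congr 1
  funext o
  cases o <;> simp

theorem mul_expectMid (t : ℕ) (c : ENNReal) (f : State Page → ENNReal) :
    c * expectMid k ch x₀ r P t f = expectMid k ch x₀ r P t fun s => c * f s := by
  unfold expectMid
  simp_rw [mul_expectAt, mul_expect]

theorem expectAt_add (t : ℕ) (f g : State Page → ENNReal) :
    expectAt k ch x₀ r P t (fun s => f s + g s) =
      expectAt k ch x₀ r P t f + expectAt k ch x₀ r P t g := by
  unfold expectAt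
  rw [← expect_add]
  congr 1
  funext o
  cases o <;> simp

theorem expectMid_add (t : ℕ) (f g : State Page → ENNReal) :
    expectMid k ch x₀ r P t (fun s => f s + g s) =
      expectMid k ch x₀ r P t f + expectMid k ch x₀ r P t g := by
  unfold expectMid
  simp_rw [expect_add, expectAt_add]

/-- Under `E`, every element of a set `V ⊆ U` is among the `d` elements of `V` of lowest priority
with probability at most `d / |V|`. -/
def Exchangeable (E : (State Page → ENNReal) → ENNReal) (U : Finset Page) : Prop :=
  ∀ V ⊆ U, ∀ x ∈ V, ∀ d : ℕ,
    (V.card : ENNReal) * E (fun s => if rankIn V s.prio x < d then 1 else 0) ≤ d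

/-- If a new phase begins without ancient pages, the priorities are freshly sampled whatever the
past was; if no phase begins, nothing changes. -/
theorem Exchangeable.mid (hk : 2 ≤ k) (hx₀ : x₀.card = k) (hP : IsLazyPrediction k T r P) {t : ℕ}
    (ht : t ≤ T)
    (hE : k ≤ (coreRun k ch r P t).W.card →
      Exchangeable (expectAt k ch x₀ r P t) (coreRun k ch r P t).U)
    (hW : k ≤ (coreMid k ch r P t).W.card) :
    Exchangeable (expectMid k ch x₀ r P t) (coreMid k ch r P t).U := by
  intro V hV x hx d
  by_cases hm : (coreRun k ch r P t).marked.card = k ∧ r (t + 1) ∉ (coreRun k ch r P t).marked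
  · unfold expectMid
    rw [mul_expectAt]
    refine (expectAt_mono hk hx₀ hP ht fun s hs => ?_).trans (expectAt_const_le t (d : ENNReal))
    have hm' : s.marked.card = k ∧ r (t + 1) ∉ s.marked := by
      rw [← hs.core_eq] at hm; exact hm
    have hcore := newPhase_core hs.inv hm'
    rw [hs.core_eq] at hcore
    have hanc := newPhase_ancient hs.inv hm'.1
    have hA : (newPhase s).A = ∅ := by
      have h1 := hanc.card_W
      have h2 : (newPhase s).W = (coreMid k ch r P t).W :=
        (congrArg State.W hcore : (newPhase s).core.W = _)
      rw [← h2] at hW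
      rw [← Finset.card_eq_zero]; omega
    have hU : (coreMid k ch r P t).U = (newPhase s).U := 
      (congrArg State.U hcore : (newPhase s).core.U = _).symm
    unfold beginPhase
    rw [if_pos hm']
    exact card_mul_expect_start_le hA (hU ▸ hV) hx d
  · have hmid : coreMid k ch r P t = coreRun k ch r P t := if_neg hm
    rw [hmid] at hW hV
    refine le_trans (mul_le_mul_right ?_ _) (hE hW V hV x hx d)
    refine expectAt_mono hk hx₀ hP ht fun s hs => ?_
    have hm' : ¬ (s.marked.card = k ∧ r (t + 1) ∉ s.marked) := by
      rw [← hs.core_eq] at hm; exact hm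
    unfold beginPhase
    rw [if_neg hm', expect_pure]

/-- The priorities are uniform when |W| reaches k. From then on in the phase they are kept while `U`
shrinks along a deterministic path, and the property passes to subsets of `U`. -/
theorem exchangeable_expectAt (hk : 2 ≤ k) (hx₀ : x₀.card = k) (hP : IsLazyPrediction k T r P)
    {t : ℕ} (ht : t ≤ T) (hW : k ≤ (coreRun k ch r P t).W.card) :
    Exchangeable (expectAt k ch x₀ r P t) (coreRun k ch r P t).U := by
  induction t with
  | zero => simp [coreRun, init, State.W] at hW; omega
  | succ t ih =>
    intro V hV x hx d
    rw [expectAt_succ]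
    have hw := (coreMid_wf hk ch hP (t := t) (by omega)).1
    rcases lt_or_ge (coreMid k ch r P t).W.card k with hWm | hWm
    · rw [mul_expectMid]
      refine (expectMid_mono hk hx₀ hP (by omega) fun s hs => ?_).trans
        (expectMid_const_le t (d : ENNReal))
      have hsW : s.W.card < k := by rw [← hs.core_eq] at hWm; exact hWm
      have hws := hs.wf hk hP (by omega)
      have hA : s.A ≠ ∅ := fun hA => absurd ((hs.inv.A_eq_empty_iff hws).1 hA) (not_le.2 hsW)
      obtain ⟨h1, h2, -, -⟩ := serveAncient_spec (ch := ch) (h := history r P (t + 1))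
        (r := r (t + 1)) (Ancient.of_inv hws hs.inv hsW) hA
      have hrun : coreRun k ch r P (t + 1) = (coreMid k ch r P t).mark (r (t + 1)) := by
        rw [coreRun_succ]; exact if_pos hWm
      rw [hrun, ← hs.core_eq, ← h2] at hV hW
      rw [serveInPhase_of_A_ne hA, expect_map]
      have hV' : V ⊆ (serveAncient ch (history r P (t + 1)) (r (t + 1))
        (s.mark (r (t + 1)))).U := hV
      refine card_mul_expect_start_le ?_ hV' hx d
      have h3 := h1.card_W
      have hW' : k ≤ (serveAncient ch (history r P (t + 1)) (r (t + 1))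
        (s.mark (r (t + 1)))).W.card := hW
      rw [← Finset.card_eq_zero]; omega
    · have hrun : coreRun k ch r P (t + 1) = advance ch (history r P (t + 1)) (r (t + 1))
          (P (t + 1)) (coreMid k ch r P t) := by
        rw [coreRun_succ]; exact if_neg (not_lt.2 hWm)
      have hVm : V ⊆ (coreMid k ch r P t).U := by
        rw [hrun] at hV
        exact hV.trans (U_advance_subset hw hWm (IsLazy.mem hP ht) (IsLazy.card hP ht)
          (IsLazy.subset hP ht))
      refine le_trans (mul_le_mul_right ?_ _) (Exchangeable.mid hk hx₀ hP (by omega)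
        (ih (by omega)) hWm V hVm x hx d)
      refine expectMid_mono hk hx₀ hP (by omega) fun s hs => ?_
      have hm := coreMid_marked hk ch hP (t := t) (by omega)
      rw [← hs.core_eq] at hm hWm
      obtain ⟨s', h1, -, -, -, h5, -⟩ := serveInPhase_settled (ch := ch)
        (h := history r P (t + 1)) hk (hs.wf hk hP (by omega)) hs.inv hWm hm
        (IsLazy.mem hP ht) (IsLazy.card hP ht) (IsLazy.subset hP ht)
      rw [h1, expect_pure, Option.elim_some, h5]

/-- A bound on the expected cost of a request in terms of the deterministic part of the state. -/
noncomputable def stepCost (k : ℕ) (ch : Choices Page) (h : History Page) (r : Page)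
    (P : Finset Page) (x : State Page) : ℝ :=
  if x.W.card < k then (if r ∈ x.W then 0 else 1)
  else settledCost ch h r P x +
    if r ∈ x.marked then 0 else (x.doubted.card : ℝ) / ((k : ℝ) - x.marked.card)

/-- All pages of `U` of lower priority than a missing page are missing too, and so is the page
itself, which makes the inequality strict. -/
theorem rankIn_lt_card_doubted {P₀ : Finset Page} {s : State Page} (hw : Wf k P₀ s)
    (hc : CacheWf k s) (hT : Disjoint s.T s.cache) {x : Page} (hx : x ∈ s.U \ s.cache) :
    rankIn s.U s.prio x < s.doubted.card := by
  rw [← card_U_sdiff_cache hw hc hT]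
  refine Finset.card_lt_card ⟨fun y hy => ?_, fun hsub => ?_⟩
  · rw [Finset.mem_filter] at hy
    rw [Finset.mem_sdiff] at hx ⊢
    exact ⟨hy.1, fun hyc => absurd (hc.order x hx.1 hx.2 y hy.1 hyc) (not_le.2 hy.2)⟩
  · have := hsub hx
    simp at this

theorem expectAt_cost_succ_le (hk : 2 ≤ k) (hx₀ : x₀.card = k) (hP : IsLazyPrediction k T r P)
    {t : ℕ} (ht : t + 1 ≤ T) :
    expectAt k ch x₀ r P (t + 1) (fun s => (s.cost : ENNReal)) ≤
      expectAt k ch x₀ r P t (fun s => (s.cost : ENNReal)) +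
        ENNReal.ofReal (stepCost k ch (history r P (t + 1)) (r (t + 1)) (P (t + 1))
          (coreMid k ch r P t)) := by
  have hmidcost : expectMid k ch x₀ r P t (fun s => (s.cost : ENNReal)) ≤
      expectAt k ch x₀ r P t (fun s => (s.cost : ENNReal)) := by
    refine expectAt_mono hk hx₀ hP (by omega) fun s hs => expect_le_const _ fun s' hs' => ?_
    rw [(of_mem_support_beginPhase hs.inv hs').2.2]
  refine le_trans ?_ (add_le_add_left hmidcost _)
  rw [expectAt_succ]
  have hw := (coreMid_wf hk ch hP (t := t) (by omega)).1
  have hm := coreMid_marked hk ch hP (t := t) (by omega)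
  unfold stepCost
  split_ifs with hWm hrW hrm
  · rw [ENNReal.ofReal_zero, add_zero]
    refine expectMid_mono hk hx₀ hP (by omega) fun s hs => expect_le_const _ fun o ho => ?_
    rw [← hs.core_eq] at hWm hrW
    obtain ⟨s', rfl, -, -, -, h5⟩ := serveInPhase_ancient (hs.wf hk hP (by omega)) hs.inv hWm ho
    rw [if_pos (show r (t + 1) ∈ s.W from hrW), add_zero] at h5
    exact Nat.cast_le.2 h5
  · rw [ENNReal.ofReal_one]
    refine le_trans ?_ (add_le_add_right (expectMid_const_le (k := k) (ch := ch) (x₀ := x₀)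
      (r := r) (P := P) t 1) _)
    rw [← expectMid_add]
    refine expectMid_mono hk hx₀ hP (by omega) fun s hs => expect_le_const _ fun o ho => ?_
    rw [← hs.core_eq] at hWm hrW
    obtain ⟨s', rfl, -, -, -, h5⟩ := serveInPhase_ancient (hs.wf hk hP (by omega)) hs.inv hWm ho
    rw [if_neg (show r (t + 1) ∉ s.W from hrW)] at h5
    exact (Nat.cast_le.2 h5).trans (Nat.cast_succ _).le
  · rw [add_zero, ENNReal.ofReal_natCast]
    refine le_trans ?_ (add_le_add_right (expectMid_const_le (k := k) (ch := ch) (x₀ := x₀)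
      (r := r) (P := P) t _) _)
    rw [← expectMid_add]
    refine expectMid_mono hk hx₀ hP (by omega) fun s hs => ?_
    rw [← hs.core_eq] at hWm hrm hm ⊢
    obtain ⟨s', h1, -, -, -, -, h6⟩ := serveInPhase_settled (ch := ch) (h := history r P (t + 1))
      hk (hs.wf hk hP (by omega)) hs.inv (not_lt.1 hWm) hm
      (IsLazy.mem hP ht) (IsLazy.card hP ht) (IsLazy.subset hP ht)
    rw [if_neg (show r (t + 1) ∉ s.U \ s.cache from
      fun h => (State.mem_U.1 (Finset.mem_sdiff.1 h).1).2.1 hrm), add_zero] at h6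
    rw [h1, expect_pure, Option.elim_some, settledCost_core]
    exact_mod_cast h6
  · have hmk : (coreMid k ch r P t).marked.card < k := hm.resolve_right hrm
    -- The page is missing only if its rank in `U` is below the number of doubted pages;
    -- exchangeability with V = U bounds the probability, and |U| is at least k minus the number of
    -- marked pages.
    have hprob : expectMid k ch x₀ r P t
        (fun s => if r (t + 1) ∈ s.U \ s.cache then 1 else 0) ≤
        ENNReal.ofReal (((coreMid k ch r P t).doubted.card : ℝ) /
          ((k : ℝ) - (coreMid k ch r P t).marked.card)) := by
      by_cases hrU : r (t + 1) ∈ (coreMid k ch r P t).U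
      · have h1 := Exchangeable.mid hk hx₀ hP (by omega)
          (exchangeable_expectAt (ch := ch) hk hx₀ hP (by omega)) (not_lt.1 hWm)
          (coreMid k ch r P t).U subset_rfl _ hrU (coreMid k ch r P t).doubted.card
        have h2 : expectMid k ch x₀ r P t
            (fun s => if r (t + 1) ∈ s.U \ s.cache then 1 else 0) ≤
            expectMid k ch x₀ r P t (fun s => if rankIn (coreMid k ch r P t).U s.prio (r (t + 1)) <
              (coreMid k ch r P t).doubted.card then 1 else 0) := by
          refine expectMid_mono hk hx₀ hP (by omega) fun s hs => ?_
          rw [← hs.core_eq] at hWm ⊢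
          obtain ⟨-, hc, hT⟩ := hs.inv.settled (not_lt.1 hWm)
          by_cases hr : r (t + 1) ∈ s.U \ s.cache
          · rw [if_pos hr, if_pos]
            exact rankIn_lt_card_doubted (hs.wf hk hP (by omega)) hc hT hr
          · rw [if_neg hr]; exact zero_le
        have h3 := le_card_U_add hw (not_lt.1 hWm)
        have h4 : 0 < (coreMid k ch r P t).U.card := Finset.card_pos.2 ⟨_, hrU⟩
        have h5 : (0 : ℝ) < (k : ℝ) - (coreMid k ch r P t).marked.card := by
          rw [sub_pos]; exact_mod_cast hmk
        have h6 : (k : ℝ) - (coreMid k ch r P t).marked.card ≤ (coreMid k ch r P t).U.card := by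
          rw [sub_le_iff_le_add]; exact_mod_cast h3
        refine h2.trans (le_trans ?_ (ENNReal.ofReal_le_ofReal
          (div_le_div_of_nonneg_left (Nat.cast_nonneg _) h5 h6)))
        rw [ENNReal.ofReal_div_of_pos (by exact_mod_cast h4), ENNReal.ofReal_natCast,
          ENNReal.ofReal_natCast, ENNReal.le_div_iff_mul_le (Or.inl (by exact_mod_cast h4.ne'))
          (Or.inl (ENNReal.natCast_ne_top _)), mul_comm]
        exact h1
      · refine le_trans (expectMid_mono hk hx₀ hP (by omega) (g := fun _ => 0) fun s hs => ?_)
          ((expectMid_const_le t 0).trans zero_le)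
        rw [← hs.core_eq] at hrU
        rw [if_neg (show r (t + 1) ∉ s.U \ s.cache from fun h => hrU (Finset.mem_sdiff.1 h).1)]
    rw [ENNReal.ofReal_add (Nat.cast_nonneg _)
      (div_nonneg (Nat.cast_nonneg _) (sub_nonneg.2 (by exact_mod_cast hmk.le))),
      ENNReal.ofReal_natCast, ← add_assoc]
    refine le_trans ?_ (add_le_add (add_le_add_right (expectMid_const_le (k := k)
      (ch := ch) (x₀ := x₀) (r := r) (P := P) t _) _) hprob)
    rw [← expectMid_add, ← expectMid_add]
    refine expectMid_mono hk hx₀ hP (by omega) fun s hs => ?_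
    rw [← hs.core_eq] at hWm hrm hm ⊢
    obtain ⟨s', h1, -, -, -, -, h6⟩ := serveInPhase_settled (ch := ch) (h := history r P (t + 1))
      hk (hs.wf hk hP (by omega)) hs.inv (not_lt.1 hWm) hm
      (IsLazy.mem hP ht) (IsLazy.card hP ht) (IsLazy.subset hP ht)
    rw [h1, expect_pure, Option.elim_some, settledCost_core]
    refine (Nat.cast_le.2 h6).trans (le_of_eq ?_)
    push_cast
    rfl

theorem stepCost_nonneg {h : History Page} {a : Page} {Q : Finset Page} {x : State Page}
    (hm : x.marked.card ≤ k) : 0 ≤ stepCost k ch h a Q x := by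
  have : (0 : ℝ) ≤ (k : ℝ) - x.marked.card := sub_nonneg.2 (by exact_mod_cast hm)
  unfold stepCost
  split_ifs <;> positivity

theorem expectAt_cost_le (hk : 2 ≤ k) (hx₀ : x₀.card = k) (hP : IsLazyPrediction k T r P)
    {t : ℕ} (ht : t ≤ T) :
    expectAt k ch x₀ r P t (fun s => (s.cost : ENNReal)) ≤
      ENNReal.ofReal (∑ i ∈ Finset.range t, stepCost k ch (history r P (i + 1)) (r (i + 1))
        (P (i + 1)) (coreMid k ch r P i)) := by
  induction t with
  | zero => simp [expectAt, run, expect_pure, init]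
  | succ t ih =>
    rw [Finset.sum_range_succ, ENNReal.ofReal_add]
    · exact (expectAt_cost_succ_le hk hx₀ hP ht).trans (add_le_add_left (ih (by omega)) _)
    · exact Finset.sum_nonneg fun i hi => stepCost_nonneg
        (coreMid_wf hk ch hP (by have := Finset.mem_range.1 hi; omega)).1.marked_le
    · exact stepCost_nonneg (coreMid_wf hk ch hP (by omega)).1.marked_le

theorem expectedCost_le (hk : 2 ≤ k) (hx₀ : x₀.card = k) (hP : IsLazyPrediction k T r P) :
    expectedCost k ch x₀ r P T ≤
      ENNReal.ofReal (∑ i ∈ Finset.range T, stepCost k ch (history r P (i + 1)) (r (i + 1))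
        (P (i + 1)) (coreMid k ch r P i)) := by
  refine le_trans (expect_mono _ fun o ho => ?_) (expectAt_cost_le hk hx₀ hP le_rfl)
  obtain ⟨s, rfl, -⟩ := exists_reachable_of_mem_support hk hx₀ hP le_rfl ho
  exact le_rfl

end

end Caching.TrustDoubt

/-! ### Potentials that are sums over the clean pages. -/

namespace Caching.TrustDoubt

variable {Page : Type u} [DecidableEq Page]

section

variable {k : ℕ} {ch : Choices Page} {h : History Page} {r : Page} {P P' : Finset Page}
  {s : State Page}

/-- A potential that is a sum over the clean pages `q`: the contribution of `q` depends on the number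
of marked pages, on the threshold of `q`, on the end of the present `q`-interval, on whether `p q` is
trusted and on whether `p q` is in a given configuration `o`. -/
noncomputable def potential (φ : ℕ → ℕ → ℕ → Bool → Bool → ℝ) (o : Finset Page) (s : State Page) :
    ℝ :=
  ∑ q ∈ s.C, φ s.marked.card (s.thr q) (s.change q) (s.trusted q) (decide (s.p q ∈ o))

/-- The number of pages `p q` that are in the configuration `o`. -/
def predictedIn (o : Finset Page) (s : State Page) : ℕ := (s.C.filter fun q => s.p q ∈ o).card

/-- Whether the request `r` is a clean page that arrives. -/
def cleanArrival (k : ℕ) (r : Page) (s : State Page) : ℕ :=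
  if k ≤ s.W.card ∧ r ∉ s.W then 1 else 0

/-- Whether the request `r` makes Trust&Doubt stop trusting a predicted eviction. -/
def newDoubt (r : Page) (s : State Page) : ℕ := if r ∈ s.T then 1 else 0

theorem potential_eq_zero {φ : ℕ → ℕ → ℕ → Bool → Bool → ℝ} {o : Finset Page} (hC : s.C = ∅) :
    potential φ o s = 0 := by simp [potential, hC]

theorem Settled.old (hw : Wf k P s) {s₁ s₃ : State Page} (hS : Settled k r P' s s₁ s₃)
    (h₁ : s₁.thr = s.thr ∧ s₁.change = s.change ∧ s₁.trusted = s.trusted ∧ s₁.p = s.p) {q : Page}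
    (hq : q ∈ s.C) : s₃.thr q = s.thr q ∧ s₃.change q = s.change q ∧
      ((s.p q = r ∧ s₃.trusted q = false) ∨
        (s.p q ≠ r ∧ s₃.trusted q = s.trusted q ∧ s₃.p q = s.p q)) := by
  obtain ⟨h1, h2, h3, h4⟩ := h₁
  cases hS with
  | clean y hrW hyW hyP hyC =>
    have hqr : q ≠ r := fun h => hrW (h ▸ mem_W_of_mem_C hw hq)
    refine ⟨Function.update_of_ne hqr _ _, Function.update_of_ne hqr _ _, Or.inr ⟨?_, ?_, ?_⟩⟩
    · exact fun h => hrW (h ▸ hw.p_mem q hq)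
    · exact Function.update_of_ne hqr _ _
    · exact Function.update_of_ne hqr _ _
  | doubt q₀ y hrW hq₀ hqr hyW hyP hyC =>
    refine ⟨congrFun h1 q, congrFun h2 q, ?_⟩
    by_cases hqq : q = q₀
    · subst hqq
      exact Or.inl ⟨hqr, Function.update_self _ _ _⟩
    · exact Or.inr ⟨fun h => hqq (hw.inj hq hq₀ (h.trans hqr.symm)),
        Function.update_of_ne hqq _ _, Function.update_of_ne hqq _ _⟩
  | other hrW hC =>
    exact ⟨congrFun h1 q, congrFun h2 q, Or.inr ⟨hC q hq, congrFun h3 q, congrFun h4 q⟩⟩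

theorem Settled.C_eq {s₁ s₃ : State Page} (hS : Settled k r P' s s₁ s₃) (h₁ : s₁.C = s.C) :
    s₃.C = if r ∈ s.W then s.C else insert r s.C := by
  cases hS with
  | clean y hrW hyW hyP hyC => rw [if_neg hrW]
  | doubt q₀ y hrW hq₀ hqr hyW hyP hyC => rw [if_pos hrW]; exact h₁
  | other hrW hC => rw [if_pos hrW]; exact h₁

theorem Settled.new {s₁ s₃ : State Page} (hS : Settled k r P' s s₁ s₃) (hr : r ∉ s.W) :
    s₃.thr r = 1 ∧ s₃.change r = s₁.marked.card ∧ s₃.trusted r = true := by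
  cases hS with
  | clean y hrW hyW hyP hyC =>
    exact ⟨Function.update_self _ _ _, Function.update_self _ _ _, Function.update_self _ _ _⟩
  | doubt q₀ y hrW hq₀ hqr hyW hyP hyC => exact absurd hrW hr
  | other hrW hC => exact absurd hrW hr

theorem Settled.marked_eq {s₁ s₃ : State Page} (hS : Settled k r P' s s₁ s₃) :
    s₃.marked = s₁.marked ∧ s₃.stale = s₁.stale := by
  cases hS <;> exact ⟨rfl, rfl⟩

theorem marked_coreInPhase (hw : Wf k P s) (hr : r ∈ P') (hP' : P'.card = k)
    (hsub : P' ⊆ insert r P) : (coreInPhase k ch h r P' s).marked = insert r s.marked ∧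
      (coreInPhase k ch h r P' s).W = insert r s.W := by
  unfold coreInPhase
  split_ifs with hW
  · exact ⟨rfl, Finset.union_insert _ _ _⟩
  · have hS := settled_settle (ch := ch) (h := h) hw (not_lt.1 hW) hr hP' hsub
    obtain ⟨h1, h2⟩ := hS.marked_eq
    refine ⟨h1, ?_⟩
    change State.stale _ ∪ State.marked _ = _
    unfold advance renew
    rw [h1, h2]
    exact Finset.union_insert _ _ _

/-- Injectivity of `p` allows at most one clean page to be doubted per request. -/
theorem card_filter_p_eq (hw : Wf k P s) :
    (s.C.filter fun q => s.p q = r ∧ s.trusted q = true).card = newDoubt r s := by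
  unfold newDoubt
  split_ifs with hrT
  · obtain ⟨q, hq, htq, rfl⟩ := State.mem_T.1 hrT
    rw [Finset.card_eq_one]
    refine ⟨q, ?_⟩
    ext a
    simp only [Finset.mem_filter, Finset.mem_singleton]
    constructor
    · rintro ⟨h1, h2, -⟩
      exact hw.inj h1 hq h2
    · rintro rfl
      exact ⟨hq, rfl, htq⟩
  · rw [Finset.card_eq_zero, Finset.filter_eq_empty_iff]
    rintro q hq ⟨h1, h2⟩
    exact hrT (State.mem_T.2 ⟨q, hq, h2, h1⟩)

/-- The number of swaps in step 4 is at most this number. -/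
noncomputable def swapBound (ch : Choices Page) (h : History Page) (r : Page)
    (P : Finset Page) (s : State Page) : ℕ :=
  ((settle ch h r P (decide (r ∉ s.marked)) (s.mark r)).C.filter fun q =>
    due (decide (r ∉ s.marked)) (settle ch h r P (decide (r ∉ s.marked)) (s.mark r)) q ∧
      ((settle ch h r P (decide (r ∉ s.marked)) (s.mark r)).trusted q = false ∨
        (q = r ∧ r ∉ s.W))).card

/-- The change of a potential when a request is served while there are no ancient pages. -/
theorem potential_advance_le {φ : ℕ → ℕ → ℕ → Bool → Bool → ℝ} {o : Finset Page}
    {κ σ δ ε ν : ℝ} {m' : ℕ} (hw : Wf k P s) (hW : k ≤ s.W.card)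
    (hr : r ∈ P') (hP' : P'.card = k) (hsub : P' ⊆ insert r P) (hro : r ∈ o)
    (hm' : (insert r s.marked).card = m')
    (hkeep : ∀ q ∈ s.C, ∀ b g, φ m' (s.thr q) (s.change q) b g + (if b = true then 0 else κ) ≤
      φ s.marked.card (s.thr q) (s.change q) b g + if g = true then ε else 0)
    (hdoubt : ∀ q ∈ s.C, ∀ b g, φ m' (s.thr q) (s.change q) false g + (if b = true then 0 else κ) ≤
      φ s.marked.card (s.thr q) (s.change q) b true + (if g = true then ε else 0) +
        if b = true then δ else 0)
    (hrenew : ∀ q ∈ s.C, s.change q = m' → ∀ g,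
      φ m' (2 * s.thr q) (m' + 2 * s.thr q) true g + σ ≤ φ m' (s.thr q) m' false g)
    (hstay : ∀ q ∈ s.C, s.change q = m' → ∀ g,
      φ m' (s.thr q) (m' + s.thr q) true g ≤ φ m' (s.thr q) m' true g)
    (hnew : r ∉ s.W → ∀ g, φ m' 1 (m' + 1) true g + σ ≤ ν + if g = true then ε else 0) :
    potential φ o (advance ch h r P' s) + κ * s.doubted.card + σ * swapBound ch h r P' s ≤
      potential φ o s + δ * newDoubt r s + ε * predictedIn o (advance ch h r P' s) +
        ν * cleanArrival k r s := by
  -- The rates are κ for a page that was doubted, σ for a swap in step 4, δ for a new doubt, ε for a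
  -- prediction lying in `o` afterwards, and ν for a clean arrival.
  have hS := settled_settle (ch := ch) (h := h) hw hW hr hP' hsub
  rw [← card_filter_p_eq hw]
  unfold potential predictedIn advance swapBound State.doubted
  generalize hs₃ : settle ch h r P' (decide (r ∉ s.marked)) (s.mark r) = s₃ at *
  set b := decide (r ∉ s.marked) with hb
  have hmark₃ : s₃.marked.card = m' := by rw [hS.marked_eq.1]; exact hm'
  -- The new contribution of `q` plus its swap charge minus its error allowance. In this form old
  -- clean pages can be compared term by term, and a clean arrival adds a single summand.
  let a : Page → ℝ := fun q => φ m' ((renew b s₃.C s₃).thr q) ((renew b s₃.C s₃).change q)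
    ((renew b s₃.C s₃).trusted q) (decide (s₃.p q ∈ o)) +
      σ * (if due b s₃ q ∧ (s₃.trusted q = false ∨ (q = r ∧ r ∉ s.W)) then 1 else 0) -
      if s₃.p q ∈ o then ε else 0
  have hold : ∀ q ∈ s.C, a q + (if s.trusted q = false then κ else 0) ≤
      φ s.marked.card (s.thr q) (s.change q) (s.trusted q) (decide (s.p q ∈ o)) +
        if s.p q = r ∧ s.trusted q = true then δ else 0 := by
    intro q hq
    have hq₃ : q ∈ s₃.C := by
      rw [hS.C_eq rfl]; split_ifs
      · exact hq
      · exact Finset.mem_insert_of_mem hq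
    have hqr : ¬ (q = r ∧ r ∉ s.W) := by
      rintro ⟨rfl, h1⟩
      exact h1 (mem_W_of_mem_C hw hq)
    obtain ⟨h1, h2, h3⟩ := hS.old hw ⟨rfl, rfl, rfl, rfl⟩ hq
    have hle : a q ≤ φ m' (s.thr q) (s.change q) (s₃.trusted q) (decide (s₃.p q ∈ o)) -
        if s₃.p q ∈ o then ε else 0 := by
      refine sub_le_sub_right ?_ _
      by_cases hd : due b s₃ q
      · have hc : s.change q = m' := by rw [← h2, hd.2, hmark₃]
        simp only [renew, hq₃, hd, and_self, if_true, nextThr, hmark₃, h1, hqr, or_false, true_and]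
        cases htq : s₃.trusted q
        · have := hrenew q hq hc (decide (s₃.p q ∈ o))
          simpa [hc] using this
        · have := hstay q hq hc (decide (s₃.p q ∈ o))
          simpa [hc] using this
      · simp only [renew, hd, and_false, if_false, h1, h2, false_and, mul_zero, add_zero]
        exact le_rfl
    rcases h3 with ⟨h3, h4⟩ | ⟨h3, h4, h5⟩
    · have := hdoubt q hq (s.trusted q) (decide (s₃.p q ∈ o))
      rw [h4] at hle
      have hro' : s.p q ∈ o := h3 ▸ hro
      simp only [h3, true_and, hro, decide_true] at this ⊢
      cases htq : s.trusted q <;> simp only [htq, decide_eq_true_eq] at this hle ⊢ <;>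
        simp at this ⊢ <;> linarith
    · have := hkeep q hq (s.trusted q) (decide (s₃.p q ∈ o))
      rw [h4] at hle
      rw [h5] at hle this
      simp only [h3, false_and, if_false]
      cases htq : s.trusted q <;> simp only [htq, decide_eq_true_eq] at this hle ⊢ <;>
        simp at this ⊢ <;> linarith
  have hsumold : ∑ q ∈ s.C, a q + κ * (s.C.filter fun q => s.trusted q = false).card ≤
      ∑ q ∈ s.C, φ s.marked.card (s.thr q) (s.change q) (s.trusted q) (decide (s.p q ∈ o)) +
        δ * (s.C.filter fun q => s.p q = r ∧ s.trusted q = true).card := by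
    have := Finset.sum_le_sum hold
    rw [Finset.sum_add_distrib, Finset.sum_add_distrib, ← Finset.sum_filter, ← Finset.sum_filter,
      Finset.sum_const, Finset.sum_const, nsmul_eq_mul, nsmul_eq_mul] at this
    linarith
  have hsumnew : ∑ q ∈ s₃.C, a q ≤ ∑ q ∈ s.C, a q + ν * cleanArrival k r s := by
    rw [hS.C_eq rfl]
    unfold cleanArrival
    by_cases hrW : r ∈ s.W
    · simp [hrW]
    · have hrC : r ∉ s.C := fun h => hrW (mem_W_of_mem_C hw h)
      rw [if_neg hrW, if_pos ⟨hW, hrW⟩, Finset.sum_insert hrC, Nat.cast_one, mul_one, add_comm]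
      refine add_le_add_right ?_ _
      obtain ⟨h1, h2, h3⟩ := hS.new hrW
      have hb' : b = true := by
        rw [hb, decide_eq_true_eq]
        exact fun h => hrW (Finset.mem_union_right _ h)
      have hd : due b s₃ r := ⟨hb', by rw [h2, hS.marked_eq.1]⟩
      have hr₃ : r ∈ s₃.C := by rw [hS.C_eq rfl, if_neg hrW]; exact Finset.mem_insert_self _ _
      have := hnew hrW (decide (s₃.p r ∈ o))
      simp only [a, renew, hr₃, hd, hrW, and_self, if_true, nextThr, h1, h3, hmark₃,
        not_false_eq_true, or_true, mul_one, Bool.true_eq_false, if_false]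
      simp only [decide_eq_true_eq] at this
      linarith
  have hexp : ∑ q ∈ s₃.C, a q = ∑ q ∈ s₃.C, φ m' ((renew b s₃.C s₃).thr q)
      ((renew b s₃.C s₃).change q) ((renew b s₃.C s₃).trusted q) (decide (s₃.p q ∈ o)) +
      σ * (s₃.C.filter fun q => due b s₃ q ∧
        (s₃.trusted q = false ∨ (q = r ∧ r ∉ s.W))).card -
      ε * (s₃.C.filter fun q => s₃.p q ∈ o).card := by
    simp only [a]
    rw [Finset.sum_sub_distrib, Finset.sum_add_distrib, ← Finset.mul_sum, Finset.sum_boole,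
      ← Finset.sum_filter, Finset.sum_const, nsmul_eq_mul, mul_comm ε]
  have hgoal : (∑ q ∈ (renew b s₃.C s₃).C, φ (renew b s₃.C s₃).marked.card
      ((renew b s₃.C s₃).thr q) ((renew b s₃.C s₃).change q) ((renew b s₃.C s₃).trusted q)
      (decide ((renew b s₃.C s₃).p q ∈ o))) = ∑ q ∈ s₃.C, φ m' ((renew b s₃.C s₃).thr q)
      ((renew b s₃.C s₃).change q) ((renew b s₃.C s₃).trusted q) (decide (s₃.p q ∈ o)) := by
    rw [← hmark₃]; rfl
  rw [hgoal]
  change _ ≤ _ + ε * ((s₃.C.filter fun q => s₃.p q ∈ o).card : ℝ) + _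
  linarith

/-- The `p q` are distinct pages outside the prediction; those lying in `o` are therefore witnesses
of prediction error. -/
theorem predictedIn_le {o : Finset Page} (hw : Wf k P s) : predictedIn o s ≤ (o \ P).card := by
  unfold predictedIn
  refine Finset.card_le_card_of_injOn s.p (fun q hq => ?_) (hw.inj.mono ?_)
  · have hq' := Finset.mem_filter.1 (Finset.mem_coe.1 hq)
    exact Finset.mem_coe.2 (Finset.mem_sdiff.2 ⟨hq'.2, hw.p_notMem q hq'.1⟩)
  · exact Finset.coe_subset.2 (Finset.filter_subset _ _)

theorem potential_coreBegin_le {φ : ℕ → ℕ → ℕ → Bool → Bool → ℝ} {o : Finset Page}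
    (hφ : 0 ≤ potential φ o s) : potential φ o (coreBegin k r s) ≤ potential φ o s := by
  unfold coreBegin
  split_ifs with hm
  · rwa [potential_eq_zero rfl]
  · exact le_rfl

/-- The change of a potential when another configuration is considered. -/
theorem potential_move_le {φ : ℕ → ℕ → ℕ → Bool → Bool → ℝ} {o o' : Finset Page} {ℓ : ℝ}
    (hℓ : 0 ≤ ℓ) (hw : Wf k P s)
    (hload : ∀ q ∈ s.C, ∀ b, φ s.marked.card (s.thr q) (s.change q) b true ≤
      φ s.marked.card (s.thr q) (s.change q) b false + ℓ)
    (hevict : ∀ q ∈ s.C, ∀ b, φ s.marked.card (s.thr q) (s.change q) b false ≤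
      φ s.marked.card (s.thr q) (s.change q) b true) :
    potential φ o' s ≤ potential φ o s + ℓ * (o' \ o).card := by
  have h1 : (s.C.filter fun q => s.p q ∈ o' \ o).card ≤ (o' \ o).card := by
    refine Finset.card_le_card_of_injOn s.p (fun q hq => ?_) (hw.inj.mono ?_)
    · exact (Finset.mem_filter.1 (Finset.mem_coe.1 hq)).2
    · exact Finset.coe_subset.2 (Finset.filter_subset _ _)
  have h2 : potential φ o' s ≤
      potential φ o s + ℓ * (s.C.filter fun q => s.p q ∈ o' \ o).card := by
    unfold potential
    rw [mul_comm ℓ, ← nsmul_eq_mul, ← Finset.sum_const, Finset.sum_filter,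
      ← Finset.sum_add_distrib]
    refine Finset.sum_le_sum fun q hq => ?_
    have h3 := hload q hq (s.trusted q)
    have h4 := hevict q hq (s.trusted q)
    by_cases h5 : s.p q ∈ o' <;> by_cases h6 : s.p q ∈ o <;> simp [h5, h6] <;> linarith
  refine h2.trans (add_le_add_right (mul_le_mul_of_nonneg_left ?_ hℓ) _)
  exact_mod_cast h1

end

end Caching.TrustDoubt

/-! ### The three potentials and the amortized bounds for one request. -/

namespace Caching.TrustDoubt

/-- The sum `1/(n+1) + … + 1/a`, which is `0` if `a ≤ n`. -/
noncomputable def harmonicGap (n a : ℕ) : ℝ := (harmonic a : ℝ) - (harmonic (min n a) : ℝ)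

theorem harmonic_mono {m n : ℕ} (h : m ≤ n) : (harmonic m : ℝ) ≤ harmonic n := by
  have : Monotone harmonic := monotone_nat_of_le_succ fun n => by
    rw [harmonic_succ]
    exact le_add_of_nonneg_right (by positivity)
  exact_mod_cast this h

theorem harmonicGap_nonneg (n a : ℕ) : 0 ≤ harmonicGap n a :=
  sub_nonneg.2 (harmonic_mono (min_le_right _ _))

theorem harmonicGap_anti {m n : ℕ} (h : m ≤ n) (a : ℕ) : harmonicGap n a ≤ harmonicGap m a :=
  sub_le_sub_left (harmonic_mono (min_le_min_right a h)) _

theorem harmonicGap_mono (n : ℕ) {a b : ℕ} (h : a ≤ b) : harmonicGap n a ≤ harmonicGap n b := by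
  unfold harmonicGap
  rcases le_total n a with h1 | h1
  · rw [min_eq_left h1, min_eq_left (h1.trans h)]
    exact sub_le_sub_right (harmonic_mono h) _
  · rw [min_eq_right h1, sub_self]
    exact harmonicGap_nonneg n b

theorem harmonicGap_of_lt {n a : ℕ} (h : n < a) :
    harmonicGap n a = harmonicGap (n + 1) a + 1 / ((n : ℝ) + 1) := by
  unfold harmonicGap
  rw [min_eq_left h.le, min_eq_left h, harmonic_succ]
  push_cast
  ring

theorem harmonicGap_two_pow_le (n e : ℕ) : harmonicGap n (2 ^ e) ≤ 1 + e := by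
  have h1 : (0 : ℝ) ≤ harmonic (min n (2 ^ e)) := by
    have := harmonic_mono (Nat.zero_le (min n (2 ^ e)))
    simpa using this
  have h2 := harmonic_le_one_add_log (2 ^ e)
  have h3 : Real.log ((2 ^ e : ℕ) : ℝ) ≤ e := by
    push_cast
    rw [Real.log_pow]
    have h4 : Real.log 2 ≤ 1 := by
      have := Real.log_two_lt_d9; linarith
    have : (0 : ℝ) ≤ e := Nat.cast_nonneg e
    nlinarith
  unfold harmonicGap
  linarith

/-- The potential of a clean page that bounds the expected cost: `m` pages are marked, the threshold
is `t`, the present interval ends at `c`, and `b` tells whether the predicted eviction is trusted. -/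
noncomputable def costPot (k m t c : ℕ) (b _g : Bool) : ℝ :=
  3 + Nat.log 2 t + (if b = true then 0 else 3 - ((m : ℝ) - ((c : ℝ) - t)) / t) -
    harmonicGap (k - m) (2 * t)

/-- The potential of a clean page that bounds the number of doubts in terms of the cache size. -/
noncomputable def sizePot (Λ _m t _c : ℕ) (b _g : Bool) : ℝ :=
  1 + Λ - Nat.log 2 t - if b = true then 0 else 1

/-- The potential of a clean page that bounds the number of doubts in terms of the prediction
error; `g` tells whether the predicted eviction is in the configuration of the offline algorithm. -/
noncomputable def errorPot (L m t c : ℕ) (b g : Bool) : ℝ :=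
  L + 2 + (if g = true then min 1 (((m : ℝ) - ((c : ℝ) - t)) / 2 ^ L)
    else if b = true then -1 else 0) - min (Nat.log 2 t : ℝ) L - if b = true then 0 else 1

/-- A doubted page must pay 1/(k-m) per arrival. If k - m > 2t, the elapsed fraction of the
interval, growing by 1/t, suffices. If k - m ≤ 2t, the harmonic gap grows by exactly 1/(k-m). -/
theorem costPot_succ_le {k m t c : ℕ} (hm : m < k) (ht : 1 ≤ t) (b g g' : Bool) :
    costPot k (m + 1) t c b g + (if b = true then 0 else 1 / ((k : ℝ) - m)) ≤
      costPot k m t c b g' := by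
  obtain ⟨n, rfl⟩ : ∃ n, k = m + n + 1 := ⟨k - m - 1, by omega⟩
  unfold costPot
  rw [show m + n + 1 - (m + 1) = n by omega, show m + n + 1 - m = n + 1 by omega]
  have h1 := harmonicGap_anti (Nat.le_succ n) (2 * t)
  cases b
  · simp only [Bool.false_eq_true, if_false]
    have ht' : (1 : ℝ) ≤ t := by exact_mod_cast ht
    have hk : (((m + n + 1 : ℕ) : ℝ) - m) = (n : ℝ) + 1 := by push_cast; ring
    have hsplit : (((m + 1 : ℕ) : ℝ) - ((c : ℝ) - t)) / t =
        ((m : ℝ) - ((c : ℝ) - t)) / t + 1 / t := by push_cast; ring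
    rw [hk, hsplit]
    have h2 : (0 : ℝ) ≤ 1 / t := by positivity
    rcases lt_or_ge n (2 * t) with h | h
    · rw [harmonicGap_of_lt h]
      linarith
    · have h3 : 1 / ((n : ℝ) + 1) ≤ 1 / t := by
        refine one_div_le_one_div_of_le (by linarith) ?_
        have : (2 * t : ℝ) ≤ n := by exact_mod_cast h
        linarith
      linarith
  · simp only [if_true]
    linarith

theorem costPot_doubt_le {k m t c : ℕ} (hc : c ≤ m + t) (g g' : Bool) :
    costPot k m t c false g ≤ costPot k m t c true g' + 3 := by
  unfold costPot
  simp only [Bool.false_eq_true, if_false, if_true]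
  have : (0 : ℝ) ≤ ((m : ℝ) - ((c : ℝ) - t)) / t := by
    have : (c : ℝ) ≤ m + t := by exact_mod_cast hc
    exact div_nonneg (by linarith) (Nat.cast_nonneg _)
  linarith

theorem log_two_mul {t : ℕ} (ht : 1 ≤ t) : Nat.log 2 (2 * t) = Nat.log 2 t + 1 := by
  rw [mul_comm]
  exact Nat.log_mul_base (by norm_num) (by omega)

/-- At the end of a doubted interval the doubt term is 3 - 1 = 2: one unit pays for the increase of
the logarithm, the other for the swap. -/
theorem costPot_renew_le (k : ℕ) {m t : ℕ} (ht : 1 ≤ t) (c : ℕ) (g g' : Bool) :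
    costPot k m (2 * t) c true g + 1 ≤ costPot k m t m false g' := by
  unfold costPot
  simp only [Bool.false_eq_true, if_false, if_true]
  have ht' : (t : ℝ) ≠ 0 := by positivity
  rw [log_two_mul ht, show ((m : ℝ) - ((m : ℝ) - t)) / t = 1 by field_simp; ring]
  have := harmonicGap_mono (k - m) (show 2 * t ≤ 2 * (2 * t) by omega)
  push_cast
  linarith

theorem costPot_new_le (k m c : ℕ) (g : Bool) : costPot k m 1 c true g ≤ 3 := by
  unfold costPot
  simp only [if_true]
  have := harmonicGap_nonneg (k - m) (2 * 1)
  simp at this ⊢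
  linarith

/-- The gap up to 2^(e+1) is at most 2 + e, against 3 + e. The remaining unit will pay for an
ancient page of the next phase. -/
theorem one_le_costPot (k : ℕ) {m t c e : ℕ} (ht : t = 2 ^ e) (hc : m ≤ c) (b g : Bool) :
    1 ≤ costPot k m t c b g := by
  unfold costPot
  have h1 := harmonicGap_two_pow_le (k - m) (e + 1)
  have h2 : Nat.log 2 t = e := by rw [ht]; exact Nat.log_pow (by norm_num) e
  have h3 : 2 * t = 2 ^ (e + 1) := by rw [ht]; ring
  rw [h2, h3]
  push_cast at h1
  cases b
  · simp only [Bool.false_eq_true, if_false]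
    have ht' : (0 : ℝ) < t := by rw [ht]; positivity
    have : ((m : ℝ) - ((c : ℝ) - t)) / t ≤ 1 := by
      rw [div_le_one ht']
      have : (m : ℝ) ≤ c := by exact_mod_cast hc
      linarith
    linarith
  · simp only [if_true]
    linarith

theorem sizePot_nonneg {Λ m t c : ℕ} (ht : Nat.log 2 t ≤ Λ) (b g : Bool) :
    0 ≤ sizePot Λ m t c b g := by
  unfold sizePot
  have : (Nat.log 2 t : ℝ) ≤ Λ := by exact_mod_cast ht
  split_ifs <;> linarith

theorem div_two_pow_succ_le {L m m' t c : ℕ} (hm : m' ≤ m + 1) :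
    ((m' : ℝ) - ((c : ℝ) - t)) / 2 ^ L ≤ ((m : ℝ) - ((c : ℝ) - t)) / 2 ^ L + 1 / 2 ^ L := by
  rw [← add_div]
  refine div_le_div_of_nonneg_right ?_ (by positivity)
  have : (m' : ℝ) ≤ m + 1 := by exact_mod_cast hm
  linarith

theorem min_one_add_le {a b c : ℝ} (hc : 0 ≤ c) (h : a ≤ b + c) : min 1 a ≤ min 1 b + c := by
  rcases le_total 1 b with h1 | h1
  · rw [min_eq_left h1]; exact (min_le_left _ _).trans (by linarith)
  · rw [min_eq_right h1]; exact (min_le_right _ _).trans h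

theorem errorPot_keep_le {L m m' t c : ℕ} (hm : m' ≤ m + 1) (b g : Bool) :
    errorPot L m' t c b g ≤ errorPot L m t c b g + if g = true then 1 / 2 ^ L else 0 := by
  unfold errorPot
  cases g
  · simp
  · simp only [if_true]
    have := min_one_add_le (by positivity) (div_two_pow_succ_le (L := L) (t := t) (c := c) hm)
    linarith

/-- The old prediction was requested and so lies in `o`, where its error term is nonnegative. Its
replacement inherits that term if it lies in `o` and has term 0 otherwise, so the decrease by 1
caused by doubting is available. -/
theorem errorPot_doubt_le {L m m' t c : ℕ} (hm : m' ≤ m + 1) (hc : c ≤ m + t) (b g : Bool) :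
    errorPot L m' t c false g ≤ errorPot L m t c b true +
      (if g = true then 1 / 2 ^ L else 0) + if b = true then -1 else 0 := by
  unfold errorPot
  have h1 := min_one_add_le (by positivity) (div_two_pow_succ_le (L := L) (t := t) (c := c) hm)
  have h2 : (0 : ℝ) ≤ min 1 (((m : ℝ) - ((c : ℝ) - t)) / 2 ^ L) := by
    have : (c : ℝ) ≤ m + t := by exact_mod_cast hc
    exact le_min zero_le_one (div_nonneg (by linarith) (by positivity))
  cases g <;> cases b <;> simp only [Bool.false_eq_true, if_false, if_true] <;> linarith

/-- Removing the doubt costs 1. For t < 2^L the growing logarithm pays. For t ≥ 2^L the logarithmic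
term is capped, but the completed interval has brought the error term to 1 if the prediction lies in
`o`; outside `o` the trusted value -1 pays. -/
theorem errorPot_renew_le (L : ℕ) {m t e : ℕ} (ht : t = 2 ^ e) (g : Bool) :
    errorPot L m (2 * t) (m + 2 * t) true g ≤ errorPot L m t m false g := by
  unfold errorPot
  have ht1 : 1 ≤ t := by rw [ht]; exact Nat.one_le_two_pow
  have h2 : Nat.log 2 t = e := by rw [ht]; exact Nat.log_pow (by norm_num) e
  rw [log_two_mul ht1, h2]
  have h3 : ((m : ℝ) - (((m + 2 * t : ℕ) : ℝ) - ((2 * t : ℕ) : ℝ))) / 2 ^ L = 0 := by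
    push_cast; simp
  have h4 : ((m : ℝ) - ((m : ℝ) - t)) / 2 ^ L = 2 ^ e / 2 ^ L := by
    rw [ht]; push_cast; ring
  rw [h3, h4]
  have h0 : (0 : ℝ) ≤ min 1 (2 ^ e / 2 ^ L) := le_min zero_le_one (by positivity)
  have h00 : min (1 : ℝ) 0 = 0 := min_eq_right zero_le_one
  rcases lt_or_ge e L with h | h
  · have h5 : min ((e + 1 : ℕ) : ℝ) (L : ℝ) = e + 1 := by
      rw [min_eq_left (by exact_mod_cast h)]; push_cast; ring
    have h6 : min (e : ℝ) (L : ℝ) = e := min_eq_left (by exact_mod_cast h.le)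
    rw [h5, h6]
    cases g <;> simp only [Bool.false_eq_true, if_false, if_true] <;> linarith
  · have h5 : min ((e + 1 : ℕ) : ℝ) (L : ℝ) = L := min_eq_right (by exact_mod_cast h.trans (by omega))
    have h6 : min (e : ℝ) (L : ℝ) = L := min_eq_right (by exact_mod_cast h)
    have h7 : min (1 : ℝ) (2 ^ e / 2 ^ L) = 1 := by
      refine min_eq_left ((one_le_div (by positivity)).2 ?_)
      exact pow_le_pow_right₀ (by norm_num) h
    rw [h5, h6, h7]
    cases g <;> simp only [Bool.false_eq_true, if_false, if_true] <;> linarith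

theorem errorPot_stay_le (L m t : ℕ) (g : Bool) :
    errorPot L m t (m + t) true g ≤ errorPot L m t m true g := by
  unfold errorPot
  have h3 : ((m : ℝ) - (((m + t : ℕ) : ℝ) - (t : ℝ))) / 2 ^ L = 0 := by
    push_cast; simp
  have h4 : (0 : ℝ) ≤ min 1 (((m : ℝ) - ((m : ℝ) - t)) / 2 ^ L) :=
    le_min zero_le_one (div_nonneg (by simp) (by positivity))
  have h00 : min (1 : ℝ) 0 = 0 := min_eq_right zero_le_one
  rw [h3]
  cases g <;> simp only [Bool.false_eq_true, if_false, if_true] <;> linarith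

theorem errorPot_new_le (L m : ℕ) (g : Bool) : errorPot L m 1 (m + 1) true g ≤ L + 2 := by
  unfold errorPot
  have h3 : ((m : ℝ) - (((m + 1 : ℕ) : ℝ) - ((1 : ℕ) : ℝ))) / 2 ^ L = 0 := by
    push_cast; simp
  have h00 : min (1 : ℝ) 0 = 0 := min_eq_right zero_le_one
  rw [h3, Nat.log_one_right]
  have : min ((0 : ℕ) : ℝ) (L : ℝ) = 0 := by simp
  rw [this]
  cases g <;> simp only [Bool.false_eq_true, if_false, if_true] <;> linarith

theorem errorPot_nonneg (L : ℕ) {m t c : ℕ} (hc : c ≤ m + t) (b g : Bool) :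
    0 ≤ errorPot L m t c b g := by
  unfold errorPot
  have h2 : (0 : ℝ) ≤ min 1 (((m : ℝ) - ((c : ℝ) - t)) / 2 ^ L) := by
    have : (c : ℝ) ≤ m + t := by exact_mod_cast hc
    exact le_min zero_le_one (div_nonneg (by linarith) (by positivity))
  have h3 := min_le_right (Nat.log 2 t : ℝ) (L : ℝ)
  cases g <;> cases b <;> simp only [Bool.false_eq_true, if_false, if_true] <;> linarith

/-- The offline algorithm pays for raising a contribution from at least -1 (trusted, outside `o`) to
at most 1. -/
theorem errorPot_load_le (L : ℕ) {m t c : ℕ} (b : Bool) :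
    errorPot L m t c b true ≤ errorPot L m t c b false + 2 := by
  unfold errorPot
  have h2 := min_le_left (1 : ℝ) (((m : ℝ) - ((c : ℝ) - t)) / 2 ^ L)
  cases b <;> simp only [Bool.false_eq_true, if_false, if_true] <;> linarith

theorem errorPot_evict_le (L : ℕ) {m t c : ℕ} (hc : c ≤ m + t) (b : Bool) :
    errorPot L m t c b false ≤ errorPot L m t c b true := by
  unfold errorPot
  have h2 : (0 : ℝ) ≤ min 1 (((m : ℝ) - ((c : ℝ) - t)) / 2 ^ L) := by
    have : (c : ℝ) ≤ m + t := by exact_mod_cast hc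
    exact le_min zero_le_one (div_nonneg (by linarith) (by positivity))
  cases b <;> simp only [Bool.false_eq_true, if_false, if_true] <;> linarith

variable {Page : Type u}

theorem ThrWf.one_le {s : State Page} (ht : ThrWf s) {q : Page} (hq : q ∈ s.C) : 1 ≤ s.thr q := by
  obtain ⟨e, he⟩ := ht.pow q hq
  rw [he]; exact Nat.one_le_two_pow

variable [DecidableEq Page]

section

variable {k : ℕ} {ch : Choices Page} {h : History Page} {r : Page} {P P' : Finset Page}
  {s : State Page}

theorem card_insert_marked_le (r : Page) (s : State Page) :
    (insert r s.marked).card ≤ s.marked.card + 1 := Finset.card_insert_le _ _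

theorem card_C_le_potential_costPot (o : Finset Page) (ht : ThrWf s) :
    (s.C.card : ℝ) ≤ potential (costPot k) o s := by
  have : ∑ q ∈ s.C, (1 : ℝ) ≤ potential (costPot k) o s :=
    Finset.sum_le_sum fun q hq => by
      obtain ⟨e, he⟩ := ht.pow q hq
      exact one_le_costPot k he (ht.lt_change q hq).le _ _
  simpa using this

theorem coreInPhase_of_lt (hW : s.W.card < k) : coreInPhase k ch h r P s = s.mark r := if_pos hW

theorem coreInPhase_of_le (hW : k ≤ s.W.card) : coreInPhase k ch h r P s = advance ch h r P s :=
  if_neg (not_lt.2 hW)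

/-- The cost of a request is paid by the clean pages, the doubts and the decrease of the
potential. -/
theorem stepCost_add_le (o : Finset Page) (hw : Wf k P s) (ht : ThrWf s)
    (hm : s.marked.card < k ∨ r ∈ s.marked)
    (hr : r ∈ P') (hP' : P'.card = k) (hsub : P' ⊆ insert r P) :
    stepCost k ch h r P' s + (((k - (coreInPhase k ch h r P' s).W.card : ℕ) : ℝ) +
        potential (costPot k) (insert r o) (coreInPhase k ch h r P' s)) ≤
      ((k - s.W.card : ℕ) : ℝ) + potential (costPot k) o s +
        5 * (cleanArrival k r s + newDoubt r s : ℕ) := by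
  rw [(marked_coreInPhase (ch := ch) (h := h) hw hr hP' hsub).2]
  -- This potential ignores the configuration; `insert r o` only serves to satisfy the requirement
  -- that `r` is in it.
  have hswitch : potential (costPot k) o s = potential (costPot k) (insert r o) s := rfl
  rw [hswitch]
  rcases lt_or_ge s.W.card k with hW | hW
  · have hC := C_eq_empty hw hW
    rw [coreInPhase_of_lt hW, potential_eq_zero hC, potential_eq_zero (show (s.mark r).C = ∅ from hC)]
    unfold stepCost
    rw [if_pos hW]
    have h1 : (0 : ℝ) ≤ 5 * (cleanArrival k r s + newDoubt r s : ℕ) := by positivity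
    split_ifs with hrW
    · rw [Finset.insert_eq_of_mem hrW]; linarith
    · rw [Finset.card_insert_of_notMem hrW]
      have : k - s.W.card = (k - (s.W.card + 1)) + 1 := by omega
      rw [this]; push_cast
      push_cast at h1
      linarith
  · rw [coreInPhase_of_le hW]
    have hW' : k ≤ (insert r s.W).card := hW.trans (Finset.card_le_card (Finset.subset_insert _ _))
    rw [Nat.sub_eq_zero_of_le hW, Nat.sub_eq_zero_of_le hW']
    set κ : ℝ := if r ∈ s.marked then 0 else 1 / ((k : ℝ) - s.marked.card) with hκ
    have hκ0 : 0 ≤ κ := by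
      have : (0 : ℝ) ≤ (k : ℝ) - s.marked.card := sub_nonneg.2 (by exact_mod_cast hw.marked_le)
      rw [hκ]; split_ifs <;> positivity
    have hkeep : ∀ q ∈ s.C, ∀ b g g', costPot k (insert r s.marked).card (s.thr q) (s.change q) b g +
        (if b = true then 0 else κ) ≤ costPot k s.marked.card (s.thr q) (s.change q) b g' := by
      intro q hq b g g'
      by_cases hrm : r ∈ s.marked
      · rw [Finset.insert_eq_of_mem hrm, hκ, if_pos hrm]
        simp only [ite_self, add_zero]
        exact le_rfl
      · rw [Finset.card_insert_of_notMem hrm, hκ, if_neg hrm]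
        exact costPot_succ_le (hm.resolve_right hrm) (ht.one_le hq) b g g'
    -- A clean page starts with at most 3 and is charged one swap, so ν = 4; its fault makes 5. A
    -- doubt raises the potential by at most 3 and its fault costs 1, which is also below 5.
    have := potential_advance_le (φ := costPot k) (o := insert r o) (κ := κ) (σ := 1) (δ := 3)
      (ε := 0) (ν := 4) (ch := ch) (h := h) hw hW hr hP' hsub (Finset.mem_insert_self _ _) rfl
      (fun q hq b g => by simpa using hkeep q hq b g g)
      (fun q hq b g => by
        cases b
        · simpa using hkeep q hq false g true
        · have h1 := hkeep q hq true g true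
          have h2 := costPot_doubt_le (k := k) (m := (insert r s.marked).card) (t := s.thr q)
            (c := s.change q) ((ht.change_le q hq).trans (Nat.add_le_add_right
              (Finset.card_le_card (Finset.subset_insert _ _)) _)) g g
          simp at h1 ⊢
          linarith)
      (fun q hq _ g => costPot_renew_le k (ht.one_le hq) _ g g)
      (fun q _ _ g => le_rfl)
      (fun _ g => by
        have := costPot_new_le k (insert r s.marked).card ((insert r s.marked).card + 1) g
        simp
        linarith)
    have hcost : stepCost k ch h r P' s = cleanArrival k r s + newDoubt r s +
        swapBound ch h r P' s + κ * s.doubted.card := by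
      unfold stepCost
      rw [if_neg (not_lt.2 hW)]
      congr 1
      · unfold settledCost cleanArrival newDoubt
        simp only [hW, true_and, swapBound]
        by_cases hrW : r ∈ s.W <;> simp [hrW]
      · rw [hκ]; split_ifs
        · simp
        · ring
    rw [hcost]
    push_cast
    have h1 : (0 : ℝ) ≤ newDoubt r s := Nat.cast_nonneg _
    linarith

/-- A doubt lowers the potential by 1. Trusting again restores this unit, but the doubled threshold
takes it away at the same time. -/
theorem potential_sizePot_add_le {Λ : ℕ} (o : Finset Page) (hw : Wf k P s) (ht : ThrWf s)
    (hr : r ∈ P') (hP' : P'.card = k) (hsub : P' ⊆ insert r P) :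
    potential (sizePot Λ) (insert r o) (coreInPhase k ch h r P' s) + newDoubt r s ≤
      potential (sizePot Λ) o s + (1 + Λ) * cleanArrival k r s := by
  have hswitch : potential (sizePot Λ) o s = potential (sizePot Λ) (insert r o) s := rfl
  rw [hswitch]
  rcases lt_or_ge s.W.card k with hW | hW
  · have hC := C_eq_empty hw hW
    rw [coreInPhase_of_lt hW, potential_eq_zero hC, potential_eq_zero (show (s.mark r).C = ∅ from hC)]
    have : newDoubt r s = 0 := by simp [newDoubt, T_eq_empty hC]
    rw [this, Nat.cast_zero]
    have : (0 : ℝ) ≤ (1 + Λ) * cleanArrival k r s := by positivity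
    linarith
  · rw [coreInPhase_of_le hW]
    have := potential_advance_le (φ := sizePot Λ) (o := insert r o) (κ := 0) (σ := 0) (δ := -1)
      (ε := 0) (ν := 1 + Λ) (ch := ch) (h := h) hw hW hr hP' hsub (Finset.mem_insert_self _ _) rfl
      (fun q hq b g => by simp [sizePot])
      (fun q hq b g => by cases b <;> simp [sizePot])
      (fun q hq _ g => by
        simp only [sizePot, log_two_mul (ht.one_le hq)]
        push_cast
        simp)
      (fun q _ _ g => le_rfl)
      (fun _ g => by simp [sizePot])
    linarith

theorem potential_errorPot_add_le (L : ℕ) {o o' : Finset Page} (hw : Wf k P s) (ht : ThrWf s)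
    (hm : s.marked.card < k ∨ r ∈ s.marked)
    (hr : r ∈ P') (hP' : P'.card = k) (hsub : P' ⊆ insert r P) (hro : r ∈ o') :
    potential (errorPot L) o' (coreInPhase k ch h r P' s) + newDoubt r s ≤
      potential (errorPot L) o s + 2 * configDist o o' + configDist P' o' / 2 ^ L +
        (L + 2) * cleanArrival k r s := by
  have hw' := (coreInPhase_wf (ch := ch) (h := h) hw ht hm hr hP' hsub).1
  have hmove : potential (errorPot L) o' s ≤ potential (errorPot L) o s + 2 * configDist o o' :=
    potential_move_le (φ := errorPot L) (o := o) (o' := o') (ℓ := 2) (by norm_num) hw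
    (fun q hq b => errorPot_load_le L b)
    (fun q hq b => errorPot_evict_le L (ht.change_le q hq) b)
  have herr : (predictedIn o' (coreInPhase k ch h r P' s) : ℝ) ≤ configDist P' o' := by
    exact_mod_cast predictedIn_le hw'
  rcases lt_or_ge s.W.card k with hW | hW
  · have hC := C_eq_empty hw hW
    rw [coreInPhase_of_lt hW, potential_eq_zero hC, potential_eq_zero (show (s.mark r).C = ∅ from hC)]
    have : newDoubt r s = 0 := by simp [newDoubt, T_eq_empty hC]
    rw [this, Nat.cast_zero]
    have : (0 : ℝ) ≤ 2 * configDist o o' + configDist P' o' / 2 ^ L +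
      (L + 2) * cleanArrival k r s := by positivity
    linarith
  · rw [coreInPhase_of_le hW] at herr ⊢
    have := potential_advance_le (φ := errorPot L) (o := o') (κ := 0) (σ := 0) (δ := -1)
      (ε := 1 / 2 ^ L) (ν := L + 2) (ch := ch) (h := h) hw hW hr hP' hsub hro rfl
      (fun q hq b g => by
        simpa using errorPot_keep_le (L := L) (t := s.thr q) (c := s.change q)
          (card_insert_marked_le r s) b g)
      (fun q hq b g => by
        have := errorPot_doubt_le (L := L) (card_insert_marked_le r s) (ht.change_le q hq) b g
        simpa only [ite_self, add_zero] using this)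
      (fun q hq _ g => by
        obtain ⟨e, he⟩ := ht.pow q hq
        simpa using errorPot_renew_le L he g)
      (fun q _ _ g => errorPot_stay_le L _ _ g)
      (fun _ g => by
        have h1 := errorPot_new_le L (insert r s.marked).card g
        have h2 : (0 : ℝ) ≤ if g = true then 1 / 2 ^ L else 0 := by positivity
        linarith)
    have h1 : 1 / 2 ^ L * (predictedIn o' (advance ch h r P' s) : ℝ) ≤
        configDist P' o' / 2 ^ L := by
      rw [div_mul_eq_mul_div, one_mul]
      exact div_le_div_of_nonneg_right herr (by positivity)
    linarith

/-- The number of pages outside `W` and of marked pages that an offline algorithm loads and misses,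
respectively, changes by at most twice the cost of the offline algorithm. -/
theorem card_sdiff_W_add_move_le {o o' : Finset Page} (ho : o.card = o'.card) :
    (o' \ s.W).card + (s.marked \ o').card ≤
      (o \ s.W).card + (s.marked \ o).card + 2 * configDist o o' := by
  have h1 : (o' \ s.W).card ≤ (o \ s.W).card + (o' \ o).card := by
    refine (Finset.card_le_card fun x hx => ?_).trans (Finset.card_union_le _ _)
    simp only [Finset.mem_union, Finset.mem_sdiff] at hx ⊢
    tauto
  have h2 : (s.marked \ o').card ≤ (s.marked \ o).card + (o \ o').card := by
    refine (Finset.card_le_card fun x hx => ?_).trans (Finset.card_union_le _ _)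
    simp only [Finset.mem_union, Finset.mem_sdiff] at hx ⊢
    tauto
  have h3 : (o \ o').card = (o' \ o).card := Finset.card_sdiff_comm ho
  unfold configDist
  omega

/-- Since |o| = k, the pages of `o` outside the new `W` exceed k - |W| by the number of pages of `W`
outside `o`. These were marked, so the old count of marked pages missing from `o` covers them. -/
theorem card_sdiff_W_coreBegin_le {o : Finset Page} (ho : o.card = k) :
    (o \ (coreBegin k r s).W).card + ((coreBegin k r s).marked \ o).card + (k - s.W.card) ≤
      (o \ s.W).card + (s.marked \ o).card + (k - (coreBegin k r s).W.card) := by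
  unfold coreBegin
  split_ifs with hm
  · have hW : k ≤ s.W.card := le_card_W_of_card_marked hm.1
    have hW' : ({ s with stale := s.marked \ s.T, marked := ∅, C := ∅ } : State Page).W =
      s.marked \ s.T := Finset.union_empty _
    rw [hW', Nat.sub_eq_zero_of_le hW]
    have h1 := Finset.card_sdiff_add_card_inter o (s.marked \ s.T)
    have h2 := Finset.card_sdiff_add_card_inter (s.marked \ s.T) o
    have h3 : ((s.marked \ s.T) \ o).card ≤ (s.marked \ o).card :=
      Finset.card_le_card (Finset.sdiff_subset_sdiff Finset.sdiff_subset subset_rfl)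
    have h4 : (s.marked \ s.T).card ≤ k := hm.1 ▸ Finset.card_le_card Finset.sdiff_subset
    rw [Finset.inter_comm] at h2
    simp only [Finset.empty_sdiff, Finset.card_empty]
    omega
  · exact le_rfl

/-- A request outside `W` removes one page from `o \ W`. This pays for a clean arrival if |W| ≥ k,
and for the growth of |W| towards k otherwise. -/
theorem card_sdiff_W_coreInPhase_le {o : Finset Page} (hw : Wf k P s)
    (hr : r ∈ P') (hP' : P'.card = k) (hsub : P' ⊆ insert r P) (hro : r ∈ o) :
    cleanArrival k r s + (o \ (coreInPhase k ch h r P' s).W).card +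
        ((coreInPhase k ch h r P' s).marked \ o).card + (k - s.W.card) ≤
      (o \ s.W).card + (s.marked \ o).card + (k - (coreInPhase k ch h r P' s).W.card) := by
  obtain ⟨h1, h2⟩ := marked_coreInPhase (ch := ch) (h := h) hw hr hP' hsub
  rw [h1, h2, Finset.insert_sdiff_of_mem _ hro]
  unfold cleanArrival
  by_cases hrW : r ∈ s.W
  · rw [Finset.insert_eq_of_mem hrW]
    simp [hrW]
  · have h3 : (o \ insert r s.W).card + 1 = (o \ s.W).card := by
      rw [Finset.sdiff_insert]
      exact Finset.card_erase_add_one (Finset.mem_sdiff.2 ⟨hro, hrW⟩)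
    rw [Finset.card_insert_of_notMem hrW]
    by_cases hW : k ≤ s.W.card
    · rw [if_pos ⟨hW, hrW⟩]; omega
    · rw [if_neg fun h => hW h.1]; omega

end

end Caching.TrustDoubt

/-! ### Summation over time and the competitive ratio. -/

namespace Caching.TrustDoubt

variable {Page : Type u} [DecidableEq Page]

section

variable {k T : ℕ} {ch : Choices Page} {r : ℕ → Page} {P : ℕ → Finset Page}

/-- A new phase starts with k - |marked \ T| ancient pages, at most |T| ≤ |C|; the discarded clean
pages still hold at least one unit each. -/
theorem ancient_add_potential_coreBegin_le {a : Page} {s : State Page} (o : Finset Page)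
    (ht : ThrWf s) :
    ((k - (coreBegin k a s).W.card : ℕ) : ℝ) + potential (costPot k) o (coreBegin k a s) ≤
      ((k - s.W.card : ℕ) : ℝ) + potential (costPot k) o s := by
  unfold coreBegin
  split_ifs with hm
  · rw [potential_eq_zero rfl, add_zero]
    have hW' : ({ s with stale := s.marked \ s.T, marked := ∅, C := ∅ } : State Page).W =
      s.marked \ s.T := Finset.union_empty _
    rw [hW']
    have h1 : s.T.card ≤ s.C.card :=
      Finset.card_image_le.trans (Finset.card_le_card (Finset.filter_subset _ _))
    have h2 := Finset.le_card_sdiff s.T s.marked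
    have h3 : k - (s.marked \ s.T).card ≤ s.C.card := by have := hm.1; omega
    have h4 : ((k - (s.marked \ s.T).card : ℕ) : ℝ) ≤ s.C.card := by exact_mod_cast h3
    have h5 := card_C_le_potential_costPot (k := k) o ht
    have h6 : (0 : ℝ) ≤ (k - s.W.card : ℕ) := Nat.cast_nonneg _
    linarith
  · exact le_rfl

/-- The number of clean pages that have arrived up to time `t`. -/
noncomputable def totalClean (k : ℕ) (ch : Choices Page) (r : ℕ → Page) (P : ℕ → Finset Page)
    (t : ℕ) : ℕ :=
  ∑ i ∈ Finset.range t, cleanArrival k (r (i + 1)) (coreMid k ch r P i)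

/-- The number of times that Trust&Doubt has stopped trusting a predicted eviction up to
time `t`. -/
noncomputable def totalDoubts (k : ℕ) (ch : Choices Page) (r : ℕ → Page) (P : ℕ → Finset Page)
    (t : ℕ) : ℕ :=
  ∑ i ∈ Finset.range t, newDoubt (r (i + 1)) (coreMid k ch r P i)

theorem totalClean_succ (t : ℕ) : totalClean k ch r P (t + 1) =
    totalClean k ch r P t + cleanArrival k (r (t + 1)) (coreMid k ch r P t) :=
  Finset.sum_range_succ _ _

theorem totalDoubts_succ (t : ℕ) : totalDoubts k ch r P (t + 1) =
    totalDoubts k ch r P t + newDoubt (r (t + 1)) (coreMid k ch r P t) :=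
  Finset.sum_range_succ _ _

theorem potential_init (φ : ℕ → ℕ → ℕ → Bool → Bool → ℝ) (o : Finset Page) :
    potential φ o (coreRun k ch r P 0) = 0 := potential_eq_zero rfl

theorem sum_stepCost_add_le (hk : 2 ≤ k) (hP : IsLazyPrediction k T r P) {t : ℕ} (ht : t ≤ T) :
    ∑ i ∈ Finset.range t, stepCost k ch (history r P (i + 1)) (r (i + 1)) (P (i + 1))
        (coreMid k ch r P i) +
      (((k - (coreRun k ch r P t).W.card : ℕ) : ℝ) +
        potential (costPot k) ∅ (coreRun k ch r P t)) ≤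
      k + 5 * (totalClean k ch r P t + totalDoubts k ch r P t : ℕ) := by
  induction t with
  | zero =>
    rw [potential_init]
    simp [coreRun, init, State.W, totalClean, totalDoubts]
  | succ t ih =>
    have hwt := coreMid_wf hk ch hP (t := t) (by omega)
    have h1 := stepCost_add_le (ch := ch) (h := history r P (t + 1)) (r := r (t + 1)) ∅ hwt.1 hwt.2
      (coreMid_marked hk ch hP (by omega)) (IsLazy.mem hP ht) (IsLazy.card hP ht)
      (IsLazy.subset hP ht)
    have h2 := ancient_add_potential_coreBegin_le (k := k) (a := r (t + 1)) ∅
      (coreRun_wf hk ch hP (t := t) (by omega)).2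
    have h3 := ih (by omega)
    have hswitch : potential (costPot k) ∅ (coreRun k ch r P (t + 1)) =
      potential (costPot k) (insert (r (t + 1)) ∅) (coreRun k ch r P (t + 1)) := rfl
    rw [Finset.sum_range_succ, totalClean_succ, totalDoubts_succ, hswitch, coreRun_succ]
    rw [← coreMid] at h2
    push_cast at h1 h3 ⊢
    linarith

/-- From 2t ≤ c ≤ m + t it follows that the threshold t is at most the number m ≤ k of marked pages.
-/
theorem log_thr_le {Q : Finset Page} {s : State Page} (hw : Wf k Q s) (ht : ThrWf s) {q : Page}
    (hq : q ∈ s.C) : Nat.log 2 (s.thr q) ≤ Nat.log 2 k := by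
  refine Nat.log_mono_right ?_
  have h1 := ht.two_le q hq
  have h2 := ht.change_le q hq
  have h3 := hw.marked_le
  omega

theorem totalDoubts_le_size (hk : 2 ≤ k) (hP : IsLazyPrediction k T r P) :
    (totalDoubts k ch r P T : ℝ) ≤ (1 + Nat.log 2 k) * totalClean k ch r P T := by
  have hnonneg : ∀ {t : ℕ}, t ≤ T →
      0 ≤ potential (sizePot (Nat.log 2 k)) ∅ (coreRun k ch r P t) := fun {t} ht => by
    have hwt := coreRun_wf hk ch hP ht
    exact Finset.sum_nonneg fun q hq => sizePot_nonneg (log_thr_le hwt.1 hwt.2 hq) _ _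
  have key : ∀ t ≤ T, totalDoubts k ch r P t +
      potential (sizePot (Nat.log 2 k)) ∅ (coreRun k ch r P t) ≤
        (1 + Nat.log 2 k) * totalClean k ch r P t := by
    intro t ht
    induction t with
    | zero =>
      rw [potential_init]
      simp [totalClean, totalDoubts]
    | succ t ih =>
      have hwt := coreMid_wf hk ch hP (t := t) (by omega)
      have h1 := potential_sizePot_add_le (ch := ch) (h := history r P (t + 1)) (r := r (t + 1))
        (Λ := Nat.log 2 k) ∅ hwt.1 hwt.2
        (IsLazy.mem hP ht) (IsLazy.card hP ht) (IsLazy.subset hP ht)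
      have h2 := potential_coreBegin_le (k := k) (r := r (t + 1)) (hnonneg (t := t) (by omega))
      have h3 := ih (by omega)
      have hswitch : potential (sizePot (Nat.log 2 k)) ∅ (coreRun k ch r P (t + 1)) =
        potential (sizePot (Nat.log 2 k)) (insert (r (t + 1)) ∅) (coreRun k ch r P (t + 1)) := rfl
      rw [totalClean_succ, totalDoubts_succ, hswitch, coreRun_succ]
      rw [← coreMid] at h2
      push_cast
      linarith
  linarith [key T le_rfl, hnonneg (le_refl T)]

theorem sum_Icc_one_eq (f : ℕ → ℕ) (n : ℕ) :
    ∑ t ∈ Finset.Icc 1 n, f t = ∑ i ∈ Finset.range n, f (i + 1) := by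
  induction n with
  | zero => simp
  | succ n ih => rw [Finset.sum_Icc_succ_top (by omega), ih, Finset.sum_range_succ]

theorem scheduleCost_succ (t : ℕ) (o : ℕ → Finset Page) :
    scheduleCost (t + 1) o = scheduleCost t o + configDist (o t) (o (t + 1)) := by
  simp only [scheduleCost, sum_Icc_one_eq, Finset.sum_range_succ, Nat.add_sub_cancel]

theorem predictionError_succ (t : ℕ) (o : ℕ → Finset Page) :
    predictionError (t + 1) P o = predictionError t P o + configDist (P (t + 1)) (o (t + 1)) := by
  simp only [predictionError, sum_Icc_one_eq, Finset.sum_range_succ]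

theorem totalDoubts_le_error (hk : 2 ≤ k) (hP : IsLazyPrediction k T r P) {x₀ : Finset Page}
    {o : ℕ → Finset Page} (ho : IsSchedule k x₀ T r o) (L : ℕ) :
    (totalDoubts k ch r P T : ℝ) ≤ 2 * scheduleCost T o + predictionError T P o / 2 ^ L +
      (L + 2) * totalClean k ch r P T := by
  have hnonneg : ∀ {t : ℕ}, t ≤ T →
      0 ≤ potential (errorPot L) (o t) (coreRun k ch r P t) := fun {t} ht => by
    have hwt := coreRun_wf hk ch hP ht
    exact Finset.sum_nonneg fun q hq => errorPot_nonneg L (hwt.2.change_le q hq) _ _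
  have key : ∀ t ≤ T, totalDoubts k ch r P t +
      potential (errorPot L) (o t) (coreRun k ch r P t) ≤
        2 * scheduleCost t o + predictionError t P o / 2 ^ L +
          (L + 2) * totalClean k ch r P t := by
    intro t ht
    induction t with
    | zero =>
      rw [potential_init]
      simp [totalClean, totalDoubts, scheduleCost, predictionError]
    | succ t ih =>
      have hwt := coreMid_wf hk ch hP (t := t) (by omega)
      have h1 := potential_errorPot_add_le (ch := ch) (h := history r P (t + 1)) (r := r (t + 1))
        (o := o t) L hwt.1 hwt.2 (coreMid_marked hk ch hP (by omega))
        (IsLazy.mem hP ht) (IsLazy.card hP ht) (IsLazy.subset hP ht)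
        (ho.serves (t + 1) (by omega) ht)
      have h2 := potential_coreBegin_le (k := k) (r := r (t + 1)) (hnonneg (t := t) (by omega))
      have h3 := ih (by omega)
      rw [totalClean_succ, totalDoubts_succ, scheduleCost_succ, predictionError_succ, coreRun_succ]
      rw [← coreMid] at h2
      push_cast
      rw [add_div]
      linarith
  linarith [key T le_rfl, hnonneg (le_refl T)]

theorem totalClean_le (hk : 2 ≤ k) (hP : IsLazyPrediction k T r P) {x₀ : Finset Page}
    {o : ℕ → Finset Page} (ho : IsSchedule k x₀ T r o) :
    totalClean k ch r P T ≤ 2 * scheduleCost T o := by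
  -- The second bound must be carried along: the slack k - |W| in the first is positive while there
  -- are ancient pages. It vanishes whenever clean pages can arrive.
  suffices key : ∀ t ≤ T, totalClean k ch r P t + (o t \ (coreRun k ch r P t).W).card +
      ((coreRun k ch r P t).marked \ o t).card ≤
        2 * scheduleCost t o + (k - (coreRun k ch r P t).W.card) ∧
      totalClean k ch r P t ≤ 2 * scheduleCost t o from (key T le_rfl).2
  intro t ht
  induction t with
  | zero =>
    have := ho.card_eq 0 (by omega)
    simp [coreRun, init, State.W, totalClean, this]
  | succ t ih =>
    obtain ⟨h1, h2⟩ := ih (by omega)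
    have hw := (coreMid_wf hk ch hP (t := t) (by omega)).1
    have h3 := card_sdiff_W_coreBegin_le (k := k) (r := r (t + 1)) (s := coreRun k ch r P t)
      (ho.card_eq t (by omega))
    have h4 := card_sdiff_W_add_move_le (s := coreMid k ch r P t)
      ((ho.card_eq t (by omega)).trans (ho.card_eq (t + 1) ht).symm)
    have h5 := card_sdiff_W_coreInPhase_le (ch := ch) (h := history r P (t + 1)) hw
      (IsLazy.mem hP ht) (IsLazy.card hP ht) (IsLazy.subset hP ht)
      (ho.serves (t + 1) (by omega) ht)
    rw [← coreMid] at h3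
    rw [← coreRun_succ] at h5
    have h6 := (marked_coreInPhase (ch := ch) (h := history r P (t + 1)) hw
      (IsLazy.mem hP ht) (IsLazy.card hP ht) (IsLazy.subset hP ht)).2
    rw [← coreRun_succ] at h6
    have h7 : (coreMid k ch r P t).W.card ≤ (coreRun k ch r P (t + 1)).W.card := by
      rw [h6]; exact Finset.card_le_card (Finset.subset_insert _ _)
    rw [totalClean_succ, scheduleCost_succ]
    refine ⟨by omega, ?_⟩
    by_cases hc : k ≤ (coreMid k ch r P t).W.card
    · omega
    · have : cleanArrival k (r (t + 1)) (coreMid k ch r P t) = 0 := by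
        simp [cleanArrival, hc]
      omega

end

/-- A number of doubts that is bounded in terms of the cache size and of the prediction error, with
`n` clean pages, is of the order of the competitive ratio. -/
theorem five_mul_le {k : ℕ} (hk : 2 ≤ k) {n d O η : ℝ} (hO : 0 ≤ O) (hη : 0 ≤ η) (hn : n ≤ 2 * O)
    (h₁ : d ≤ (1 + Nat.log 2 k) * n)
    (h₂ : ∀ L : ℕ, d ≤ 2 * O + η / 2 ^ L + (L + 2) * n) :
    5 * (n + d) ≤ 55 * min (1 + Real.log (1 + η / O)) (Real.log k) * O := by
  have hlog2 : (0.69 : ℝ) < Real.log 2 := by linarith [Real.log_two_gt_d9]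
  have hk' : (2 : ℝ) ≤ k := by exact_mod_cast hk
  -- For O = 0 the right side vanishes whatever the quotient by zero is, and `n` ≤ 0 forces `d` ≤ 0
  -- by the size bound.
  rcases hO.eq_or_lt with rfl | hO
  · have h3 : (1 + Nat.log 2 k : ℝ) * n ≤ 0 := mul_nonpos_of_nonneg_of_nonpos (by positivity)
      (by linarith)
    linarith
  rw [mul_assoc, min_mul_of_nonneg _ _ hO.le, mul_min_of_nonneg _ _ (by norm_num : (0 : ℝ) ≤ 55)]
  refine le_min ?_ ?_
  · set l := Real.log (1 + η / O) with hl
    have hl0 : 0 ≤ l := Real.log_nonneg (by have := div_nonneg hη hO.le; linarith)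
    -- L is log₂(1 + η/O) rounded up, and 1/log 2 < 3/2. Then n + d ≤ 2O + (2O + O + (3l/2 + 3)·2O)
    -- = (11 + 3l)O, and five times this gives the constant 55.
    obtain ⟨L, hL₁, hL₂⟩ : ∃ L : ℕ, 1 + η / O ≤ 2 ^ L ∧ (L : ℝ) ≤ 3 / 2 * l + 1 := by
      refine ⟨⌈l / Real.log 2⌉₊, ?_, ?_⟩
      · have h3 : l ≤ ⌈l / Real.log 2⌉₊ * Real.log 2 := by
          rw [← div_le_iff₀ (by linarith)]; exact Nat.le_ceil _
        rw [← Real.log_pow] at h3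
        exact (Real.log_le_log_iff (by have := div_nonneg hη hO.le; linarith) (by positivity)).1 h3
      · have h3 := (Nat.ceil_lt_add_one (div_nonneg hl0 (by linarith : 0 ≤ Real.log 2))).le
        have h4 : l / Real.log 2 ≤ 3 / 2 * l := by
          rw [div_le_iff₀ (by linarith)]; nlinarith
        linarith
    have h3 : η / 2 ^ L ≤ O := by
      rw [div_le_iff₀ (by positivity)]
      have : η / O ≤ 2 ^ L := by linarith
      rw [div_le_iff₀ hO] at this
      linarith
    have h4 : ((L : ℝ) + 2) * n ≤ (3 / 2 * l + 3) * (2 * O) :=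
      (mul_le_mul_of_nonneg_left hn (by positivity)).trans
        (mul_le_mul_of_nonneg_right (by linarith) (by linarith))
    have h5 := h₂ L
    have h6 : 0 ≤ l * O := mul_nonneg hl0 hO.le
    nlinarith
  · have h3 : (Nat.log 2 k : ℝ) * Real.log 2 ≤ Real.log k := by
      rw [← Real.log_pow]
      refine Real.log_le_log (by positivity) ?_
      exact_mod_cast Nat.pow_log_le_self 2 (by omega)
    have h4 : Real.log 2 ≤ Real.log k := Real.log_le_log (by norm_num) hk'
    -- As log 2 > 0.69 and k ≥ 2, the summand 2 is below 2.9 log k and the other below 1.45 log k.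
    have h5 : (2 + Nat.log 2 k : ℝ) ≤ 5 * Real.log k := by
      have : (0 : ℝ) ≤ Nat.log 2 k := Nat.cast_nonneg _
      nlinarith
    have h6 : (2 + Nat.log 2 k : ℝ) * n ≤ 5 * Real.log k * (2 * O) :=
      (mul_le_mul_of_nonneg_left hn (by positivity)).trans
        (mul_le_mul_of_nonneg_right h5 (by linarith))
    have h7 : 0 ≤ Real.log k * O := mul_nonneg (by linarith) hO.le
    nlinarith

end Caching.TrustDoubt

open Caching.TrustDoubt in
theorem mainTheorem1 :
    ∃ c : ℝ, 0 < c ∧ ∀ k : ℕ, 2 ≤ k → ∃ α : ℝ, 0 ≤ α ∧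
      ∀ (Page : Type u) [DecidableEq Page] (ch : Caching.TrustDoubt.Choices Page)
        (x₀ : Finset Page) (T : ℕ) (r : ℕ → Page) (P : ℕ → Finset Page),
        x₀.card = k → Caching.IsLazyPrediction k T r P →
        (∀ t ≤ T, ∀ z ∈ (Caching.TrustDoubt.run k ch x₀ r P t).support,
          ∃ s : Caching.TrustDoubt.State Page, z = some s ∧ s.cache.card = k ∧
            (1 ≤ t → r t ∈ s.cache)) ∧
        ∀ o : ℕ → Finset Page, Caching.IsSchedule k x₀ T r o →
          Caching.TrustDoubt.expectedCost k ch x₀ r P T ≤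
            ENNReal.ofReal
              (c * min (1 + Real.log (1 + (Caching.predictionError T P o : ℝ) /
                      (Caching.scheduleCost T o : ℝ)))
                    (Real.log k) * (Caching.scheduleCost T o : ℝ) + α) := by
  -- The additive constant k pays for the k ancient pages of the first phase.
  refine ⟨55, by norm_num, fun k hk => ⟨k, Nat.cast_nonneg k, ?_⟩⟩
  intro Page _ ch x₀ T r P hx₀ hP
  refine ⟨fun t ht z hz => ?_, fun o ho => ?_⟩
  · obtain ⟨s, hzs, hs⟩ := exists_reachable_of_mem_support hk hx₀ hP ht hz
    exact ⟨s, hzs, hs.inv.card_cache, hs.mem⟩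
  · refine (expectedCost_le hk hx₀ hP).trans (ENNReal.ofReal_le_ofReal ?_)
    have h1 := sum_stepCost_add_le (ch := ch) hk hP (le_refl T)
    have h2 := card_C_le_potential_costPot (k := k) ∅ (coreRun_wf hk ch hP (le_refl T)).2
    have h3 : (0 : ℝ) ≤ (k - (coreRun k ch r P T).W.card : ℕ) := Nat.cast_nonneg _
    have h4 : (0 : ℝ) ≤ (coreRun k ch r P T).C.card := Nat.cast_nonneg _
    have h5 := five_mul_le (n := totalClean k ch r P T) (d := totalDoubts k ch r P T)
      (O := Caching.scheduleCost T o) (η := Caching.predictionError T P o) hk (Nat.cast_nonneg _)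
      (Nat.cast_nonneg _) (by exact_mod_cast totalClean_le hk hP ho)
      (totalDoubts_le_size hk hP) (totalDoubts_le_error hk hP ho)
    push_cast at h1
    linarith
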